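/- **Setting.** Let $\lambda$ be a nonempty partition and $N\ge|\lambda|$. An $N$-standard set-valued tableau of shape $\lambda$ assigns to each box of $\lambda$ a nonempty subset of $\{1,\dots,N\}$ such that each of $1,\dots,N$ is used exactly once and every selection of one value from each box is semistandard (strictly increasing down columns, weakly increasing along rows). For $0\le k\le N$, an $N^{(k)}$-standard set-valued pre-tableau $S$ of shape $\lambda$ assigns to each box a possibly empty subset of $\{k+1,\dots,N\}$ such that each of $k+1,\dots,N$ is used exactly once; if $S(r,c)\ne\emptyset$ and $b\in\{(r+1,c),(r,c+1)\}$ is a box of $\lambda$, then $S(b)\ne\emptyset$ and $\max S(r,c)<\min S(b)$; and the set $\lambda\setminus S$ of boxes with $S(r,c)=\emptyset$ has at most $k$ elements. Let $\mathcal{SVT}$ be the set of all such triples $(\lambda,N,S)$ ($k$ is determined by $N$ and $S$), and let $\mathsf{SVT}(\lambda,N,S)$ be the set of $N$-standard set-valued tableaux $T$ of shape $\lambda$ with $S(b)\subseteq T(b)$ for every box $b$. **Generation.** For a finite set $A$ of boxes let $NW(A)$ be the set of boxes of $A$ that have no other box of $A$ weakly north-west of them. A hook walk in $A$ starts at a uniformly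 random box of $A$ and moves repeatedly to a uniformly random box of $A$ that is strictly to the right in the same row or strictly below in the same column, until there is none. The algorithm $\mathsf{SVGen}(\lambda,N,S)$ starts with $T=S$; if $k=N$, it first puts $N$ into the box in which a hook walk in $\lambda$ ends. Then it inserts the remaining values $M$ (those of $1,\dots,k$, without $N$ if $k=N$) in decreasing order: if $\lambda'$ is the set of currently empty boxes, then with probability $(M-|\lambda'|)/M$ the value $M$ is added to a uniformly random box of $NW(\lambda\setminus\lambda')$, and otherwise it is put into the box in which a hook walk in $\lambda'$ ends. Let $p(T)$ be the probability that the output is $T\in\mathsf{SVT}(\lambda,N,S)$. **Chain.** $\mathcal{MC}_{\mathsf{SVT}}(\lambda,N,S)$ is the Markov chain on $\mathsf{SVT}(\lambda,N,S)$ with transition matrix $P(T,F)=p(F)\min\{1,p(T)/p(F)\}$ for $F\ne T$ and $P(T,T)=1-\sum_{R\ne T}P(T,R)$. Let $U$ be the uniform distribution on $\mathsf{SVT}(\lambda,N,S)$, $d_{TV}(\mu,\nu)=\max_A|\mu(A)-\nu(A)|$, and $t_{\rm mix}(\varepsilon)=\min\{t:\max_T d_{TV}(P^t(T,\cdot),U)\le\varepsilon\}$.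 **Theorem 5.7.** Let $C\in\mathbb N$, and let $\mathcal F\subseteq\mathcal{SVT}$ be either the class of all triples with $|\lambda\setminus S|\le C$ or the class of all triples with $k-|\lambda\setminus S|\le C$. Then: 1. (Rapid mixing.) There is a polynomial $h$ such that, for all $(\lambda,N,S)\in\mathcal F$ and all $\varepsilon>0$, $t_{\rm mix}(\varepsilon)$ exists and $t_{\rm mix}(\varepsilon)\le h(|\lambda\setminus S|,k,\varepsilon^{-1})$. 2. ($\mathcal{MC}_{\mathsf{SVT}}$ is an FPAUS.) There are a randomized algorithm and a polynomial $q$ such that, for all $(\lambda,N,S)\in\mathcal F$ and all $\delta\in(0,1]$, the algorithm on input $(\lambda,N,S)$, $k$ and $\delta$ always returns an element of $\mathsf{SVT}(\lambda,N,S)$; the law $\Gamma$ of its output is the law of $\mathcal{MC}_{\mathsf{SVT}}(\lambda,N,S)$ after some number $t$ of steps, started from an output of $\mathsf{SVGen}(\lambda,N,S)$; $d_{TV}(\Gamma,U)\le\delta$; and the running time is always at most $q(|\lambda\setminus S|,k,\log\delta^{-1})$. Algorithms are programs for a random-access machine with unit-cost addition, truncated subtraction, array access, tests and counted loops (no multiplication),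 with an instruction drawing a uniformly random element of $\{0,\dots,e-1\}$, and with random access to $\lambda$ and $S$; $\delta$ is given as $\lceil\log_2\delta^{-1}\rceil$, and the output is $S$ together with the row and column of each of the values $1,\dots,k$. -/

import Mathlib

open scoped NNReal ENNReal

noncomputable section

namespace SetValued

/-! ### Set-valued tableaux

Boxes of a Young diagram are pairs (row, column), both counted from 0. Entries are positive integers. -/

/-- An assignment of a finite set of numbers to each box of the diagram `Y`. -/
abbrev Filling (Y : YoungDiagram) : Type := Y.cells → Finset ℕ

/-- `d` is the box directly below `c` or directly to the right of `c`. -/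
def IsNext {Y : YoungDiagram} (c d : Y.cells) : Prop :=
  d.1 = (c.1.1 + 1, c.1.2) ∨ d.1 = (c.1.1, c.1.2 + 1)

/-- A single-valued filling is semistandard: columns increase strictly from top to bottom, rows
increase weakly from left to right. -/
def IsSemistandard {Y : YoungDiagram} (f : Y.cells → ℕ) : Prop :=
  (∀ c d : Y.cells, c.1.2 = d.1.2 → c.1.1 < d.1.1 → f c < f d) ∧
  (∀ c d : Y.cells, c.1.1 = d.1.1 → c.1.2 ≤ d.1.2 → f c ≤ f d)

/-- `N`-standard set-valued tableaux of shape `Y`: every box carries a nonempty subset of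
`{1, …, N}`, every selection of one value per box is semistandard, and each of `1, …, N` occurs
exactly once. -/
def IsStandardSV (Y : YoungDiagram) (N : ℕ) (T : Filling Y) : Prop :=
  (∀ c, T c ⊆ Finset.Icc 1 N) ∧ (∀ c, (T c).Nonempty) ∧
  (∀ f : Y.cells → ℕ, (∀ c, f c ∈ T c) → IsSemistandard f) ∧
  (∀ v ∈ Finset.Icc 1 N, ∃! c, v ∈ T c)

/-- The boxes left empty by a filling. For a pre-tableau `S` of shape `λ` this is `λ ∖ S`. -/
def emptyBoxes {Y : YoungDiagram} (T : Filling Y) : Finset Y.cells :=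
  Finset.univ.filter fun c => T c = ∅

/-- The boxes which carry at least one value. -/
def filledBoxes {Y : YoungDiagram} (T : Filling Y) : Finset Y.cells :=
  Finset.univ.filter fun c => T c ≠ ∅

/-- Standard set-valued pre-tableaux of shape `Y` in which exactly the values `k + 1, …, N` have
been placed. -/
def IsPreTableau (Y : YoungDiagram) (N k : ℕ) (S : Filling Y) : Prop :=
  (∀ c, S c ⊆ Finset.Icc (k + 1) N) ∧
  (∀ v ∈ Finset.Icc (k + 1) N, ∃! c, v ∈ S c) ∧
  (∀ c d, IsNext c d → S c ≠ ∅ → S d ≠ ∅) ∧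
  (∀ c d, IsNext c d → ∀ a ∈ S c, ∀ b ∈ S d, a < b) ∧
  (emptyBoxes S).card ≤ k

/-- The triples `(λ, N, S)`: `λ = Y` is a (nonempty) partition with at most `N` boxes and `S` is a
pre-tableau of shape `λ` in which exactly the values `k + 1, …, N` have been placed, for some
`0 ≤ k ≤ N`. The number `k` is determined by `N` and `S`. -/
structure Triple where
  Y : YoungDiagram
  N : ℕ
  k : ℕ
  S : Filling Y
  nonempty : Y.cells.Nonempty
  card_le : Y.cells.card ≤ N
  k_le : k ≤ N
  pre : IsPreTableau Y N k S

/-- The number `|λ ∖ S|` of empty boxes. -/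
def Triple.m (x : Triple) : ℕ := (emptyBoxes x.S).card

open scoped Classical in
/-- `SVT(λ, N, S)`: the `N`-standard set-valued tableaux of shape `λ` that contain `S`. -/
def SVT (x : Triple) : Finset (Filling x.Y) :=
  (Fintype.piFinset fun _ : x.Y.cells => (Finset.Icc 1 x.N).powerset).filter
    fun T => IsStandardSV x.Y x.N T ∧ ∀ c, x.S c ⊆ T c

/-! ### The random generation algorithm -/

/-- Draw an element of `A` uniformly at random and continue with `f`; if `A` is empty, the result
is `x`. -/
def pick {α β : Type} (A : Finset α) (x : PMF β) (f : α → PMF β) : PMF β :=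
  if h : A.Nonempty then (PMF.uniformOfFinset A h).bind f else x

/-- A coin that shows `true` with probability `p`. -/
def coin (p : ℝ≥0) (hp : p ≤ 1) : PMF Bool :=
  PMF.ofFintype (fun b => bif b then (p : ℝ≥0∞) else ((1 - p : ℝ≥0) : ℝ≥0∞)) (by
    simp only [Fintype.sum_bool, cond_true, cond_false]
    exact_mod_cast add_tsub_cancel_of_le hp)

/-- The boxes of `A` strictly to the right of `c` in its row or strictly below `c` in its column. -/
def hook {Y : YoungDiagram} (A : Finset Y.cells) (c : Y.cells) : Finset Y.cells :=
  A.filter fun d => (d.1.1 = c.1.1 ∧ c.1.2 < d.1.2) ∨ (d.1.2 = c.1.2 ∧ c.1.1 < d.1.1)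

/-- The hook walk from `c`: as long as the hook of the current box is nonempty, move to a uniformly
random box of it. The first argument bounds the number of moves; a walk in `A` makes fewer than
`A.card` moves. -/
def hookWalk {Y : YoungDiagram} (A : Finset Y.cells) : ℕ → Y.cells → PMF Y.cells
  | 0, c => PMF.pure c
  | n + 1, c => pick (hook A c) (PMF.pure c) (hookWalk A n)

/-- Put `v` into the box reached by the hook walk in `A` from a uniformly random box of `A`. (This
is never called on an empty `A` with positive probability.) -/
def hookInsert {Y : YoungDiagram} (A : Finset Y.cells) (v : ℕ) (T : Filling Y) : PMF (Filling Y) :=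
  pick A (PMF.pure T) fun c =>
    (hookWalk A A.card c).bind fun d => PMF.pure (Function.update T d {v})

/-- The boxes of `A` with no other box of `A` weakly to the north-west. -/
def NW {Y : YoungDiagram} (A : Finset Y.cells) : Finset Y.cells :=
  A.filter fun c => ∀ d ∈ A, d.1.1 ≤ c.1.1 → d.1.2 ≤ c.1.2 → d = c

/-- One round: insertion of the value `M`, where the values larger than `M` are already placed. With
probability `(M - |λ'|) / M`, where `λ'` is the set of empty boxes, the value joins a uniformly
random box of `NW` of the filled boxes; otherwise it goes to an empty box found by a hook walk. -/
def svStep {Y : YoungDiagram} (M : ℕ) (T : Filling Y) : PMF (Filling Y) :=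
  (coin (((M - (emptyBoxes T).card : ℕ) : ℝ≥0) / (M : ℝ≥0))
    (div_le_one_of_le₀ (Nat.cast_le.2 (Nat.sub_le _ _)) (zero_le))).bind fun b =>
      if b then
        pick (NW (filledBoxes T)) (PMF.pure T) fun c => PMF.pure (Function.update T c (T c ∪ {M}))
      else hookInsert (emptyBoxes T) M T

/-- Insert the values `M, M - 1, …, 1`. -/
def svLoop {Y : YoungDiagram} : ℕ → Filling Y → PMF (Filling Y)
  | 0, T => PMF.pure T
  | M + 1, T => (svStep (M + 1) T).bind (svLoop M)

/-- The law of the output of `SVGen` on `(λ, N, k, S)`. If nothing is placed yet (`k = N`), the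
value `N` is put into a box found by a hook walk in `λ` first. -/
def svGen (x : Triple) : PMF (Filling x.Y) :=
  if x.k = x.N then (hookInsert Finset.univ x.N x.S).bind (svLoop (x.N - 1))
  else svLoop x.k x.S

/-! ### Markov chains -/

/-- Total variation distance `max_A |μ(A) - ν(A)|` on a finite set. -/
def tvDist {X : Type} [Fintype X] (μ ν : X → ℝ) : ℝ :=
  ⨆ A : Finset X, |∑ y ∈ A, μ y - ∑ y ∈ A, ν y|

/-- `d(t) = max_x d_TV(P^t(x, ·), π)`. -/
def distStat {X : Type} [Fintype X] [DecidableEq X] (P : Matrix X X ℝ) (π : X → ℝ) (t : ℕ) : ℝ :=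
  ⨆ y : X, tvDist ((P ^ t) y) π

/-- The mixing time `min {t : d(t) ≤ ε}`; it is meaningful if this set is nonempty. -/
def mixingTime {X : Type} [Fintype X] [DecidableEq X] (P : Matrix X X ℝ) (π : X → ℝ) (ε : ℝ) : ℕ :=
  sInf {t : ℕ | distStat P π t ≤ ε}

/-- The uniform distribution. -/
def unif (X : Type) [Fintype X] : X → ℝ := fun _ => 1 / (Fintype.card X : ℝ)

/-- The probability that `SVGen` returns the tableau `T`. -/
def probSVG (x : Triple) (T : SVT x) : ℝ := (svGen x T.1).toReal

/-- The transition matrix of the chain `MC_SVT(λ, N, S)` on `SVT(λ, N, S)`: the Metropolis chain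
with uniform target for the proposal that runs `SVGen` afresh. -/
def mcSVT (x : Triple) : Matrix (SVT x) (SVT x) ℝ := fun T F =>
  if F ≠ T then probSVG x F * min 1 (probSVG x T / probSVG x F)
  else 1 - ∑ R ∈ Finset.univ.filter (fun R => R ≠ T),
    probSVG x R * min 1 (probSVG x T / probSVG x R)

/-- The chains `MC_SVT(λ, N, S)` mix rapidly on a class of triples: one polynomial in `|λ ∖ S|`, `k`
and `ε⁻¹` bounds the mixing times, with respect to the uniform distribution, of all of them. -/
def RapidlyMixing (F : Set Triple) : Prop :=
  ∃ p : MvPolynomial (Fin 3) ℕ, ∀ x ∈ F, ∀ ε : ℝ, 0 < ε →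
    (∃ t : ℕ, distStat (mcSVT x) (unif (SVT x)) t ≤ ε) ∧
    (mixingTime (mcSVT x) (unif (SVT x)) ε : ℝ) ≤
      MvPolynomial.aeval ![(x.m : ℝ), (x.k : ℝ), ε⁻¹] p

/-! ### Randomised random-access programs

A machine has finitely many arrays of natural numbers (with arbitrary indices), random access to the
input `(λ, N, S)`, counted loops, and unit-cost instructions. Arithmetic is restricted to addition and
truncated subtraction (no multiplication), so that numbers grow by `O(1)` bits per step and unit cost
is an honest measure of time. The random instruction draws uniformly from `{0, …, e - 1}`. -/

/-- Expressions. -/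
inductive Expr : Type
  /-- a constant -/
  | lit (n : ℕ) : Expr
  /-- the content of array `a` at index `i` -/
  | get (a : ℕ) (i : Expr) : Expr
  | add (e f : Expr) : Expr
  /-- truncated subtraction -/
  | sub (e f : Expr) : Expr
  /-- status of the box `(r, c)`: 0 outside the shape, 1 if `S(r, c)` is empty, 2 otherwise -/
  | box (r c : Expr) : Expr
  /-- 1 if `v ∈ S(r, c)`, else 0 -/
  | entry (r c v : Expr) : Expr

/-- Programs. -/
inductive Prog : Type
  | skip : Prog
  /-- `a[i] := e` -/
  | set (a : ℕ) (i e : Expr) : Prog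
  /-- `a[i] :=` a uniformly random element of `{0, …, e - 1}` (0 if `e = 0`) -/
  | rand (a : ℕ) (i e : Expr) : Prog
  | seq (p q : Prog) : Prog
  /-- if `e ≠ 0` then `p` else `q` -/
  | ite (e : Expr) (p q : Prog) : Prog
  /-- evaluate `e` once, then run `p` that many times -/
  | loop (e : Expr) (p : Prog) : Prog

/-- The memory: array name, index, content. -/
abbrev Mem : Type := ℕ → ℕ → ℕ

/-- The value of an expression, on the input triple `x` in memory `s`. -/
def Expr.val (x : Triple) (s : Mem) : Expr → ℕ
  | lit n => n
  | get a i => s a (i.val x s)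
  | add e f => e.val x s + f.val x s
  | sub e f => e.val x s - f.val x s
  | box r c =>
      if h : (r.val x s, c.val x s) ∈ x.Y.cells then
        if x.S ⟨(r.val x s, c.val x s), h⟩ = ∅ then 1 else 2
      else 0
  | entry r c v =>
      if h : (r.val x s, c.val x s) ∈ x.Y.cells then
        if v.val x s ∈ x.S ⟨(r.val x s, c.val x s), h⟩ then 1 else 0
      else 0

/-- The time to evaluate an expression: one unit per operation in it. -/
def Expr.cost : Expr → ℕ
  | lit _ => 1
  | get _ i => i.cost + 1
  | add e f => e.cost + f.cost + 1
  | sub e f => e.cost + f.cost + 1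
  | box r c => r.cost + c.cost + 1
  | entry r c v => r.cost + c.cost + v.cost + 1

/-- Overwrite the entry of array `a` at index `i` by `v`. -/
def Mem.write (s : Mem) (a i v : ℕ) : Mem := Function.update s a (Function.update (s a) i v)

/-- Run `f` `n` times in a row, adding up the times, with one additional unit per round. -/
def iter (f : Mem → PMF (Mem × ℕ)) : ℕ → Mem → PMF (Mem × ℕ)
  | 0, s => PMF.pure (s, 0)
  | n + 1, s => (f s).bind fun r => (iter f n r.1).bind fun q => PMF.pure (q.1, r.2 + 1 + q.2)

/-- The joint law of the final memory and the running time of a program started in memory `s`, on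
the input triple `x`. -/
def Prog.run (x : Triple) : Prog → Mem → PMF (Mem × ℕ)
  | skip, s => PMF.pure (s, 1)
  | set a i e, s => PMF.pure (s.write a (i.val x s) (e.val x s), i.cost + e.cost + 1)
  | rand a i e, s =>
      pick (Finset.range (e.val x s))
        (PMF.pure (s.write a (i.val x s) 0, i.cost + e.cost + 1))
        fun u => PMF.pure (s.write a (i.val x s) u, i.cost + e.cost + 1)
  | seq p q, s =>
      (p.run x s).bind fun r => (q.run x r.1).bind fun w => PMF.pure (w.1, r.2 + w.2)
  | ite e p q, s =>
      (if e.val x s ≠ 0 then p.run x s else q.run x s).bind fun r =>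
        PMF.pure (r.1, e.cost + 1 + r.2)
  | loop e p, s =>
      (iter (fun s' => p.run x s') (e.val x s) s).bind fun r => PMF.pure (r.1, e.cost + 1 + r.2)

/-- The initial memory: array 0 starts with `k`, `N` and the accuracy parameter `b`; everything else
is 0. -/
def initMem (x : Triple) (b : ℕ) : Mem := fun a i =>
  if a = 0 then (if i = 0 then x.k else if i = 1 then x.N else if i = 2 then b else 0) else 0

/-- The filling that a final memory describes: `S` together with each value `v ≤ k` put into the box
whose row and column are found at index `v` of arrays 1 and 2. -/
def output (x : Triple) (s : Mem) : Filling x.Y := fun c =>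
  x.S c ∪ (Finset.Icc 1 x.k).filter fun v => (s 1 v, s 2 v) = c.1

/-- The bias parameter `δ` is handed to a program as the integer `⌈log₂ δ⁻¹⌉`. -/
def biasInput (δ : ℝ) : ℕ := ⌈Real.logb 2 δ⁻¹⌉₊

/-- The law of the final memory and the running time on the input `(λ, N, S)` and `δ`. -/
def Prog.law (p : Prog) (x : Triple) (δ : ℝ) : PMF (Mem × ℕ) :=
  p.run x (initMem x (biasInput δ))

/-- The law of the filling returned by the program on the input `(λ, N, S)` and `δ`. -/
def Prog.sample (p : Prog) (x : Triple) (δ : ℝ) : PMF (Filling x.Y) :=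
  (p.law x δ).map fun r => output x r.1

/-- `MC_SVT` is a fully polynomial almost uniform sampler on a class of triples: there is a program
which, for every `(λ, N, S)` in the class and every `δ ∈ (0, 1]`, always returns an element of
`SVT(λ, N, S)`; its output is the state of the chain `MC_SVT(λ, N, S)` after some number `t` of steps
from a start drawn by `SVGen`; the law of the output is within `δ` of uniform in total variation; and
the running time never exceeds a fixed polynomial in `|λ ∖ S|`, `k` and `log δ⁻¹`. -/
def IsFPAUS (F : Set Triple) : Prop :=
  ∃ (prog : Prog) (p : MvPolynomial (Fin 3) ℕ), ∀ x ∈ F, ∀ δ : ℝ, 0 < δ → δ ≤ 1 →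
    (∀ T ∈ (prog.sample x δ).support, T ∈ SVT x) ∧
    (∃ t : ℕ, ∀ T : SVT x,
      (prog.sample x δ T.1).toReal = Matrix.vecMul (probSVG x) (mcSVT x ^ t) T) ∧
    tvDist (fun T : SVT x => (prog.sample x δ T.1).toReal) (unif (SVT x)) ≤ δ ∧
    (∀ r ∈ (prog.law x δ).support,
      (r.2 : ℝ) ≤ MvPolynomial.aeval ![(x.m : ℝ), (x.k : ℝ), Real.log δ⁻¹] p)

/-- The triples with `|λ ∖ S| ≤ C`. -/
def fixEmpty (C : ℕ) : Set Triple := {x | x.m ≤ C}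

/-- The triples with `k - |λ ∖ S| ≤ C`. -/
def fixExcess (C : ℕ) : Set Triple := {x | x.k ≤ x.m + C}

end SetValued

end

open scoped NNReal ENNReal

noncomputable section

namespace SetValued

/-! ### Tableaux, truncations and admissible boxes. -/

section Tableaux

variable {Y : YoungDiagram} {N M : ℕ} {T : Filling Y} {c d : Y.cells}

/-! A tableau `T` records its own history: once the values above `M` are placed, the filling must be
`trunc M T`. Hence p(T) is a single product over the insertions. By Greene, Nijenhuis and Wilf
(`sum_hookWalk`), a hook walk in an empty shape A ends in the corner c with probability H(A) / (|A|
H(A \ c)), where H is the product of the hook lengths. These factors telescope together with those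
of the coins. All that depends on `T` is w(T), the product over the joining steps of the number of
north-west boxes on offer, so p(T) w(T) is a constant `Triple.base` (`genStep_apply`,
`genLoop_apply`, `probSVG_mul_weight`).

Write m for the number of empty boxes of S. Both classes satisfy |SVT| p(T) ≥ (k+1)^(-C) for every T
(`one_le_card_mul_prob`). If m ≤ C, this follows from |SVT| p(T) ≥ w(T) p(T) = base ≥ (k+1)^(-m).
Here w(T) ≤ |SVT| because the step with most choices can be repeated: empty the shape down to the
one at that step and make all k-m joins there (`prod_stepWeight_le`, `pow_le_card_completions`). If
k-m ≤ C, then w ≤ (k+1)^C, while 1 = ∑ p ≤ ∑ p w = |SVT| base.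

Off the diagonal the chain has entries min(p(T), p(F)), so it is symmetric and the uniform law is
stationary. Each row dominates the uniform law times 1/R with R = (k+1)^C (`mcSVT_ge`). By Doeblin's
argument the distance after t steps is at most (1 - 1/R)^t (`tvDist_chain_le`).

For the sampler no probability has to be computed: p(T)/p(F) = w(F)/w(T), so a proposal F is
accepted if a uniform u < w(T) satisfies u < w(F) (`metStep_apply`). Weights are accumulated by
additions. The program is compared with the abstract process by couplings (`Lift`), which at the end
give an equality of laws (`sample_sampler`). All its loop lengths are functions of k and the
accuracy parameter, which bounds every run deterministically (`Prog.cost_le_bound`). -/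

theorem IsNext.le (h : IsNext c d) : c ≤ d := by
  change c.1 ≤ d.1
  rcases h with h | h <;> rw [h, Prod.le_def] <;> simp

theorem IsNext.ne (h : IsNext c d) : c ≠ d := by
  rintro rfl
  rcases h with h | h <;> simpa using congrArg (fun p : ℕ × ℕ => p.1 + p.2) h

/-- A property that passes from each box to the next ones passes to all boxes to the south-east. -/
theorem propagate {P : Y.cells → Prop} (h : ∀ c d, IsNext c d → P c → P d) (hcd : c ≤ d)
    (hc : P c) : P d := by
  obtain ⟨n, hn⟩ : ∃ n, n = (d.1.1 - c.1.1) + (d.1.2 - c.1.2) := ⟨_, rfl⟩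
  induction n generalizing d with
  | zero =>
    have h1 : c.1.1 ≤ d.1.1 ∧ c.1.2 ≤ d.1.2 := hcd
    have : d = c := Subtype.ext (Prod.ext (by omega) (by omega))
    exact this ▸ hc
  | succ n ih =>
    have h1 : c.1.1 ≤ d.1.1 ∧ c.1.2 ≤ d.1.2 := hcd
    obtain ⟨⟨i, j⟩, hd⟩ := d
    simp only at h1 hn
    -- Step back by one box, upwards while `d` is in a lower row and to the left otherwise; the
    -- diagram is a lower set, so that box exists.
    by_cases hlt : c.1.1 < i
    · have hm : (i - 1, j) ∈ Y.cells :=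
        Y.isLowerSet (show ((i - 1, j) : ℕ × ℕ) ≤ (i, j) from ⟨by simp, le_rfl⟩) hd
      refine h ⟨(i - 1, j), hm⟩ _ (Or.inl ?_) (ih (d := ⟨(i - 1, j), hm⟩) ⟨?_, ?_⟩ ?_)
      · simp; omega
      · simp; omega
      · simp; omega
      · simp; omega
    · have hm : (i, j - 1) ∈ Y.cells :=
        Y.isLowerSet (show ((i, j - 1) : ℕ × ℕ) ≤ (i, j) from ⟨le_rfl, by simp⟩) hd
      refine h ⟨(i, j - 1), hm⟩ _ (Or.inr ?_) (ih (d := ⟨(i, j - 1), hm⟩) ⟨?_, ?_⟩ ?_)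
      · simp; omega
      · simp; omega
      · simp; omega
      · simp; omega

theorem mem_emptyBoxes : c ∈ emptyBoxes T ↔ T c = ∅ := by simp [emptyBoxes]

theorem filledBoxes_eq : filledBoxes T = (emptyBoxes T)ᶜ := by
  ext c; simp [emptyBoxes, filledBoxes]

/-- The local conditions chain along unit steps: every box passed is nonempty, so some value in it
links the two inequalities. -/
theorem IsPreTableau.strict (hT : IsPreTableau Y N M T) (hcd : c ≤ d) (hne : d ≠ c)
    (hc : T c ≠ ∅) : T d ≠ ∅ ∧ ∀ a ∈ T c, ∀ b ∈ T d, a < b := by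
  have key : T d ≠ ∅ ∧ (d = c ∨ ∀ a ∈ T c, ∀ b ∈ T d, a < b) := by
    refine propagate (P := fun d => T d ≠ ∅ ∧ (d = c ∨ ∀ a ∈ T c, ∀ b ∈ T d, a < b)) ?_ hcd
      ⟨hc, Or.inl rfl⟩
    rintro e f hef ⟨h1, h2⟩
    refine ⟨hT.2.2.1 e f hef h1, Or.inr fun a ha b hb => ?_⟩
    rcases h2 with rfl | h2
    · exact hT.2.2.2.1 e f hef a ha b hb
    · obtain ⟨v, hv⟩ := Finset.nonempty_iff_ne_empty.2 h1
      exact (h2 a ha v hv).trans (hT.2.2.2.1 e f hef v hv b hb)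
  exact ⟨key.1, key.2.resolve_left hne⟩

theorem IsPreTableau.isLowerSet (hT : IsPreTableau Y N M T) :
    IsLowerSet (emptyBoxes T : Set Y.cells) := by
  intro d c hcd hd
  simp only [Finset.mem_coe, mem_emptyBoxes] at hd ⊢
  by_contra hc
  exact propagate (P := fun e => T e ≠ ∅) hT.2.2.1 hcd hc hd

/-- Complete tableaux are the pre-tableaux with k = 0, so one set of local conditions serves for the
start, the intermediate fillings and the output. -/
theorem isStandardSV_iff : IsStandardSV Y N T ↔ IsPreTableau Y N 0 T := by
  constructor
  · rintro ⟨h1, h2, h3, h4⟩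
    refine ⟨h1, h4, fun c d _ _ => (h2 d).ne_empty, ?_, ?_⟩
    · intro c d hcd a ha b hb
      have hne := hcd.ne
      -- A selection with `a` in `c` and `b` in `d`, arbitrary elsewhere.
      have hs := h3 (fun e => if e = c then a else if e = d then b else (h2 e).choose) (by
        intro e
        by_cases hec : e = c
        · simpa [hec] using ha
        · by_cases hed : e = d
          · simpa [hed, hne.symm] using hb
          · simpa [hec, hed] using (h2 e).choose_spec)
      rcases hcd with h | h
      · simpa [hne.symm] using hs.1 c d (by rw [h]) (by rw [h]; simp)
      · have hle : a ≤ b := by simpa [hne.symm] using hs.2 c d (by rw [h]) (by rw [h]; simp)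
        -- Rows are only weakly increasing, but an equality would put one value into two boxes.
        refine lt_of_le_of_ne hle ?_
        rintro rfl
        exact hne ((h4 a (h1 c ha)).unique ha hb)
    · rw [Nat.le_zero, Finset.card_eq_zero, Finset.eq_empty_iff_forall_notMem]
      intro c hc
      exact (h2 c).ne_empty (mem_emptyBoxes.1 hc)
  · intro hT
    have h2 : ∀ c, T c ≠ ∅ := by
      intro c hc
      have := hT.2.2.2.2
      rw [Nat.le_zero, Finset.card_eq_zero] at this
      have h := mem_emptyBoxes.2 hc
      simp [this] at h
    refine ⟨hT.1, fun c => Finset.nonempty_iff_ne_empty.2 (h2 c), fun f hf => ⟨?_, ?_⟩, hT.2.1⟩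
    · intro c d h h'
      exact (hT.strict (c := c) (d := d) ⟨h'.le, h.le⟩ (by rintro rfl; exact lt_irrefl _ h')
        (h2 c)).2 _ (hf c) _ (hf d)
    · intro c d h h'
      by_cases hcd : d = c
      · rw [hcd]
      · exact ((hT.strict (c := c) (d := d) ⟨h.le, h'⟩ hcd (h2 c)).2 _ (hf c) _ (hf d)).le

/-- Add the value `v` to the box `c`. -/
def place (c : Y.cells) (v : ℕ) (T : Filling Y) : Filling Y := Function.update T c (insert v (T c))

/-- Keep only the values larger than `M`. -/
def trunc (M : ℕ) (T : Filling Y) : Filling Y := fun c => (T c).filter (M < ·)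

theorem place_self {v : ℕ} : place c v T c = insert v (T c) := by simp [place]

theorem place_of_ne {v : ℕ} (h : d ≠ c) : place c v T d = T d := by simp [place, h]

theorem trunc_trunc {K : ℕ} (h : M ≤ K) : trunc K (trunc M T) = trunc K T := by
  funext c
  ext v
  simp only [trunc, Finset.mem_filter]
  constructor <;> intro h <;> [exact ⟨h.1.1, h.2⟩; exact ⟨⟨h.1, by omega⟩, h.2⟩]

theorem IsPreTableau.trunc_self (hT : IsPreTableau Y N M T) : trunc M T = T := by
  funext c
  refine Finset.filter_true_of_mem fun v hv => ?_
  have := Finset.mem_Icc.1 (hT.1 c hv); omega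

/-- A new smallest value may be put into `c`: all boxes before it are empty, all boxes after it are
not. -/
def Admissible (T : Filling Y) (c : Y.cells) : Prop :=
  (∀ b, b ≤ c → b ≠ c → T b = ∅) ∧ (∀ d, c ≤ d → d ≠ c → T d ≠ ∅)

/-- The new value is smaller than all present ones, so admissibility secures the order conditions.
Only the count of empty boxes must be supplied: a join uses up a value without filling a box. -/
theorem IsPreTableau.place (hT : IsPreTableau Y N (M + 1) T) (hM : M + 1 ≤ N)
    (hc : Admissible T c) (hcard : (emptyBoxes (place c (M + 1) T)).card ≤ M) :
    IsPreTableau Y N M (place c (M + 1) T) := by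
  have hsub : ∀ b, ∀ v ∈ T b, M + 2 ≤ v ∧ v ≤ N := fun b v hv => Finset.mem_Icc.1 (hT.1 b hv)
  refine ⟨fun b v hv => ?_, fun v hv => ?_, fun a b hab ha => ?_, fun a b hab u hu v hv => ?_, hcard⟩
  · by_cases hbc : b = c
    · subst hbc
      rw [place_self, Finset.mem_insert] at hv
      rcases hv with rfl | hv
      · simp [hM]
      · have := hsub b v hv; simp; omega
    · rw [place_of_ne hbc] at hv
      have := hsub b v hv; simp; omega
  · rw [Finset.mem_Icc] at hv
    by_cases hvM : v = M + 1
    · subst hvM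
      refine ⟨c, by simp [place_self], fun b hb => ?_⟩
      by_contra hbc
      simp only at hb
      rw [place_of_ne hbc] at hb
      have := hsub b _ hb; omega
    · obtain ⟨b, hb, hu⟩ := hT.2.1 v (by simp; omega)
      have hiff : ∀ e, v ∈ SetValued.place c (M + 1) T e ↔ v ∈ T e := by
        intro e
        by_cases hec : e = c
        · subst hec; simp [place_self, hvM]
        · rw [place_of_ne hec]
      exact ⟨b, (hiff b).2 hb, fun e he => hu e ((hiff e).1 he)⟩
  · by_cases hbc : b = c
    · subst hbc; simp [place_self]
    · rw [place_of_ne hbc]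
      by_cases hac : a = c
      · subst hac; exact hc.2 b hab.le hbc
      · rw [place_of_ne hac] at ha
        exact hT.2.2.1 a b hab ha
  · by_cases hbc : b = c
    · subst hbc
      rw [place_of_ne hab.ne, hc.1 a hab.le hab.ne] at hu
      simp at hu
    · rw [place_of_ne hbc] at hv
      by_cases hac : a = c
      · subst hac
        rw [place_self, Finset.mem_insert] at hu
        rcases hu with rfl | hu
        · have := hsub b v hv; omega
        · exact hT.2.2.2.1 a b hab u hu v hv
      · rw [place_of_ne hac] at hu
        exact hT.2.2.2.1 a b hab u hu v hv

theorem IsPreTableau.trunc_place (hT : IsPreTableau Y N (M + 1) T) :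
    trunc (M + 1) (SetValued.place c (M + 1) T) = T := by
  conv_rhs => rw [← hT.trunc_self]
  funext b
  by_cases hbc : b = c
  · subst hbc; simp [trunc, place_self, Finset.filter_insert]
  · simp [trunc, place_of_ne hbc]

theorem IsPreTableau.trunc_succ (hT : IsPreTableau Y N M T) (hM : M < N) :
    IsPreTableau Y N (M + 1) (trunc (M + 1) T) := by
  have hsub : ∀ b, ∀ v ∈ T b, M + 1 ≤ v ∧ v ≤ N := fun b v hv => Finset.mem_Icc.1 (hT.1 b hv)
  refine ⟨fun b v hv => ?_, fun v hv => ?_, fun a b hab ha => ?_, fun a b hab u hu v hv => ?_, ?_⟩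
  · simp only [trunc, Finset.mem_filter] at hv
    have := hsub b v hv.1; simp; omega
  · rw [Finset.mem_Icc] at hv
    obtain ⟨b, hb, hu⟩ := hT.2.1 v (by simp; omega)
    refine ⟨b, ?_, fun e he => hu e ?_⟩
    · simp only [trunc, Finset.mem_filter]; exact ⟨hb, by omega⟩
    · simp only [trunc, Finset.mem_filter] at he; exact he.1
  · obtain ⟨v, hv⟩ := Finset.nonempty_iff_ne_empty.2 ha
    simp only [trunc, Finset.mem_filter] at hv
    obtain ⟨u, hu⟩ := Finset.nonempty_iff_ne_empty.2
      (hT.2.2.1 a b hab (Finset.ne_empty_of_mem hv.1))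
    have := hT.2.2.2.1 a b hab v hv.1 u hu
    exact Finset.ne_empty_of_mem (a := u) (by simp only [trunc, Finset.mem_filter]; exact ⟨hu, by omega⟩)
  · simp only [trunc, Finset.mem_filter] at hu hv
    exact hT.2.2.2.1 a b hab u hu.1 v hv.1
  -- Removing one value empties at most the one box containing it.
  · obtain ⟨c, -, hu⟩ := hT.2.1 (M + 1) (by simp; omega)
    have : emptyBoxes (trunc (M + 1) T) ⊆ insert c (emptyBoxes T) := by
      intro b hb
      rw [Finset.mem_insert, mem_emptyBoxes]
      by_contra hcon
      push Not at hcon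
      obtain ⟨v, hv⟩ := hcon.2
      rw [mem_emptyBoxes] at hb
      have h1 := hsub b v hv
      have h2 : v ∉ trunc (M + 1) T b := by simp [hb]
      simp only [trunc, Finset.mem_filter, not_and] at h2
      have h3 := h2 hv
      have : v = M + 1 := by omega
      subst this
      exact hcon.1 (hu b hv)
    exact (Finset.card_le_card this).trans ((Finset.card_insert_le _ _).trans
      (Nat.succ_le_succ hT.2.2.2.2))

/-- The converse of `IsPreTableau.place`: a larger value before the box of `M + 1` would contradict
strictness. This is what lets the history of a tableau be read backwards. -/
theorem IsPreTableau.exists_place (hT : IsPreTableau Y N M T) (hM : M < N) :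
    ∃ c, T = SetValued.place c (M + 1) (trunc (M + 1) T) ∧ Admissible (trunc (M + 1) T) c := by
  have hsub : ∀ b, ∀ v ∈ T b, M + 1 ≤ v ∧ v ≤ N := fun b v hv => Finset.mem_Icc.1 (hT.1 b hv)
  obtain ⟨c, hc, hu⟩ := hT.2.1 (M + 1) (by simp; omega)
  simp only at hc hu
  refine ⟨c, ?_, fun b hb hbc => ?_, fun d hd hdc => ?_⟩
  · funext b
    by_cases hbc : b = c
    · subst hbc
      rw [place_self]
      ext v
      simp only [trunc, Finset.mem_insert, Finset.mem_filter]
      constructor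
      · intro hv
        have := hsub b v hv
        by_cases hvM : v = M + 1
        · exact Or.inl hvM
        · exact Or.inr ⟨hv, by omega⟩
      · rintro (rfl | hv)
        · exact hc
        · exact hv.1
    · rw [place_of_ne hbc]
      refine (Finset.filter_true_of_mem fun v hv => ?_).symm
      have := hsub b v hv
      rcases Nat.lt_or_ge (M + 1) v with h | h
      · exact h
      · have : v = M + 1 := by omega
        subst this
        exact absurd (hu b hv) hbc
  · refine Finset.eq_empty_of_forall_notMem fun v hv => ?_
    simp only [trunc, Finset.mem_filter] at hv
    have := (hT.strict hb (Ne.symm hbc) (Finset.ne_empty_of_mem hv.1)).2 v hv.1 _ hc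
    omega
  · have h := hT.strict hd hdc (Finset.ne_empty_of_mem hc)
    obtain ⟨v, hv⟩ := Finset.nonempty_iff_ne_empty.2 h.1
    have := h.2 _ hc v hv
    exact Finset.ne_empty_of_mem (a := v)
      (by simp only [trunc, Finset.mem_filter]; exact ⟨hv, this⟩)

theorem emptyBoxes_place {v : ℕ} : emptyBoxes (place c v T) = (emptyBoxes T).erase c := by
  ext b
  by_cases hbc : b = c
  · subst hbc; simp [mem_emptyBoxes, place_self]
  · simp [mem_emptyBoxes, place_of_ne hbc, hbc]

/-- A box of `A` to the south-east of `c` projects to the row and to the column of `c`, and the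
projections stay in the lower set. -/
theorem hook_eq_empty_iff {A : Finset Y.cells} (hA : IsLowerSet (A : Set Y.cells)) :
    hook A c = ∅ ↔ ∀ d ∈ A, c ≤ d → d = c := by
  rw [hook, Finset.filter_eq_empty_iff]
  constructor
  · intro h d hd hcd
    have hle : c.1.1 ≤ d.1.1 ∧ c.1.2 ≤ d.1.2 := hcd
    have m1 : (d.1.1, c.1.2) ∈ Y.cells := Y.isLowerSet (show (d.1.1, c.1.2) ≤ d.1 from ⟨le_rfl, hle.2⟩) d.2
    have m2 : (c.1.1, d.1.2) ∈ Y.cells := Y.isLowerSet (show (c.1.1, d.1.2) ≤ d.1 from ⟨hle.1, le_rfl⟩) d.2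
    have h1 := h (x := ⟨_, m1⟩) (hA (show (⟨_, m1⟩ : Y.cells) ≤ d from ⟨le_rfl, hle.2⟩) hd)
    have h2 := h (x := ⟨_, m2⟩) (hA (show (⟨_, m2⟩ : Y.cells) ≤ d from ⟨hle.1, le_rfl⟩) hd)
    simp only [true_and, not_or, not_and, not_lt] at h1 h2
    exact Subtype.ext (Prod.ext (by omega) (by omega))
  · intro h d hd hcd
    have hle : c ≤ d := ⟨by omega, by omega⟩
    have := h d hd hle
    subst this
    omega

theorem mem_NW_iff {A : Finset Y.cells} : c ∈ NW A ↔ c ∈ A ∧ ∀ d ∈ A, d ≤ c → d = c := by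
  simp only [NW, Finset.mem_filter]
  refine and_congr_right fun _ => forall₂_congr fun d _ => ?_
  exact ⟨fun h hd => h hd.1 hd.2, fun h h1 h2 => h ⟨h1, h2⟩⟩

theorem IsPreTableau.mem_NW_iff (hT : IsPreTableau Y N M T) :
    c ∈ NW (filledBoxes T) ↔ T c ≠ ∅ ∧ Admissible T c := by
  rw [SetValued.mem_NW_iff]
  simp only [filledBoxes, Finset.mem_filter, Finset.mem_univ, true_and]
  refine and_congr_right fun hc => ⟨fun h => ⟨fun b hb hbc => ?_, fun d hd hdc => ?_⟩, fun h d hd hdc => ?_⟩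
  · by_contra hb'
    exact hbc (h b hb' hb)
  · exact (hT.strict hd hdc hc).1
  · by_contra hne
    exact hd (h.1 d hdc hne)

/-- With `IsPreTableau.mem_NW_iff` this matches the two kinds of insertion with the admissible
boxes: corners of the empty shape and north-west boxes of the filled one. -/
theorem IsPreTableau.corner_iff (hT : IsPreTableau Y N M T) (hc : T c = ∅) :
    hook (emptyBoxes T) c = ∅ ↔ Admissible T c := by
  rw [hook_eq_empty_iff hT.isLowerSet]
  refine ⟨fun h => ⟨fun b hb hbc => ?_, fun d hd hdc hd' => ?_⟩, fun h d hd hdc => ?_⟩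
  · exact mem_emptyBoxes.1 (hT.isLowerSet hb (mem_emptyBoxes.2 hc))
  · exact hdc (h d (mem_emptyBoxes.2 hd') hd)
  · by_contra hne
    exact h.2 d hdc hne (mem_emptyBoxes.1 hd)

/-- A row contains at most one of these boxes, and above each of them, except in row 0, lies a box
of `A`. -/
theorem NW_compl_card_le (A : Finset Y.cells) : (NW Aᶜ).card ≤ A.card + 1 := by
  classical
  have hex : ∀ c : Y.cells, c ∈ NW Aᶜ → 0 < c.1.1 → ∃ d ∈ A, d.1 = (c.1.1 - 1, c.1.2) := by
    intro c hc h0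
    have m : (c.1.1 - 1, c.1.2) ∈ Y.cells :=
      Y.isLowerSet (show (c.1.1 - 1, c.1.2) ≤ c.1 from ⟨by simp, le_rfl⟩) c.2
    refine ⟨⟨_, m⟩, ?_, rfl⟩
    by_contra hm
    have := ((mem_NW_iff.1 hc).2 ⟨_, m⟩ (by simpa using hm) ⟨by simp, le_rfl⟩)
    have := congrArg (fun d : Y.cells => d.1.1) this
    simp at this; omega
  have hrow : ∀ c ∈ NW Aᶜ, ∀ d ∈ NW Aᶜ, c.1.1 = d.1.1 → c = d := by
    intro c hc d hd h
    rw [mem_NW_iff] at hc hd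
    rcases le_total c.1.2 d.1.2 with h' | h'
    · exact hd.2 c hc.1 ⟨h.le, h'⟩
    · exact (hc.2 d hd.1 ⟨h.ge, h'⟩).symm
  -- The injection into `A` and one extra point: the box above, or `none` for row 0.
  let g : Y.cells → Option (Y.cells) := fun c =>
    if h : ∃ d ∈ A, 0 < c.1.1 ∧ d.1 = (c.1.1 - 1, c.1.2) then some h.choose else none
  have hcard : (insert none (A.image some)).card ≤ A.card + 1 :=
    (Finset.card_insert_le _ _).trans (Nat.succ_le_succ Finset.card_image_le)
  refine le_trans (Finset.card_le_card_of_injOn g ?_ ?_) hcard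
  · intro c hc
    simp only [g]
    split_ifs with h
    · simpa using h.choose_spec.1
    · simp
  · intro c hc d hd hcd
    simp only [g] at hcd
    refine hrow c hc d hd ?_
    split_ifs at hcd with h1 h2 h2
    · have e1 := h1.choose_spec.2
      have e2 := h2.choose_spec.2
      have e3 := e1.2.symm.trans ((congrArg Subtype.val (Option.some.inj hcd)).trans e2.2)
      have := congrArg Prod.fst e3
      simp only at this
      omega
    · have z1 : c.1.1 = 0 := by
        by_contra h0
        obtain ⟨e, he, he'⟩ := hex c hc (by omega)
        exact h1 ⟨e, he, by omega, he'⟩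
      have z2 : d.1.1 = 0 := by
        by_contra h0
        obtain ⟨e, he, he'⟩ := hex d hd (by omega)
        exact h2 ⟨e, he, by omega, he'⟩
      rw [z1, z2]

end Tableaux

/-! ### Uniform choices. -/

section Pick

variable {α β : Type}

theorem pick_of_nonempty {A : Finset α} (h : A.Nonempty) (x : PMF β) (f : α → PMF β) :
    pick A x f = (PMF.uniformOfFinset A h).bind f := by simp [pick, h]

theorem pick_empty (x : PMF β) (f : α → PMF β) : pick ∅ x f = x := by simp [pick]

theorem pick_apply_toReal {A : Finset α} (h : A.Nonempty) (x : PMF β) (f : α → PMF β) (b : β) :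
    (pick A x f b).toReal = (A.card : ℝ)⁻¹ * ∑ a ∈ A, (f a b).toReal := by
  rw [pick_of_nonempty h, PMF.bind_apply, tsum_eq_sum (s := A)]
  · rw [ENNReal.toReal_sum, Finset.mul_sum]
    · refine Finset.sum_congr rfl fun a ha => ?_
      rw [ENNReal.toReal_mul, PMF.uniformOfFinset_apply_of_mem h ha]
      simp
    · intro a ha
      exact ENNReal.mul_ne_top (PMF.apply_ne_top _ _) (PMF.apply_ne_top _ _)
  · intro a ha
    rw [PMF.uniformOfFinset_apply_of_notMem h ha, zero_mul]

theorem mem_support_pick {A : Finset α} (h : A.Nonempty) (x : PMF β) (f : α → PMF β) (b : β) :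
    b ∈ (pick A x f).support ↔ ∃ a ∈ A, b ∈ (f a).support := by
  rw [pick_of_nonempty h, PMF.mem_support_bind_iff]
  simp

end Pick

/-! ### The one-dimensional weights behind the hook walk. -/

section Weights

/-- The weight of position `i` on the way to `α` for the rates `x`. -/
def hookWeight (x : ℕ → ℝ) (α i : ℕ) : ℝ :=
  if i = α then 1 else if i < α then (x i)⁻¹ * ∏ l ∈ Finset.Ico (i + 1) α, (1 + (x l)⁻¹) else 0

/-- Expand the product by the first index at which an inverse rate is chosen; choosing none
corresponds to the weight 1 at `α`. -/
theorem sum_hookWeight (x : ℕ → ℝ) {α i : ℕ} (h : i ≤ α) :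
    ∑ l ∈ Finset.Ico i (α + 1), hookWeight x α l = ∏ l ∈ Finset.Ico i α, (1 + (x l)⁻¹) := by
  induction h using Nat.decreasingInduction with
  | self => simp [hookWeight]
  | of_succ i hi ih =>
    rw [Finset.sum_eq_sum_Ico_succ_bot (by omega), ih, Finset.prod_eq_prod_Ico_succ_bot hi]
    simp only [hookWeight, hi.ne, hi, if_true, if_false]
    ring

/-- The form of the identity that enters the recursion of the walk; at `i = α` both sides vanish
because the rate there is 0. -/
theorem sum_hookWeight_succ (x : ℕ → ℝ) {α i : ℕ} (h : i ≤ α) (hx : i < α → x i ≠ 0)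
    (hα : x α = 0) :
    ∑ l ∈ Finset.Ico (i + 1) (α + 1), hookWeight x α l = x i * hookWeight x α i := by
  rcases h.eq_or_lt with rfl | h
  · simp [hα]
  · rw [sum_hookWeight x (show i + 1 ≤ α from h)]
    simp only [hookWeight, h.ne, h, if_true, if_false]
    rw [mul_inv_cancel_left₀ (hx h)]

end Weights

/-! ### The hook walk and the theorem of Greene, Nijenhuis and Wilf. -/

section HookWalk

variable {Y : YoungDiagram} {A : Finset Y.cells}

/-- The Young diagram formed by a lower set of boxes. -/
def shape (A : Finset Y.cells) (hA : IsLowerSet (A : Set Y.cells)) : YoungDiagram where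
  cells := A.map (Function.Embedding.subtype _)
  isLowerSet := by
    intro p q hqp hp
    simp only [Finset.coe_map, Set.mem_image, Finset.mem_coe, Function.Embedding.subtype_apply] at hp ⊢
    obtain ⟨d, hd, rfl⟩ := hp
    exact ⟨⟨q, Y.isLowerSet hqp d.2⟩, hA (show (⟨q, _⟩ : Y.cells) ≤ d from hqp) hd, rfl⟩

theorem mem_shape {hA : IsLowerSet (A : Set Y.cells)} {p : ℕ × ℕ} :
    p ∈ shape A hA ↔ ∃ h : p ∈ Y.cells, (⟨p, h⟩ : Y.cells) ∈ A := by
  rw [← YoungDiagram.mem_cells]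
  simp [shape]

/-- The length of row `i` of a lower set of boxes. -/
def rowLen (A : Finset Y.cells) (hA : IsLowerSet (A : Set Y.cells)) (i : ℕ) : ℕ :=
  (shape A hA).rowLen i

/-- The length of column `j` of a lower set of boxes. -/
def colLen (A : Finset Y.cells) (hA : IsLowerSet (A : Set Y.cells)) (j : ℕ) : ℕ :=
  (shape A hA).colLen j

theorem lt_rowLen_iff (hA : IsLowerSet (A : Set Y.cells)) {i j : ℕ} :
    j < rowLen A hA i ↔ ∃ h : (i, j) ∈ Y.cells, (⟨(i, j), h⟩ : Y.cells) ∈ A := by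
  rw [rowLen, ← YoungDiagram.mem_iff_lt_rowLen, mem_shape]

theorem lt_colLen_iff (hA : IsLowerSet (A : Set Y.cells)) {i j : ℕ} :
    i < colLen A hA j ↔ ∃ h : (i, j) ∈ Y.cells, (⟨(i, j), h⟩ : Y.cells) ∈ A := by
  rw [colLen, ← YoungDiagram.mem_iff_lt_colLen, mem_shape]

theorem card_hook (hA : IsLowerSet (A : Set Y.cells)) (c : Y.cells) :
    (hook A c).card = (rowLen A hA c.1.1 - (c.1.2 + 1)) + (colLen A hA c.1.2 - (c.1.1 + 1)) := by
  have h1 : ((A.filter fun d => d.1.1 = c.1.1 ∧ c.1.2 < d.1.2)).card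
      = rowLen A hA c.1.1 - (c.1.2 + 1) := by
    rw [← Nat.card_Ico, ← Finset.card_image_of_injOn (f := fun d : Y.cells => d.1.2)]
    · congr 1
      ext j
      simp only [Finset.mem_image, Finset.mem_filter, Finset.mem_Ico, lt_rowLen_iff]
      constructor
      · rintro ⟨⟨⟨i', j'⟩, h⟩, ⟨hd, e, hlt⟩, rfl⟩
        simp only at e hlt
        subst e
        exact ⟨hlt, h, hd⟩
      · rintro ⟨hlt, h, hd⟩
        exact ⟨⟨_, h⟩, ⟨hd, rfl, hlt⟩, rfl⟩
    · intro d hd d' hd' e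
      simp only [Finset.coe_filter, Set.mem_ofPred_eq] at hd hd'
      exact Subtype.ext (Prod.ext (hd.2.1.trans hd'.2.1.symm) e)
  have h2 : ((A.filter fun d => d.1.2 = c.1.2 ∧ c.1.1 < d.1.1)).card
      = colLen A hA c.1.2 - (c.1.1 + 1) := by
    rw [← Nat.card_Ico, ← Finset.card_image_of_injOn (f := fun d : Y.cells => d.1.1)]
    · congr 1
      ext j
      simp only [Finset.mem_image, Finset.mem_filter, Finset.mem_Ico, lt_colLen_iff]
      constructor
      · rintro ⟨⟨⟨i', j'⟩, h⟩, ⟨hd, e, hlt⟩, rfl⟩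
        simp only at e hlt
        subst e
        exact ⟨hlt, h, hd⟩
      · rintro ⟨hlt, h, hd⟩
        exact ⟨⟨_, h⟩, ⟨hd, rfl, hlt⟩, rfl⟩
    · intro d hd d' hd' e
      simp only [Finset.coe_filter, Set.mem_ofPred_eq] at hd hd'
      exact Subtype.ext (Prod.ext e (hd.2.1.trans hd'.2.1.symm))
  rw [hook, Finset.filter_or, Finset.card_union_of_disjoint, h1, h2]
  rw [Finset.disjoint_filter]
  omega

open scoped Classical in
/-- The number of boxes of `A` strictly south-east of `c`. -/
def depth (A : Finset Y.cells) (c : Y.cells) : ℕ := (A.filter fun d => c < d).card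

theorem lt_of_mem_hook {c d : Y.cells} (h : d ∈ hook A c) : c < d := by
  simp only [hook, Finset.mem_filter] at h
  have hle : c ≤ d := ⟨by omega, by omega⟩
  refine lt_of_le_of_ne hle ?_
  rintro rfl
  omega

open scoped Classical in
theorem depth_lt {c d : Y.cells} (h : d ∈ hook A c) : depth A d < depth A c := by
  have hlt := lt_of_mem_hook h
  refine Finset.card_lt_card ⟨?_, ?_⟩
  · intro e he
    simp only [Finset.mem_filter] at he ⊢
    exact ⟨he.1, hlt.trans he.2⟩
  · intro hs
    have := hs (Finset.mem_filter.2 ⟨(Finset.mem_filter.1 h).1, hlt⟩)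
    simp at this

open scoped Classical in
theorem depth_lt_card {c : Y.cells} (h : c ∈ A) : depth A c < A.card := by
  refine Finset.card_lt_card ⟨Finset.filter_subset _ _, fun hs => ?_⟩
  simpa using hs h

theorem hook_empty_of_depth {c : Y.cells} (h : depth A c = 0) : hook A c = ∅ := by
  by_contra hne
  obtain ⟨d, hd⟩ := Finset.nonempty_iff_ne_empty.2 hne
  have := depth_lt hd
  omega

theorem hookWalk_of_hook_empty {c : Y.cells} (h : hook A c = ∅) (n : ℕ) :
    hookWalk A n c = PMF.pure c := by
  cases n with
  | zero => rfl
  | succ n => rw [hookWalk, h, pick_empty]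

theorem hookWalk_stable {c : Y.cells} {n : ℕ} (h : depth A c ≤ n) :
    hookWalk A (n + 1) c = hookWalk A n c := by
  induction n generalizing c with
  | zero =>
    have := hook_empty_of_depth (Nat.le_zero.1 h)
    rw [hookWalk_of_hook_empty this, hookWalk_of_hook_empty this]
  | succ n ih =>
    by_cases hc : (hook A c).Nonempty
    · rw [hookWalk, hookWalk, pick_of_nonempty hc, pick_of_nonempty hc]
      ext b
      simp only [PMF.bind_apply]
      refine tsum_congr fun d => ?_
      by_cases hd : d ∈ hook A c
      · rw [ih (by have := depth_lt hd; omega)]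
      · rw [PMF.uniformOfFinset_apply_of_notMem hc hd, zero_mul, zero_mul]
    · rw [Finset.not_nonempty_iff_eq_empty] at hc
      rw [hookWalk_of_hook_empty hc, hookWalk_of_hook_empty hc]

/-- The budget of moves is immaterial beyond the depth. This allows an induction on it, and lets the
program make k moves instead of `A.card`. -/
theorem hookWalk_eq_of_le {c : Y.cells} {m n : ℕ} (h : depth A c ≤ m) (hmn : m ≤ n) :
    hookWalk A n c = hookWalk A m c := by
  induction n, hmn using Nat.le_induction with
  | base => rfl
  | succ n hn ih => rw [hookWalk_stable (h.trans hn), ih]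

theorem hookWalk_support {c d : Y.cells} {n : ℕ} (h : depth A c ≤ n) (hc : c ∈ A)
    (hd : d ∈ (hookWalk A n c).support) : d ∈ A ∧ hook A d = ∅ := by
  induction n generalizing c with
  | zero =>
    have hc' := hook_empty_of_depth (Nat.le_zero.1 h)
    rw [hookWalk_of_hook_empty hc', PMF.mem_support_pure_iff] at hd
    exact hd ▸ ⟨hc, hc'⟩
  | succ n ih =>
    by_cases hne : (hook A c).Nonempty
    · rw [hookWalk, mem_support_pick hne] at hd
      obtain ⟨e, he, hd⟩ := hd
      exact ih (by have := depth_lt he; omega) (Finset.mem_filter.1 he).1 hd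
    · rw [Finset.not_nonempty_iff_eq_empty] at hne
      rw [hookWalk_of_hook_empty hne, PMF.mem_support_pure_iff] at hd
      exact hd ▸ ⟨hc, hne⟩

/-- The box at position `p`, with a default value outside the diagram. -/
def cellAt (d : Y.cells) (p : ℕ × ℕ) : Y.cells := if h : p ∈ Y.cells then ⟨p, h⟩ else d

theorem cellAt_of_mem (d : Y.cells) {p : ℕ × ℕ} (h : p ∈ Y.cells) : (cellAt d p).1 = p := by
  rw [cellAt, dif_pos h]

theorem cellAt_val (d : Y.cells) {p : ℕ × ℕ} (h : p ≤ d.1) : (cellAt d p).1 = p := by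
  exact cellAt_of_mem d (Y.isLowerSet h d.2)

theorem cellAt_mem (hA : IsLowerSet (A : Set Y.cells)) {d : Y.cells} (hd : d ∈ A) {p : ℕ × ℕ}
    (h : p ≤ d.1) : cellAt d p ∈ A :=
  hA (show (cellAt d p).1 ≤ d.1 by rw [cellAt_val d h]; exact h) hd

theorem cellAt_coe (d c : Y.cells) : cellAt d c.1 = c := by
  rw [cellAt, dif_pos c.2]

variable (A) in
/-- The number of boxes in the hook of the box in row `i` and in the column of `d`. -/
def legRate (d : Y.cells) (i : ℕ) : ℝ := ((hook A (cellAt d (i, d.1.2))).card : ℝ)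

variable (A) in
/-- The number of boxes in the hook of the box in column `j` and in the row of `d`. -/
def armRate (d : Y.cells) (j : ℕ) : ℝ := ((hook A (cellAt d (d.1.1, j))).card : ℝ)

variable {d : Y.cells}

theorem corner_rowLen (hA : IsLowerSet (A : Set Y.cells)) (hd : d ∈ A) (hcor : hook A d = ∅) : rowLen A hA d.1.1 = d.1.2 + 1 := by
  have h := card_hook hA d
  rw [hcor, Finset.card_empty] at h
  have : d.1.2 < rowLen A hA d.1.1 := (lt_rowLen_iff hA).2 ⟨d.2, hd⟩
  omega

theorem corner_colLen (hA : IsLowerSet (A : Set Y.cells)) (hd : d ∈ A) (hcor : hook A d = ∅) : colLen A hA d.1.2 = d.1.1 + 1 := by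
  have h := card_hook hA d
  rw [hcor, Finset.card_empty] at h
  have : d.1.1 < colLen A hA d.1.2 := (lt_colLen_iff hA).2 ⟨d.2, hd⟩
  omega

/-- The row and the column of `d` end at `d`. So the arms and legs of the two projected boxes
recombine to the arm and leg of `c`. This additivity is why the hitting probability factors into a
row part and a column part. -/
theorem card_hook_eq_add (hA : IsLowerSet (A : Set Y.cells)) (hd : d ∈ A) (hcor : hook A d = ∅) {c : Y.cells} (hcd : c ≤ d) :
    ((hook A c).card : ℝ) = legRate A d c.1.1 + armRate A d c.1.2 := by
  have hle : c.1.1 ≤ d.1.1 ∧ c.1.2 ≤ d.1.2 := hcd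
  have h1 : (c.1.1, d.1.2) ≤ d.1 := ⟨hle.1, le_rfl⟩
  have h2 : (d.1.1, c.1.2) ≤ d.1 := ⟨le_rfl, hle.2⟩
  rw [legRate, armRate, card_hook hA, card_hook hA, card_hook hA, cellAt_val d h1, cellAt_val d h2]
  have r1 := corner_rowLen hA hd hcor
  have r2 := corner_colLen hA hd hcor
  have r3 : d.1.2 < rowLen A hA c.1.1 := by
    have := cellAt_mem hA hd h1
    rw [lt_rowLen_iff]
    have hm : (c.1.1, d.1.2) ∈ Y.cells := Y.isLowerSet h1 d.2
    exact ⟨hm, by rwa [cellAt, dif_pos hm] at this⟩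
  have r4 : d.1.1 < colLen A hA c.1.2 := by
    have := cellAt_mem hA hd h2
    rw [lt_colLen_iff]
    have hm : (d.1.1, c.1.2) ∈ Y.cells := Y.isLowerSet h2 d.2
    exact ⟨hm, by rwa [cellAt, dif_pos hm] at this⟩
  norm_cast
  simp only at *
  omega

theorem legRate_ne (hd : d ∈ A) {i : ℕ} (h : i < d.1.1) : legRate A d i ≠ 0 := by
  have hle : (i, d.1.2) ≤ d.1 := ⟨h.le, le_rfl⟩
  rw [legRate, Nat.cast_ne_zero, Finset.card_ne_zero]
  refine ⟨d, ?_⟩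
  rw [hook, Finset.mem_filter, cellAt_val d hle]
  exact ⟨hd, Or.inr ⟨rfl, h⟩⟩

theorem armRate_ne (hd : d ∈ A) {j : ℕ} (h : j < d.1.2) : armRate A d j ≠ 0 := by
  have hle : (d.1.1, j) ≤ d.1 := ⟨le_rfl, h.le⟩
  rw [armRate, Nat.cast_ne_zero, Finset.card_ne_zero]
  refine ⟨d, ?_⟩
  rw [hook, Finset.mem_filter, cellAt_val d hle]
  exact ⟨hd, Or.inl ⟨rfl, h⟩⟩

/-- On the leg only the row varies, on the arm only the column; beyond `d` the weights vanish, so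
both sums may stop there. -/
theorem sum_hook_weight (hA : IsLowerSet (A : Set Y.cells)) (hd : d ∈ A) {c : Y.cells} (hcd : c ≤ d) (u v : ℕ → ℝ)
    (hu : ∀ i, d.1.1 < i → u i = 0) (hv : ∀ j, d.1.2 < j → v j = 0) :
    ∑ e ∈ hook A c, u e.1.1 * v e.1.2 =
      (∑ i ∈ Finset.Ico (c.1.1 + 1) (d.1.1 + 1), u i) * v c.1.2 +
        u c.1.1 * ∑ j ∈ Finset.Ico (c.1.2 + 1) (d.1.2 + 1), v j := by
  have hle : c.1.1 ≤ d.1.1 ∧ c.1.2 ≤ d.1.2 := hcd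
  rw [hook, Finset.filter_or, Finset.sum_union, add_comm, Finset.sum_mul, Finset.mul_sum]
  · congr 1
    · symm
      have hmem : ∀ i ∈ Finset.Ico (c.1.1 + 1) (d.1.1 + 1), (i, c.1.2) ≤ d.1 := fun i hi => by
        rw [Finset.mem_Ico] at hi
        exact ⟨by simp only; omega, hle.2⟩
      refine Finset.sum_of_injOn (fun i => cellAt d (i, c.1.2)) ?_ ?_ ?_ ?_
      · intro i hi j hj hij
        have := congrArg Subtype.val hij
        simp only [cellAt_val d (hmem i hi), cellAt_val d (hmem j hj)] at this
        exact congrArg Prod.fst this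
      · intro i hi
        simp only [Finset.coe_filter, Set.mem_ofPred_eq, cellAt_val d (hmem i hi)]
        have := Finset.mem_Ico.1 hi
        exact ⟨cellAt_mem hA hd (hmem i hi), by simp only [true_and]; omega⟩
      · intro e he hne
        simp only [Finset.mem_filter] at he
        rw [hu, zero_mul]
        by_contra hlt
        refine hne ⟨e.1.1, by simp; omega, ?_⟩
        have : (e.1.1, c.1.2) = e.1 := Prod.ext rfl he.2.1.symm
        simp only [this, cellAt_coe]
      · intro i hi
        simp only [cellAt_val d (hmem i hi)]
    · symm
      have hmem : ∀ j ∈ Finset.Ico (c.1.2 + 1) (d.1.2 + 1), (c.1.1, j) ≤ d.1 := fun i hi => by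
        rw [Finset.mem_Ico] at hi
        exact ⟨hle.1, by simp only; omega⟩
      refine Finset.sum_of_injOn (fun j => cellAt d (c.1.1, j)) ?_ ?_ ?_ ?_
      · intro i hi j hj hij
        have := congrArg Subtype.val hij
        simp only [cellAt_val d (hmem i hi), cellAt_val d (hmem j hj)] at this
        exact congrArg Prod.snd this
      · intro i hi
        simp only [Finset.coe_filter, Set.mem_ofPred_eq, cellAt_val d (hmem i hi)]
        have := Finset.mem_Ico.1 hi
        exact ⟨cellAt_mem hA hd (hmem i hi), by simp only [true_and]; omega⟩
      · intro e he hne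
        simp only [Finset.mem_filter] at he
        rw [hv, mul_zero]
        by_contra hlt
        refine hne ⟨e.1.2, by simp; omega, ?_⟩
        have : (c.1.1, e.1.2) = e.1 := Prod.ext he.2.1.symm rfl
        simp only [this, cellAt_coe]
      · intro i hi
        simp only [cellAt_val d (hmem i hi)]
  · rw [Finset.disjoint_filter]
    omega

theorem hookWeight_of_lt (x : ℕ → ℝ) {α i : ℕ} (h : α < i) : hookWeight x α i = 0 := by
  rw [hookWeight, if_neg h.ne', if_neg h.le.not_gt]

/-- The product of the weights satisfies the recursion of the walk: summed over the hook of `c` it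
becomes (leg rate + arm rate) times its value at `c`, and the bracket is the size of the hook. At
corners it is 1 for `d` and 0 otherwise. -/
theorem hookWalk_apply (hA : IsLowerSet (A : Set Y.cells)) (hd : d ∈ A) (hcor : hook A d = ∅) {c : Y.cells} {n : ℕ} (hn : depth A c ≤ n) (hc : c ∈ A) :
    (hookWalk A n c d).toReal =
      hookWeight (legRate A d) d.1.1 c.1.1 * hookWeight (armRate A d) d.1.2 c.1.2 := by
  have hl0 : legRate A d d.1.1 = 0 := by simp [legRate, cellAt, hcor]
  have ha0 : armRate A d d.1.2 = 0 := by simp [armRate, cellAt, hcor]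
  have hempty : ∀ c, hook A c = ∅ → c ∈ A → (PMF.pure c d).toReal =
      hookWeight (legRate A d) d.1.1 c.1.1 * hookWeight (armRate A d) d.1.2 c.1.2 := by
    intro c hc0 hc
    by_cases hcd : d = c
    · subst hcd
      simp [hookWeight]
    · rw [PMF.pure_apply, if_neg hcd, ENNReal.toReal_zero]
      have : ¬ c ≤ d := fun h => hcd ((hook_eq_empty_iff hA).1 hc0 d hd h)
      have : d.1.1 < c.1.1 ∨ d.1.2 < c.1.2 := by
        by_contra hcon
        push Not at hcon
        exact this hcon
      rcases this with h | h
      · rw [hookWeight_of_lt _ h, zero_mul]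
      · rw [hookWeight_of_lt (armRate A d) h, mul_zero]
  induction n generalizing c with
  | zero =>
    exact hempty c (hook_empty_of_depth (Nat.le_zero.1 hn)) hc
  | succ n ih =>
    by_cases hne : (hook A c).Nonempty
    · rw [hookWalk, pick_apply_toReal hne]
      have : ∀ e ∈ hook A c, (hookWalk A n e d).toReal =
          hookWeight (legRate A d) d.1.1 e.1.1 * hookWeight (armRate A d) d.1.2 e.1.2 := fun e he =>
        ih (by have := depth_lt he; omega) (Finset.mem_filter.1 he).1
      rw [Finset.sum_congr rfl this]
      have hpos : ((hook A c).card : ℝ) ≠ 0 := by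
        rw [Nat.cast_ne_zero]; exact hne.card_ne_zero
      rw [inv_mul_eq_iff_eq_mul₀ hpos]
      by_cases hcd : c ≤ d
      · have hle : c.1.1 ≤ d.1.1 ∧ c.1.2 ≤ d.1.2 := hcd
        rw [sum_hook_weight hA hd hcd _ _ (fun i hi => hookWeight_of_lt _ hi)
          (fun i hi => hookWeight_of_lt _ hi), card_hook_eq_add hA hd hcor hcd,
          sum_hookWeight_succ _ hle.1 (legRate_ne hd) hl0,
          sum_hookWeight_succ _ hle.2 (armRate_ne hd) ha0]
        ring
      -- The walk only moves to the south-east, so outside the rectangle north-west of `d` both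
      -- sides are 0.
      · have hz : ∀ e : Y.cells, ¬ e ≤ d →
            hookWeight (legRate A d) d.1.1 e.1.1 * hookWeight (armRate A d) d.1.2 e.1.2 = 0 := by
          intro e he
          have : d.1.1 < e.1.1 ∨ d.1.2 < e.1.2 := by
            by_contra hcon
            push Not at hcon
            exact he hcon
          rcases this with h | h
          · rw [hookWeight_of_lt _ h, zero_mul]
          · rw [hookWeight_of_lt (armRate A d) h, mul_zero]
        rw [hz c hcd, mul_zero]
        exact Finset.sum_eq_zero fun e he => hz e fun h => hcd ((lt_of_mem_hook he).le.trans h)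
    · rw [Finset.not_nonempty_iff_eq_empty] at hne
      rw [hookWalk_of_hook_empty hne]
      exact hempty c hne hc

/-- The product of the hook lengths. -/
def hookProd (A : Finset Y.cells) : ℕ := ∏ c ∈ A, ((hook A c).card + 1)

theorem sum_box_weight (hA : IsLowerSet (A : Set Y.cells)) (hd : d ∈ A) (u v : ℕ → ℝ)
    (hu : ∀ i, d.1.1 < i → u i = 0) (hv : ∀ j, d.1.2 < j → v j = 0) :
    ∑ e ∈ A, u e.1.1 * v e.1.2 =
      (∑ i ∈ Finset.Ico 0 (d.1.1 + 1), u i) * ∑ j ∈ Finset.Ico 0 (d.1.2 + 1), v j := by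
  rw [Finset.sum_mul_sum, ← Finset.sum_product']
  symm
  have hmem : ∀ p ∈ Finset.Ico 0 (d.1.1 + 1) ×ˢ Finset.Ico 0 (d.1.2 + 1), p ≤ d.1 := fun p hp => by
    simp only [Finset.mem_product, Finset.mem_Ico] at hp
    exact ⟨by omega, by omega⟩
  refine Finset.sum_of_injOn (fun p => cellAt d p) ?_ ?_ ?_ ?_
  · intro p hp q hq hpq
    have := congrArg Subtype.val hpq
    simpa only [cellAt_val d (hmem p hp), cellAt_val d (hmem q hq)] using this
  · intro p hp
    exact cellAt_mem hA hd (hmem p hp)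
  · intro e he hne
    by_cases hlt : e ≤ d
    · have hle : e.1.1 ≤ d.1.1 ∧ e.1.2 ≤ d.1.2 := hlt
      exact absurd ⟨e.1, by simp; omega, cellAt_coe d e⟩ hne
    · have : d.1.1 < e.1.1 ∨ d.1.2 < e.1.2 := by
        by_contra hcon
        push Not at hcon
        exact hlt hcon
      rcases this with h | h
      · rw [hu _ h, zero_mul]
      · rw [hv _ h, mul_zero]
  · intro p hp
    simp only [cellAt_val d (hmem p hp)]

/-- Erasing the corner shortens exactly the hooks of the boxes above it and to its left. For such a
box with h other boxes in its hook the factor is (h+1)/h = 1 + 1/h, as in `sum_hookWeight`. -/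
theorem hookProd_erase (hA : IsLowerSet (A : Set Y.cells)) (hd : d ∈ A) (hcor : hook A d = ∅) :
    (hookProd A : ℝ) = hookProd (A.erase d) *
      ((∏ i ∈ Finset.Ico 0 d.1.1, (1 + (legRate A d i)⁻¹)) *
        ∏ j ∈ Finset.Ico 0 d.1.2, (1 + (armRate A d j)⁻¹)) := by
  have hstep : ∀ c ∈ A.erase d, (((hook A c).card + 1 : ℕ) : ℝ) =
      (((hook (A.erase d) c).card + 1 : ℕ) : ℝ) *
        if d ∈ hook A c then (1 + ((hook A c).card : ℝ)⁻¹) else 1 := by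
    intro c hc
    have he : hook (A.erase d) c = (hook A c).erase d := by
      rw [hook, hook, Finset.filter_erase]
    split_ifs with h
    · have hpos : 0 < (hook A c).card := Finset.card_pos.2 ⟨d, h⟩
      rw [he, Finset.card_erase_of_mem h]
      have : (((hook A c).card - 1 + 1 : ℕ) : ℝ) = (hook A c).card := by
        rw [Nat.sub_add_cancel hpos]
      rw [this]
      have : ((hook A c).card : ℝ) ≠ 0 := by positivity
      push_cast
      field_simp
    · rw [he, Finset.erase_eq_of_notMem h, mul_one]
  have hset : (A.erase d).filter (fun c => d ∈ hook A c) =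
      (A.filter fun c => c.1.2 = d.1.2 ∧ c.1.1 < d.1.1) ∪
        (A.filter fun c => c.1.1 = d.1.1 ∧ c.1.2 < d.1.2) := by
    ext c
    simp only [hook, Finset.mem_filter, Finset.mem_union, Finset.mem_erase]
    constructor
    · rintro ⟨⟨-, h1⟩, h2, h3⟩
      rcases h3 with h3 | h3
      · exact Or.inr ⟨h1, h3.1.symm, h3.2⟩
      · exact Or.inl ⟨h1, h3.1.symm, h3.2⟩
    · rintro (⟨h1, h2, h3⟩ | ⟨h1, h2, h3⟩)
      · exact ⟨⟨by rintro rfl; omega, h1⟩, hd, Or.inr ⟨h2.symm, h3⟩⟩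
      · exact ⟨⟨by rintro rfl; omega, h1⟩, hd, Or.inl ⟨h2.symm, h3⟩⟩
  rw [hookProd, ← Finset.mul_prod_erase A _ hd, hcor, Finset.card_empty, zero_add, one_mul,
    Nat.cast_prod, Finset.prod_congr rfl hstep, Finset.prod_mul_distrib, hookProd, Nat.cast_prod,
    ← Finset.prod_filter, hset, Finset.prod_union]
  · congr 2
    · symm
      have hmem : ∀ i ∈ Finset.Ico 0 d.1.1, (i, d.1.2) ≤ d.1 := fun i hi => by
        rw [Finset.mem_Ico] at hi
        exact ⟨by simp only; omega, le_rfl⟩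
      refine Finset.prod_of_injOn (fun i => cellAt d (i, d.1.2)) ?_ ?_ ?_ ?_
      · intro i hi j hj hij
        have := congrArg Subtype.val hij
        simp only [cellAt_val d (hmem i hi), cellAt_val d (hmem j hj)] at this
        exact congrArg Prod.fst this
      · intro i hi
        simp only [Finset.coe_filter, Set.mem_ofPred_eq, cellAt_val d (hmem i hi)]
        have := Finset.mem_Ico.1 hi
        exact ⟨cellAt_mem hA hd (hmem i hi), by simp only [true_and]; omega⟩
      · intro e he hne
        simp only [Finset.mem_filter] at he
        refine absurd ⟨e.1.1, by simp; omega, ?_⟩ hne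
        have : (e.1.1, d.1.2) = e.1 := Prod.ext rfl he.2.1.symm
        simp only [this, cellAt_coe]
      · intro i hi
        rfl
    · symm
      have hmem : ∀ j ∈ Finset.Ico 0 d.1.2, (d.1.1, j) ≤ d.1 := fun i hi => by
        rw [Finset.mem_Ico] at hi
        exact ⟨le_rfl, by simp only; omega⟩
      refine Finset.prod_of_injOn (fun i => cellAt d (d.1.1, i)) ?_ ?_ ?_ ?_
      · intro i hi j hj hij
        have := congrArg Subtype.val hij
        simp only [cellAt_val d (hmem i hi), cellAt_val d (hmem j hj)] at this
        exact congrArg Prod.snd this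
      · intro i hi
        simp only [Finset.coe_filter, Set.mem_ofPred_eq, cellAt_val d (hmem i hi)]
        have := Finset.mem_Ico.1 hi
        exact ⟨cellAt_mem hA hd (hmem i hi), by simp only [true_and]; omega⟩
      · intro e he hne
        simp only [Finset.mem_filter] at he
        refine absurd ⟨e.1.2, by simp; omega, ?_⟩ hne
        have : (d.1.1, e.1.2) = e.1 := Prod.ext he.2.1.symm rfl
        simp only [this, cellAt_coe]
      · intro i hi
        rfl
  · rw [Finset.disjoint_filter]
    omega

/-- The theorem of Greene, Nijenhuis and Wilf: the hook walk ends in the corner `d` with probability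
`hookProd A / (A.card * hookProd (A.erase d))`. -/
theorem sum_hookWalk (hA : IsLowerSet (A : Set Y.cells)) (hd : d ∈ A) (hcor : hook A d = ∅) :
    (∑ c ∈ A, (hookWalk A A.card c d).toReal) * hookProd (A.erase d) = hookProd A := by
  rw [Finset.sum_congr rfl fun c hc => hookWalk_apply hA hd hcor (depth_lt_card hc).le hc,
    sum_box_weight hA hd _ _ (fun i hi => hookWeight_of_lt _ hi)
      (fun i hi => hookWeight_of_lt _ hi), sum_hookWeight _ (Nat.zero_le _),
    sum_hookWeight _ (Nat.zero_le _), hookProd_erase hA hd hcor, mul_comm]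

end HookWalk

/-! ### The law of the generation algorithm. -/

section Law

variable {Y : YoungDiagram} {N M : ℕ} {T F : Filling Y} {c d : Y.cells}

/-- Insertion of the value `M`; the value `N` is always put into an empty box. -/
def genStep (N M : ℕ) (T : Filling Y) : PMF (Filling Y) :=
  if M = N then hookInsert (emptyBoxes T) M T else svStep M T

/-- Insert the values `M, M - 1, …, 1`, where all values are at most `N`. -/
def genLoop (N : ℕ) : ℕ → Filling Y → PMF (Filling Y)
  | 0, T => PMF.pure T
  | M + 1, T => (genStep N (M + 1) T).bind (genLoop N M)

theorem genLoop_eq_svLoop (h : M < N) : genLoop (Y := Y) N M = svLoop M := by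
  induction M with
  | zero => funext T; rfl
  | succ M ih =>
    funext T
    rw [genLoop, svLoop, ih (by omega), genStep, if_neg h.ne]

/-- If k = N, nothing has been placed, so all boxes are empty and the special first insertion is an
ordinary hook walk without a coin. One loop then covers both cases. -/
theorem svGen_eq_genLoop (x : Triple) : svGen x = genLoop x.N x.k x.S := by
  have hN : 0 < x.N := lt_of_lt_of_le (Finset.card_pos.2 x.nonempty) x.card_le
  rw [svGen]
  split_ifs with h
  · obtain ⟨n, hn⟩ : ∃ n, x.N = n + 1 := ⟨x.N - 1, by omega⟩
    have he : emptyBoxes x.S = Finset.univ := by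
      ext c
      have := x.pre.1 c
      rw [h, Finset.Icc_eq_empty (by omega), Finset.subset_empty] at this
      simp [mem_emptyBoxes, this]
    rw [h, hn, genLoop, genStep, if_pos rfl, he, Nat.add_sub_cancel,
      genLoop_eq_svLoop (Nat.lt_succ_self n)]
  · rw [genLoop_eq_svLoop (lt_of_le_of_ne x.k_le h)]

theorem IsPreTableau.notMem (hT : IsPreTableau Y N M T) {v : ℕ} (hv : v ≤ M) : v ∉ T c := by
  intro h
  have := Finset.mem_Icc.1 (hT.1 c h)
  omega

theorem place_injective {v : ℕ} (hv : ∀ c, v ∉ T c) (h : place c v T = place d v T) : c = d := by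
  by_contra hne
  have h1 := congrFun h c
  rw [place_self, place_of_ne hne] at h1
  exact hv c (h1 ▸ Finset.mem_insert_self _ _)

theorem update_eq_place_iff {v : ℕ} (hv : ∀ c, v ∉ T c) (hc : T c = ∅) :
    place c v T = Function.update T d {v} ↔ d = c := by
  constructor
  · intro h
    by_contra hne
    have h1 := congrFun h c
    rw [place_self, Function.update_of_ne (Ne.symm hne)] at h1
    exact hv c (h1 ▸ Finset.mem_insert_self _ _)
  · rintro rfl
    simp [place, hc]

theorem hookInsert_support {A : Finset Y.cells} (hA : A.Nonempty) {v : ℕ}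
    (hempty : ∀ c ∈ A, T c = ∅)
    (hF : F ∈ (hookInsert A v T).support) : ∃ c ∈ A, hook A c = ∅ ∧ F = place c v T := by
  rw [hookInsert, mem_support_pick hA] at hF
  obtain ⟨a, ha, hF⟩ := hF
  rw [PMF.mem_support_bind_iff] at hF
  obtain ⟨d, hd, hF⟩ := hF
  rw [PMF.mem_support_pure_iff] at hF
  obtain ⟨h1, h2⟩ := hookWalk_support (depth_lt_card ha).le ha hd
  refine ⟨d, h1, h2, ?_⟩
  rw [hF, place, hempty d h1]
  rfl

theorem hookInsert_apply {A : Finset Y.cells} (hA : IsLowerSet (A : Set Y.cells)) {v : ℕ}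
    (hv : ∀ c, v ∉ T c) (hcA : c ∈ A) (hcor : hook A c = ∅) (hc : T c = ∅) :
    (hookInsert A v T (place c v T)).toReal =
      hookProd A / (A.card * hookProd (A.erase c)) := by
  have hpos : (hookProd (A.erase c) : ℝ) ≠ 0 := by
    rw [Nat.cast_ne_zero, hookProd, Finset.prod_ne_zero_iff]
    intros; omega
  rw [hookInsert, pick_apply_toReal ⟨c, hcA⟩, ← sum_hookWalk hA hcA hcor]
  have : ∀ a ∈ A, (((hookWalk A A.card a).bind fun d =>
      PMF.pure (Function.update T d {v})) (place c v T)).toReal =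
      (hookWalk A A.card a c).toReal := by
    intro a _
    rw [PMF.bind_apply, tsum_eq_single c]
    · rw [PMF.pure_apply, if_pos ((update_eq_place_iff hv hc).2 rfl), mul_one]
    · intro d hd
      rw [PMF.pure_apply, if_neg (fun h => hd ((update_eq_place_iff hv hc).1 h)), mul_zero]
  rw [Finset.sum_congr rfl this]
  field_simp

theorem coin_true (p : ℝ≥0) (hp : p ≤ 1) : (coin p hp true).toReal = p := by
  simp [coin]

theorem coin_false (p : ℝ≥0) (hp : p ≤ 1) : (coin p hp false).toReal = 1 - p := by
  simp [coin, hp]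

theorem svStep_apply (M : ℕ) (T F : Filling Y) (hM : 0 < M) (hcard : (emptyBoxes T).card ≤ M) :
    (svStep M T F).toReal =
      ((M : ℝ) - (emptyBoxes T).card) / M *
        (pick (NW (filledBoxes T)) (PMF.pure T) (fun c => PMF.pure (place c M T)) F).toReal +
      (emptyBoxes T).card / M * (hookInsert (emptyBoxes T) M T F).toReal := by
  have hM' : (M : ℝ) ≠ 0 := by positivity
  have hp : ∀ c, T c ∪ {M} = insert M (T c) := fun c => by
    rw [Finset.union_comm]; rfl
  rw [svStep, PMF.bind_apply, tsum_bool, ENNReal.toReal_add, ENNReal.toReal_mul,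
    ENNReal.toReal_mul, coin_true, coin_false]
  · simp only [if_true, hp, place]
    simp only [NNReal.coe_div, NNReal.coe_natCast, Nat.cast_sub hcard]
    rw [add_comm]
    congr 2
    field_simp
    ring
  · exact ENNReal.mul_ne_top (PMF.apply_ne_top _ _) (PMF.apply_ne_top _ _)
  · exact ENNReal.mul_ne_top (PMF.apply_ne_top _ _) (PMF.apply_ne_top _ _)

theorem pick_place_apply {A : Finset Y.cells} {v : ℕ} (hv : ∀ c, v ∉ T c) (hc : c ∈ A) :
    (pick A (PMF.pure T) (fun c => PMF.pure (place c v T)) (place c v T)).toReal =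
      (A.card : ℝ)⁻¹ := by
  rw [pick_apply_toReal ⟨c, hc⟩, Finset.sum_eq_single c]
  · simp
  · intro d _ hd
    rw [PMF.pure_apply, if_neg (fun h => hd (place_injective hv h).symm)]
    simp
  · exact fun h => absurd hc h

theorem toReal_eq_zero_of_notMem {α : Type*} {p : PMF α} {a : α} (h : a ∉ p.support) :
    (p a).toReal = 0 := by
  rw [(PMF.apply_eq_zero_iff p a).2 h, ENNReal.toReal_zero]

theorem NW_nonempty {A : Finset Y.cells} (h : A.Nonempty) : (NW A).Nonempty := by
  obtain ⟨c, hc⟩ := A.exists_minimal h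
  refine ⟨c, mem_NW_iff.2 ⟨hc.1, fun d hd hdc => ?_⟩⟩
  exact le_antisymm hdc (hc.2 hd hdc)

theorem IsPreTableau.filled_nonempty (hT : IsPreTableau Y N M T) (hM : M < N) :
    (filledBoxes T).Nonempty := by
  obtain ⟨c, hc, -⟩ := hT.2.1 N (by simp; omega)
  exact ⟨c, by simp only [filledBoxes, Finset.mem_filter, Finset.mem_univ, true_and]
               exact Finset.ne_empty_of_mem hc⟩

theorem IsPreTableau.empty_top (hT : IsPreTableau Y N N T) : emptyBoxes T = Finset.univ := by
  ext c
  have := hT.1 c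
  rw [Finset.Icc_eq_empty (by omega), Finset.subset_empty] at this
  simp [mem_emptyBoxes, this]

/-- The algorithm never gets stuck: the number of empty boxes stays at most the number of values
left. -/
theorem genStep_support (hY : Y.cells.Nonempty) (hT : IsPreTableau Y N (M + 1) T) (hM : M + 1 ≤ N)
    (hF : F ∈ (genStep N (M + 1) T).support) :
    ∃ c, Admissible T c ∧ F = place c (M + 1) T ∧ IsPreTableau Y N M F := by
  have hhook : (emptyBoxes T).Nonempty → F ∈ (hookInsert (emptyBoxes T) (M + 1) T).support →
      ∃ c, Admissible T c ∧ F = place c (M + 1) T ∧ IsPreTableau Y N M F := by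
    intro hne hF
    obtain ⟨c, hc, hcor, rfl⟩ := hookInsert_support hne (fun c hc => mem_emptyBoxes.1 hc) hF
    have had := (hT.corner_iff (mem_emptyBoxes.1 hc)).1 hcor
    refine ⟨c, had, rfl, hT.place hM had ?_⟩
    rw [emptyBoxes_place, Finset.card_erase_of_mem hc]
    have := hT.2.2.2.2
    omega
  rw [genStep] at hF
  split_ifs at hF with h
  · refine hhook ?_ hF
    have : Nonempty Y.cells := hY.to_subtype
    rw [h] at hT
    rw [hT.empty_top]
    exact Finset.univ_nonempty
  · have hlt : M + 1 < N := lt_of_le_of_ne hM h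
    rw [PMF.mem_support_iff, ne_eq] at hF
    have hF' : (svStep (M + 1) T F).toReal ≠ 0 := by
      rw [ne_eq, ENNReal.toReal_eq_zero_iff, not_or]
      exact ⟨hF, PMF.apply_ne_top _ _⟩
    rw [svStep_apply (M + 1) T F (by omega) hT.2.2.2.2] at hF'
    by_cases hj : F ∈ (pick (NW (filledBoxes T)) (PMF.pure T)
        (fun c => PMF.pure (place c (M + 1) T))).support ∧ (emptyBoxes T).card ≤ M
    · rw [mem_support_pick (NW_nonempty (hT.filled_nonempty hlt))] at hj
      obtain ⟨⟨c, hc, hF⟩, hle⟩ := hj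
      rw [PMF.mem_support_pure_iff] at hF
      subst hF
      have had := (hT.mem_NW_iff.1 hc).2
      refine ⟨c, had, rfl, hT.place hM had ?_⟩
      rw [emptyBoxes_place]
      exact (Finset.card_le_card (Finset.erase_subset _ _)).trans hle
    · have h1 : (((M + 1 : ℕ) : ℝ) - (emptyBoxes T).card) / (M + 1 : ℕ) *
        (pick (NW (filledBoxes T)) (PMF.pure T)
          (fun c => PMF.pure (place c (M + 1) T)) F).toReal = 0 := by
        rw [not_and_or] at hj
        rcases hj with hj | hj
        · rw [toReal_eq_zero_of_notMem hj, mul_zero]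
        -- If every remaining value is needed for an empty box, the coin for joining has probability
        -- 0.
        · have : (emptyBoxes T).card = M + 1 := le_antisymm hT.2.2.2.2 (by omega)
          rw [this]; simp
      rw [h1, zero_add] at hF'
      refine hhook ?_ ?_
      · rw [Finset.nonempty_iff_ne_empty]
        intro he
        simp [he] at hF'
      · by_contra hcon
        rw [toReal_eq_zero_of_notMem hcon, mul_zero] at hF'
        exact hF' rfl

/-- The probability that the values `M, …, 1` are inserted in one given way, up to the choices among
nonempty boxes, if `A` is the set of empty boxes. -/
def baseProb (N M : ℕ) (A : Finset Y.cells) : ℝ :=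
  if M = N then ((N - A.card).factorial * hookProd A : ℕ) / (A.card * (N - 1).factorial : ℕ)
  else ((M - A.card).factorial * hookProd A : ℕ) / (M.factorial : ℕ)

theorem hookProd_pos (A : Finset Y.cells) : 0 < hookProd A :=
  Finset.prod_pos fun _ _ => Nat.succ_pos _

/-- The telescoping step. A hook walk contributes a quotient of hook products; in a coin step its
factor |λ'| cancels the |λ'| of the coin. In a join the weight cancels the uniform choice and leaves
a quotient of factorials. The value `N` is placed without a coin, which accounts for the separate
branch of `baseProb`. -/
theorem genStep_apply (hT : IsPreTableau Y N (M + 1) T) (hM : M + 1 ≤ N)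
    (hc : Admissible T c) (hF : IsPreTableau Y N M (place c (M + 1) T)) :
    (genStep N (M + 1) T (place c (M + 1) T)).toReal *
      (if c ∈ emptyBoxes T then 1 else ((NW (filledBoxes T)).card : ℝ)) *
      baseProb N M ((emptyBoxes T).erase c) = baseProb N (M + 1) (emptyBoxes T) := by
  have hv : ∀ c, M + 1 ∉ T c := fun c => hT.notMem le_rfl
  have hcard := hT.2.2.2.2
  have hp1 : (hookProd (emptyBoxes T) : ℝ) ≠ 0 := by exact_mod_cast (hookProd_pos _).ne'
  have hp2 : (hookProd ((emptyBoxes T).erase c) : ℝ) ≠ 0 := by exact_mod_cast (hookProd_pos _).ne'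
  have hf : ∀ n : ℕ, (n.factorial : ℝ) ≠ 0 := fun n => by exact_mod_cast n.factorial_ne_zero
  have hMN : M ≠ N := by omega
  by_cases hce : c ∈ emptyBoxes T
  · have hce' := mem_emptyBoxes.1 hce
    have hk := hookInsert_apply hT.isLowerSet hv hce ((hT.corner_iff hce').2 hc) hce'
    have hpos : 0 < (emptyBoxes T).card := Finset.card_pos.2 ⟨c, hce⟩
    have hpos' : ((emptyBoxes T).card : ℝ) ≠ 0 := by positivity
    have hcard' : ((emptyBoxes T).erase c).card = (emptyBoxes T).card - 1 :=
      Finset.card_erase_of_mem hce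
    have e1 : M - ((emptyBoxes T).card - 1) = M + 1 - (emptyBoxes T).card := by omega
    rw [if_pos hce, mul_one, genStep, baseProb, if_neg hMN, hcard', e1]
    split_ifs with h
    · subst h
      rw [hk, baseProb, if_pos rfl, Nat.add_sub_cancel]
      push_cast
      field_simp
    · rw [svStep_apply (M + 1) T _ (by omega) hcard, hk, baseProb, if_neg h,
        toReal_eq_zero_of_notMem, Nat.factorial_succ]
      · push_cast
        have := hf M
        have : (M : ℝ) + 1 ≠ 0 := by positivity
        field_simp
        ring
      · have hlt : M + 1 < N := lt_of_le_of_ne hM h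
        rw [mem_support_pick (NW_nonempty (hT.filled_nonempty hlt))]
        rintro ⟨d, hd, hd'⟩
        rw [PMF.mem_support_pure_iff] at hd'
        have := place_injective hv hd'
        subst this
        exact (hT.mem_NW_iff.1 hd).1 hce'
  · have hcf : T c ≠ ∅ := fun h => hce (mem_emptyBoxes.2 h)
    have hNW : c ∈ NW (filledBoxes T) := hT.mem_NW_iff.2 ⟨hcf, hc⟩
    have hle : (emptyBoxes T).card ≤ M := by
      have := hF.2.2.2.2
      rwa [emptyBoxes_place, Finset.erase_eq_of_notMem hce] at this
    have hne : M + 1 ≠ N := by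
      rintro rfl
      rw [hT.empty_top] at hce
      exact hce (Finset.mem_univ _)
    have e1 : M + 1 - (emptyBoxes T).card = (M - (emptyBoxes T).card) + 1 := by omega
    have hpos : ((NW (filledBoxes T)).card : ℝ) ≠ 0 := by
      rw [Nat.cast_ne_zero]; exact (Finset.card_pos.2 ⟨c, hNW⟩).ne'
    rw [if_neg hce, genStep, if_neg hne, svStep_apply (M + 1) T _ (by omega) hcard,
      pick_place_apply hv hNW, Finset.erase_eq_of_notMem hce, baseProb, if_neg hMN, baseProb,
      if_neg hne, e1, Nat.factorial_succ, Nat.factorial_succ]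
    -- A hook walk ends in an empty box, so it cannot produce this join.
    have hz : ((emptyBoxes T).card : ℝ) / (M + 1 : ℕ) *
        (hookInsert (emptyBoxes T) (M + 1) T (place c (M + 1) T)).toReal = 0 := by
      rcases (emptyBoxes T).eq_empty_or_nonempty with h0 | h0
      · simp [h0]
      · rw [toReal_eq_zero_of_notMem, mul_zero]
        intro hs
        obtain ⟨d, hd, -, hd'⟩ := hookInsert_support h0 (fun c hc => mem_emptyBoxes.1 hc) hs
        have := place_injective hv hd'
        subst this
        exact hce hd
    rw [hz]
    push_cast [Nat.cast_sub hle]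
    have := hf M
    have : (M : ℝ) + 1 ≠ 0 := by positivity
    field_simp
    ring

/-- The number of boxes the value `j` could have joined if it joined a nonempty box, else 1. -/
def stepWeight (T : Filling Y) (j : ℕ) : ℕ :=
  if emptyBoxes (trunc j T) = emptyBoxes (trunc (j - 1) T) then (NW (filledBoxes (trunc j T))).card
  else 1

theorem IsPreTableau.trunc (hT : IsPreTableau Y N 0 T) (hM : M ≤ N) :
    IsPreTableau Y N M (trunc M T) := by
  induction M with
  | zero => rwa [hT.trunc_self]
  | succ M ih =>
    have := (ih (by omega)).trunc_succ (by omega)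
    rwa [trunc_trunc (Nat.le_succ M)] at this

/-- The last step of the history of a tableau. -/
theorem IsPreTableau.exists_step (hT : IsPreTableau Y N 0 T) (hM : M + 1 ≤ N) :
    ∃ c, SetValued.trunc M T = SetValued.place c (M + 1) (SetValued.trunc (M + 1) T) ∧
      Admissible (SetValued.trunc (M + 1) T) c ∧
      emptyBoxes (SetValued.trunc M T) = (emptyBoxes (SetValued.trunc (M + 1) T)).erase c ∧
      stepWeight T (M + 1) = if c ∈ emptyBoxes (SetValued.trunc (M + 1) T) then 1
        else (NW (filledBoxes (SetValued.trunc (M + 1) T))).card := by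
  obtain ⟨c, h1, h2⟩ := (hT.trunc (M := M) (by omega)).exists_place (by omega)
  rw [trunc_trunc (Nat.le_succ M)] at h1 h2
  have he : emptyBoxes (SetValued.trunc M T) = (emptyBoxes (SetValued.trunc (M + 1) T)).erase c := by
    conv_lhs => rw [h1]
    exact emptyBoxes_place
  refine ⟨c, h1, h2, he, ?_⟩
  rw [stepWeight, Nat.add_sub_cancel, he]
  by_cases hc : c ∈ emptyBoxes (SetValued.trunc (M + 1) T)
  · rw [if_pos hc, if_neg]
    intro h
    rw [h] at hc
    exact Finset.notMem_erase _ _ hc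
  · rw [if_neg hc, if_pos (Finset.erase_eq_of_notMem hc).symm]

theorem genLoop_support (hY : Y.cells.Nonempty) (hT : IsPreTableau Y N M T) (hM : M ≤ N)
    (hF : F ∈ (genLoop N M T).support) : IsPreTableau Y N 0 F ∧ trunc M F = T := by
  induction M generalizing T with
  | zero =>
    rw [genLoop, PMF.mem_support_pure_iff] at hF
    subst hF
    exact ⟨hT, hT.trunc_self⟩
  | succ M ih =>
    rw [genLoop, PMF.mem_support_bind_iff] at hF
    obtain ⟨T1, h1, hF⟩ := hF
    obtain ⟨c, hc, rfl, hpre⟩ := genStep_support hY hT hM h1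
    obtain ⟨h2, h3⟩ := ih hpre (by omega) hF
    refine ⟨h2, ?_⟩
    rw [← trunc_trunc (Nat.le_succ M), h3, hT.trunc_place]

/-- Only one path leads to `F`, through its truncations. Its probability is therefore a product, and
`genStep_apply` collapses it. -/
theorem genLoop_apply (hY : Y.cells.Nonempty) (hF : IsPreTableau Y N 0 F) (hM : M ≤ N)
    (hN : 0 < N) :
    (genLoop N M (trunc M F) F).toReal * ∏ j ∈ Finset.Icc 1 M, (stepWeight F j : ℝ) =
      baseProb N M (emptyBoxes (trunc M F)) := by
  induction M with
  | zero =>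
    have : emptyBoxes F = ∅ := by
      have := hF.2.2.2.2
      rwa [Nat.le_zero, Finset.card_eq_zero] at this
    simp [genLoop, hF.trunc_self, baseProb, hN.ne, this, hookProd]
  | succ M ih =>
    obtain ⟨c, h1, h2, h3, h4⟩ := hF.exists_step hM
    have hT := hF.trunc hM
    have hT1 := hF.trunc (M := M) (by omega)
    -- Any other intermediate filling contributes 0, since the final tableau determines it.
    rw [genLoop, PMF.bind_apply, tsum_eq_single (trunc M F), ENNReal.toReal_mul,
      Finset.prod_Icc_succ_top (by omega), h4]
    · have hs := genStep_apply hT hM h2 (h1 ▸ hT1)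
      rw [← h1, ← h3, ← ih (by omega)] at hs
      rw [← hs]
      push_cast
      ring
    · intro T1 hne
      by_contra hcon
      rw [mul_eq_zero, not_or] at hcon
      obtain ⟨d, -, -, hpre⟩ := genStep_support hY hT hM ((PMF.mem_support_iff _ _).2 hcon.1)
      exact hne (genLoop_support hY hpre (by omega) ((PMF.mem_support_iff _ _).2 hcon.2)).2.symm

end Law

/-! ### Counting the completions of a pre-tableau. -/

section Counting

variable {Y : YoungDiagram} {N M : ℕ} {T F : Filling Y}

open scoped Classical in
/-- The tableaux whose values larger than `M` form the filling `T`. -/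
def completions (N M : ℕ) (T : Filling Y) : Finset (Filling Y) :=
  (Fintype.piFinset fun _ : Y.cells => (Finset.Icc 1 N).powerset).filter
    fun F => IsPreTableau Y N 0 F ∧ trunc M F = T

theorem mem_completions : F ∈ completions N M T ↔ IsPreTableau Y N 0 F ∧ trunc M F = T := by
  classical
  rw [completions, Finset.mem_filter, Fintype.mem_piFinset, and_iff_right_iff_imp]
  intro h c
  exact Finset.mem_powerset.2 (h.1.1 c)

theorem sum_completions_le (hT : IsPreTableau Y N (M + 1) T) (s : Finset Y.cells) :
    ∑ c ∈ s, (completions N M (place c (M + 1) T)).card ≤ (completions N (M + 1) T).card := by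
  classical
  rw [← Finset.card_biUnion]
  · refine Finset.card_le_card fun F hF => ?_
    rw [Finset.mem_biUnion] at hF
    obtain ⟨c, -, hF⟩ := hF
    rw [mem_completions] at hF ⊢
    exact ⟨hF.1, by rw [← trunc_trunc (Nat.le_succ M), hF.2, hT.trunc_place]⟩
  · intro c _ d _ hcd
    rw [Function.onFun, Finset.disjoint_left]
    intro F h1 h2
    rw [mem_completions] at h1 h2
    exact hcd (place_injective (fun c => hT.notMem le_rfl) (h1.2.symm.trans h2.2))

theorem exists_corner_notMem {A B : Finset Y.cells} (hA : IsLowerSet (A : Set Y.cells))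
    (hB : IsLowerSet (B : Set Y.cells)) (h : B ⊂ A) : ∃ c ∈ A, c ∉ B ∧ hook A c = ∅ := by
  obtain ⟨c, hc⟩ := (A \ B).exists_maximal (Finset.sdiff_nonempty.2 h.2)
  have h1 := Finset.mem_sdiff.1 hc.1
  refine ⟨c, h1.1, h1.2, (hook_eq_empty_iff hA).2 fun d hd hcd => ?_⟩
  exact le_antisymm (hc.2 (Finset.mem_sdiff.2 ⟨hd, fun hdB => h1.2 (hB hcd hdB)⟩) hcd) hcd

/-- Use the largest remaining values to fill corners outside `B` until exactly `B` is empty, then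
join north-west boxes of the complement of `B`, freely chosen each time. Filling a corner lowers
both the values left and the empty boxes by one, so the exponent, the number of joins, is preserved.
-/
theorem pow_le_card_completions (hT : IsPreTableau Y N M T) (hM : M ≤ N) {B : Finset Y.cells}
    (hB : IsLowerSet (B : Set Y.cells)) (hsub : B ⊆ emptyBoxes T) :
    (NW Bᶜ).card ^ (M - (emptyBoxes T).card) ≤ (completions N M T).card := by
  induction M generalizing T B with
  | zero =>
    rw [Nat.zero_sub, pow_zero, Nat.one_le_iff_ne_zero, Finset.card_ne_zero]
    exact ⟨T, mem_completions.2 ⟨hT, hT.trunc_self⟩⟩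
  | succ M ih =>
    have hcorner : ∀ B : Finset Y.cells, IsLowerSet (B : Set Y.cells) → B ⊂ emptyBoxes T →
        (NW Bᶜ).card ^ (M + 1 - (emptyBoxes T).card) ≤ (completions N (M + 1) T).card := by
      intro B hB hsub
      obtain ⟨c, hc, hcB, hcor⟩ := exists_corner_notMem hT.isLowerSet hB hsub
      have had := (hT.corner_iff (mem_emptyBoxes.1 hc)).1 hcor
      have hpos : 0 < (emptyBoxes T).card := Finset.card_pos.2 ⟨c, hc⟩
      have hcard : (emptyBoxes (place c (M + 1) T)).card = (emptyBoxes T).card - 1 := by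
        rw [emptyBoxes_place, Finset.card_erase_of_mem hc]
      have hpre := hT.place hM had (by have := hT.2.2.2.2; omega)
      have h1 := ih hpre (by omega) hB (by
        rw [emptyBoxes_place]
        exact Finset.subset_erase.2 ⟨hsub.1, hcB⟩)
      have h2 := sum_completions_le hT {c}
      rw [Finset.sum_singleton] at h2
      refine le_trans (le_of_eq ?_) (h1.trans h2)
      rw [hcard]
      congr 1
      omega
    rcases hsub.eq_or_ssubset with rfl | hsub
    · by_cases hle : (emptyBoxes T).card ≤ M
      · have h2 := sum_completions_le hT (NW (emptyBoxes T)ᶜ)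
        refine le_trans ?_ h2
        have h3 : ∀ c ∈ NW (emptyBoxes T)ᶜ, (NW (emptyBoxes T)ᶜ).card ^ (M - (emptyBoxes T).card) ≤
            (completions N M (place c (M + 1) T)).card := by
          intro c hc
          rw [← filledBoxes_eq, hT.mem_NW_iff] at hc
          have he : emptyBoxes (place c (M + 1) T) = emptyBoxes T := by
            rw [emptyBoxes_place, Finset.erase_eq_of_notMem]
            rw [mem_emptyBoxes]; exact hc.1
          have := ih (hT.place hM hc.2 (by rwa [he])) (by omega) hB (by rw [he])
          rwa [he] at this
        refine le_trans (le_of_eq ?_) (Finset.card_nsmul_le_sum _ _ _ h3)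
        rw [smul_eq_mul, ← pow_succ']
        congr 1
        omega
      -- No join is left and the exponent is 0, so `B` may be replaced by the empty set, a proper
      -- subset.
      · have h0 := hcorner ∅ (by simp [isLowerSet_empty])
          (Finset.ssubset_iff_subset_ne.2 ⟨Finset.empty_subset _, by
            intro h
            rw [← h] at hle
            simp at hle⟩)
        have he : M + 1 - (emptyBoxes T).card = 0 := by omega
        rw [he, pow_zero] at h0 ⊢
        exact h0
    · exact hcorner B hB hsub

/-- For `B` one takes the empty shape at a joining step with the most choices; each of the joins is
bounded by this maximum. -/
theorem prod_stepWeight_le (hF : IsPreTableau Y N 0 F) (hM : M ≤ N) :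
    ∃ B : Finset Y.cells, IsLowerSet (B : Set Y.cells) ∧ B ⊆ emptyBoxes (trunc M F) ∧
      ∏ j ∈ Finset.Icc 1 M, stepWeight F j ≤
        (NW Bᶜ).card ^ (M - (emptyBoxes (trunc M F)).card) := by
  induction M with
  | zero => exact ⟨∅, by simp [isLowerSet_empty], Finset.empty_subset _, by simp⟩
  | succ M ih =>
    obtain ⟨B, h1, h2, h3⟩ := ih (by omega)
    obtain ⟨c, -, -, he, hw⟩ := hF.exists_step hM
    have hT := hF.trunc hM
    have hT' := hF.trunc (M := M) (by omega)
    rw [Finset.prod_Icc_succ_top (by omega), hw]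
    by_cases hc : c ∈ emptyBoxes (trunc (M + 1) F)
    · refine ⟨B, h1, h2.trans (he ▸ Finset.erase_subset _ _), ?_⟩
      rw [if_pos hc, mul_one]
      refine h3.trans (le_of_eq ?_)
      have hpos : 0 < (emptyBoxes (trunc (M + 1) F)).card := Finset.card_pos.2 ⟨c, hc⟩
      rw [he, Finset.card_erase_of_mem hc]
      congr 1
      omega
    · rw [Finset.erase_eq_of_notMem hc] at he
      rw [if_neg hc, filledBoxes_eq]
      have hle := hT'.2.2.2.2
      rw [he] at h2 h3 hle
      have hexp : M + 1 - (emptyBoxes (trunc (M + 1) F)).card =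
        M - (emptyBoxes (trunc (M + 1) F)).card + 1 := by omega
      rw [hexp]
      -- Keep whichever of the old and the current shape offers more boxes.
      rcases le_total (NW Bᶜ).card (NW (emptyBoxes (trunc (M + 1) F))ᶜ).card with h | h
      · refine ⟨_, hT.isLowerSet, subset_rfl, ?_⟩
        rw [pow_succ]
        exact Nat.mul_le_mul_right _ (h3.trans (Nat.pow_le_pow_left h _))
      · refine ⟨B, h1, h2, ?_⟩
        rw [pow_succ]
        exact Nat.mul_le_mul h3 h

theorem stepWeight_pos (hF : IsPreTableau Y N 0 F) {j : ℕ} (hj : 1 ≤ j) (hjN : j ≤ N) :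
    0 < stepWeight F j := by
  obtain ⟨M, rfl⟩ : ∃ M, j = M + 1 := ⟨j - 1, by omega⟩
  obtain ⟨c, h1, h2, he, hw⟩ := hF.exists_step hjN
  rw [hw]
  split_ifs with hc
  · exact one_pos
  · rw [mem_emptyBoxes] at hc
    exact Finset.card_pos.2 ⟨c, (hF.trunc hjN).mem_NW_iff.2 ⟨hc, h2⟩⟩

end Counting

/-! ### The output probabilities and their lower bound. -/

section Triples

variable {x : Triple} {T F : Filling x.Y}

/-- `S` already locates every value above k and each value occurs once, so containing `S` amounts to
truncating to `S`. -/
theorem mem_SVT_iff : T ∈ SVT x ↔ IsPreTableau x.Y x.N 0 T ∧ trunc x.k T = x.S := by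
  classical
  rw [SVT, Finset.mem_filter, Fintype.mem_piFinset, isStandardSV_iff]
  constructor
  · rintro ⟨-, h, hS⟩
    refine ⟨h, funext fun c => Finset.Subset.antisymm (fun v hv => ?_) fun v hv => ?_⟩
    · rw [trunc, Finset.mem_filter] at hv
      have hvN := Finset.mem_Icc.1 (h.1 c hv.1)
      obtain ⟨d, hd, -⟩ := x.pre.2.1 v (by simp; omega)
      have := (h.2.1 v (by simp; omega)).unique hv.1 (hS d hd)
      exact this ▸ hd
    · rw [trunc, Finset.mem_filter]
      have := Finset.mem_Icc.1 (x.pre.1 c hv)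
      exact ⟨hS c hv, by omega⟩
  · rintro ⟨h, hS⟩
    refine ⟨fun c => Finset.mem_powerset.2 (h.1 c), h, fun c => ?_⟩
    rw [← hS]
    exact Finset.filter_subset _ _

theorem Triple.N_pos (x : Triple) : 0 < x.N :=
  lt_of_lt_of_le (Finset.card_pos.2 x.nonempty) x.card_le

theorem svGen_support (hT : T ∈ (svGen x).support) : T ∈ SVT x := by
  rw [svGen_eq_genLoop] at hT
  exact mem_SVT_iff.2 (genLoop_support x.nonempty x.pre x.k_le hT)

/-- The number of choices among nonempty boxes in the history of a tableau. -/
def weight (x : Triple) (T : Filling x.Y) : ℕ := ∏ j ∈ Finset.Icc 1 x.k, stepWeight T j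

theorem weight_pos (hT : T ∈ SVT x) : 0 < weight x T :=
  Finset.prod_pos fun j hj => by
    rw [Finset.mem_Icc] at hj
    exact stepWeight_pos (mem_SVT_iff.1 hT).1 hj.1 (hj.2.trans x.k_le)

/-- The product of `probSVG` and `weight`, which is the same for all tableaux. -/
def Triple.base (x : Triple) : ℝ := baseProb x.N x.k (emptyBoxes x.S)

theorem probSVG_mul_weight (T : SVT x) : probSVG x T * weight x T.1 = x.base := by
  have h := mem_SVT_iff.1 T.2
  have := genLoop_apply x.nonempty h.1 x.k_le x.N_pos
  rw [h.2] at this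
  rw [probSVG, svGen_eq_genLoop, weight, Triple.base, ← this]
  push_cast
  rfl

theorem Triple.m_pos (h : x.k = x.N) : 0 < x.m := by
  have hp := x.pre
  rw [h] at hp
  rw [Triple.m, hp.empty_top]
  have : Nonempty x.Y.cells := x.nonempty.to_subtype
  exact Finset.card_pos.2 Finset.univ_nonempty

/-- The hook product is at least 1, and k!/(k-m)! is a product of m factors at most k. -/
theorem Triple.base_ge (x : Triple) : 1 ≤ ((x.k : ℝ) + 1) ^ x.m * x.base := by
  have hm : x.m ≤ x.k := x.pre.2.2.2.2
  have hH : 1 ≤ hookProd (emptyBoxes x.S) := hookProd_pos _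
  have hd : x.k.factorial ≤ (x.k - x.m).factorial * (x.k + 1) ^ x.m := by
    rw [← Nat.factorial_mul_descFactorial hm]
    exact Nat.mul_le_mul_left _ ((Nat.descFactorial_le_pow _ _).trans
      (Nat.pow_le_pow_left (Nat.le_succ _) _))
  have key : x.k.factorial ≤ (x.k + 1) ^ x.m * ((x.k - x.m).factorial * hookProd (emptyBoxes x.S)) := by
    calc x.k.factorial ≤ (x.k - x.m).factorial * (x.k + 1) ^ x.m * 1 := by rwa [mul_one]
      _ ≤ (x.k - x.m).factorial * (x.k + 1) ^ x.m * hookProd (emptyBoxes x.S) :=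
        Nat.mul_le_mul_left _ hH
      _ = _ := by ring
  rw [Triple.base, baseProb]
  split_ifs with h
  · have hmp := Triple.m_pos h
    -- For k = N the denominator is m (N-1)!, which is at most N!.
    have hle : x.m * (x.N - 1).factorial ≤ x.k.factorial := by
      rw [h, ← Nat.mul_factorial_pred x.N_pos.ne', ← h]
      exact Nat.mul_le_mul_right _ hm
    rw [← mul_div_assoc, one_le_div (by
      exact_mod_cast Nat.mul_pos hmp (Nat.factorial_pos _))]
    rw [← h] at hle ⊢
    exact_mod_cast hle.trans key
  · rw [← mul_div_assoc, one_le_div (by exact_mod_cast Nat.factorial_pos _)]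
    exact_mod_cast key

theorem Triple.base_pos (x : Triple) : 0 < x.base := by
  have := x.base_ge
  have h2 : (0 : ℝ) < ((x.k : ℝ) + 1) ^ x.m := by positivity
  by_contra hcon
  have := mul_nonpos_of_nonneg_of_nonpos h2.le (not_lt.1 hcon)
  linarith

theorem probSVG_pos (T : SVT x) : 0 < probSVG x T := by
  have h := probSVG_mul_weight T
  have hb := x.base_pos
  rw [← h] at hb
  exact (pos_iff_pos_of_mul_pos hb).2 (by exact_mod_cast weight_pos T.2)

theorem sum_probSVG (x : Triple) : ∑ T : SVT x, probSVG x T = 1 := by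
  have h1 := (svGen x).tsum_coe
  rw [tsum_eq_sum (s := SVT x)] at h1
  · have h2 := congrArg ENNReal.toReal h1
    rw [ENNReal.toReal_sum fun a _ => PMF.apply_ne_top _ _, ENNReal.toReal_one] at h2
    rw [← h2]
    exact Finset.sum_coe_sort (SVT x) fun T => (svGen x T).toReal
  · intro T hT
    by_contra h
    exact hT (svGen_support ((PMF.mem_support_iff _ _).2 h))

/-- Upper bound for the weight and lower bound for the count are applied with the same `B`. -/
theorem weight_le_card (T : SVT x) : weight x T.1 ≤ Fintype.card (SVT x) := by
  have h := mem_SVT_iff.1 T.2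
  obtain ⟨B, h1, h2, h3⟩ := prod_stepWeight_le h.1 x.k_le
  rw [h.2] at h2 h3
  refine h3.trans ((pow_le_card_completions x.pre x.k_le h1 h2).trans ?_)
  rw [Fintype.card_coe]
  refine Finset.card_le_card fun F hF => ?_
  rwa [mem_completions, ← mem_SVT_iff] at hF

theorem weight_le_pow (T : SVT x) : weight x T.1 ≤ (x.k + 1) ^ (x.k - x.m) := by
  have h := mem_SVT_iff.1 T.2
  have hm : x.m ≤ x.k := x.pre.2.2.2.2
  obtain ⟨B, h1, h2, h3⟩ := prod_stepWeight_le h.1 x.k_le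
  rw [h.2] at h2 h3
  refine h3.trans (Nat.pow_le_pow_left ((NW_compl_card_le B).trans ?_) _)
  exact Nat.succ_le_succ ((Finset.card_le_card h2).trans hm)

/-- On both classes the uniform distribution has a polynomially bounded density with respect to
`SVGen`. -/
theorem one_le_card_mul_prob {C : ℕ} (hx : x ∈ fixEmpty C ∪ fixExcess C) (T : SVT x) :
    1 ≤ ((x.k : ℝ) + 1) ^ C * (Fintype.card (SVT x) * probSVG x T) := by
  have hk : (1 : ℝ) ≤ (x.k : ℝ) + 1 := by simp
  have hm : x.m ≤ x.k := x.pre.2.2.2.2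
  rcases hx with hx | hx
  -- Few empty boxes: |SVT| p(T) ≥ w(T) p(T), the constant `x.base`.
  · have hx' : x.m ≤ C := hx
    refine x.base_ge.trans ?_
    refine mul_le_mul (pow_le_pow_right₀ hk hx') ?_ x.base_pos.le (by positivity)
    rw [← probSVG_mul_weight T, mul_comm]
    exact mul_le_mul_of_nonneg_right (by exact_mod_cast weight_le_card T) (probSVG_pos T).le
  · have hx' : x.k ≤ x.m + C := hx
    -- Few joins: weights are at least 1 and p w is constant, so 1 = ∑ p ≤ ∑ p w = |SVT| p(T) w(T),
    -- with w(T) at most (k+1)^C.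
    have h1 : (1 : ℝ) ≤ weight x T.1 * (Fintype.card (SVT x) * probSVG x T) := by
      calc (1 : ℝ) = ∑ F : SVT x, probSVG x F := (sum_probSVG x).symm
        _ ≤ ∑ F : SVT x, probSVG x F * weight x F.1 := by
          refine Finset.sum_le_sum fun F _ => ?_
          have : (1 : ℝ) ≤ weight x F.1 := by exact_mod_cast weight_pos F.2
          nlinarith [probSVG_pos F]
        _ = ∑ F : SVT x, probSVG x T * weight x T.1 := by
          simp_rw [probSVG_mul_weight]
        _ = _ := by
          rw [Finset.sum_const, nsmul_eq_mul, Finset.card_univ]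
          ring
    refine h1.trans ?_
    refine mul_le_mul_of_nonneg_right ?_ (mul_nonneg (Nat.cast_nonneg _) (probSVG_pos T).le)
    have h2 : weight x T.1 ≤ (x.k + 1) ^ C :=
      (weight_le_pow T).trans (Nat.pow_le_pow_right (by omega) (by omega))
    exact_mod_cast h2

end Triples

/-! ### Total variation and Doeblin's contraction. -/

section Metropolis

variable {X : Type} [Fintype X]

/-- The sums over `A` and its complement are opposite, so the total of the absolute values counts
them twice. -/
theorem abs_sum_le_half [DecidableEq X] {D : X → ℝ} (h0 : ∑ y, D y = 0) (A : Finset X) :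
    |∑ y ∈ A, D y| ≤ (∑ y, |D y|) / 2 := by
  have h1 := Finset.sum_add_sum_compl A D
  have h2 := Finset.sum_add_sum_compl A fun y => |D y|
  have h3 := Finset.abs_sum_le_sum_abs D A
  have h4 := Finset.abs_sum_le_sum_abs D Aᶜ
  rw [h0] at h1
  have h5 : ∑ y ∈ Aᶜ, D y = -∑ y ∈ A, D y := by linarith
  rw [h5, abs_neg] at h4
  linarith

theorem tvDist_le_half [DecidableEq X] {μ ν : X → ℝ} (h : ∑ y, μ y = ∑ y, ν y) :
    tvDist μ ν ≤ (∑ y, |μ y - ν y|) / 2 := by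
  refine ciSup_le fun A => ?_
  rw [← Finset.sum_sub_distrib]
  exact abs_sum_le_half (by rw [Finset.sum_sub_distrib, h, sub_self]) A

/-- One step of a chain contracts the distance from a stationary law if all its transition
probabilities are at least `β` times some law. -/
theorem contraction {P : Matrix X X ℝ} {π D : X → ℝ} {β : ℝ} (hP : ∀ y z, β * π z ≤ P y z)
    (hrow : ∀ y, ∑ z, P y z = 1) (hπ : ∑ z, π z = 1) (hD : ∑ y, D y = 0) :
    ∑ z, |Matrix.vecMul D P z| ≤ (1 - β) * ∑ y, |D y| := by
  have h1 : ∀ z, |Matrix.vecMul D P z| ≤ ∑ y, |D y| * (P y z - β * π z) := by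
    intro z
    -- Subtracting the common part `β π` from all rows changes nothing, because `D` has total 0;
    -- each remaining row has mass 1 - β.
    have : Matrix.vecMul D P z = ∑ y, D y * (P y z - β * π z) := by
      simp only [mul_sub, Finset.sum_sub_distrib, ← Finset.sum_mul, hD, zero_mul, sub_zero]
      rfl
    rw [this]
    refine (Finset.abs_sum_le_sum_abs _ _).trans (Finset.sum_le_sum fun y _ => ?_)
    rw [abs_mul, abs_of_nonneg (sub_nonneg.2 (hP y z))]
  refine (Finset.sum_le_sum fun z _ => h1 z).trans (le_of_eq ?_)
  rw [Finset.sum_comm, Finset.mul_sum]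
  refine Finset.sum_congr rfl fun y _ => ?_
  rw [← Finset.mul_sum, Finset.sum_sub_distrib, hrow, ← Finset.mul_sum, hπ]
  ring

theorem tvDist_pow_le [DecidableEq X] {P : Matrix X X ℝ} {π v : X → ℝ} {β : ℝ} (hβ : β ≤ 1)
    (hP : ∀ y z, β * π z ≤ P y z) (hrow : ∀ y, ∑ z, P y z = 1) (hπ : ∑ z, π z = 1)
    (hπ0 : ∀ z, 0 ≤ π z) (hstat : Matrix.vecMul π P = π) (hv : ∑ z, v z = 1) (hv0 : ∀ z, 0 ≤ v z)
    (t : ℕ) : tvDist (Matrix.vecMul v (P ^ t)) π ≤ (1 - β) ^ t := by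
  have key : ∑ z, Matrix.vecMul v (P ^ t) z = 1 ∧
      ∑ z, |Matrix.vecMul v (P ^ t) z - π z| ≤ 2 * (1 - β) ^ t := by
    induction t with
    | zero =>
      simp only [pow_zero, Matrix.vecMul_one, hv, true_and, mul_one]
      calc ∑ z, |v z - π z| ≤ ∑ z, (v z + π z) := Finset.sum_le_sum fun z _ => by
            rw [abs_le]; constructor <;> linarith [hv0 z, hπ0 z]
        _ = 2 := by rw [Finset.sum_add_distrib, hv, hπ]; norm_num
    | succ t ih =>
      have e : Matrix.vecMul v (P ^ (t + 1)) = Matrix.vecMul (Matrix.vecMul v (P ^ t)) P := by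
        rw [Matrix.vecMul_vecMul, pow_succ]
      constructor
      · rw [e]
        simp only [Matrix.vecMul, dotProduct] at ih ⊢
        rw [Finset.sum_comm]
        simp only [← Finset.mul_sum, hrow, mul_one]
        exact ih.1
      · have h := contraction (D := Matrix.vecMul v (P ^ t) - π) hP hrow hπ (by
          simp only [Pi.sub_apply, Finset.sum_sub_distrib, ih.1, hπ, sub_self])
        rw [Matrix.sub_vecMul, hstat, ← e] at h
        simp only [Pi.sub_apply] at h
        refine h.trans ?_
        rw [pow_succ]
        nlinarith [ih.2, sub_nonneg.2 hβ]
  refine (tvDist_le_half (key.1.trans hπ.symm)).trans ?_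
  linarith [key.2]

end Metropolis

/-! ### The Metropolis chain and rapid mixing. -/

section Chain

variable {x : Triple}

theorem mcSVT_of_ne {T F : SVT x} (h : F ≠ T) : mcSVT x T F = min (probSVG x F) (probSVG x T) := by
  rw [mcSVT, if_pos h, mul_min_of_nonneg _ _ (probSVG_pos F).le, mul_one,
    mul_div_cancel₀ _ (probSVG_pos F).ne']

theorem mcSVT_row (T : SVT x) : ∑ F, mcSVT x T F = 1 := by
  rw [← Finset.sum_filter_add_sum_filter_not _ (fun F => F ≠ T)]
  have h1 : Finset.univ.filter (fun F : SVT x => ¬ F ≠ T) = {T} := by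
    ext F; simp
  rw [h1, Finset.sum_singleton]
  have h2 : mcSVT x T T = 1 - ∑ F ∈ Finset.univ.filter (fun R => R ≠ T), mcSVT x T F := by
    conv_lhs => rw [mcSVT, if_neg (by simp)]
    congr 1
    refine Finset.sum_congr rfl fun F hF => ?_
    rw [mcSVT, if_pos (Finset.mem_filter.1 hF).2]
  rw [h2]
  ring

theorem mcSVT_symm (T F : SVT x) : mcSVT x T F = mcSVT x F T := by
  by_cases h : F = T
  · rw [h]
  · rw [mcSVT_of_ne h, mcSVT_of_ne (Ne.symm h), min_comm]

/-- Off the diagonal the entry is the smaller of two output probabilities, each at least 1/(R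
|SVT|). -/
theorem mcSVT_ge {R : ℝ} (hR : 1 ≤ R)
    (h : ∀ T : SVT x, 1 ≤ R * (Fintype.card (SVT x) * probSVG x T)) (T F : SVT x) :
    R⁻¹ * unif (SVT x) F ≤ mcSVT x T F := by
  have hne : Nonempty (SVT x) := ⟨T⟩
  have hcard : (0 : ℝ) < Fintype.card (SVT x) := by exact_mod_cast Fintype.card_pos
  have hp : ∀ T : SVT x, R⁻¹ * unif (SVT x) F ≤ probSVG x T := by
    intro T
    rw [unif, one_div, ← mul_inv, inv_le_iff_one_le_mul₀ (by positivity)]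
    have := h T
    linarith
  by_cases hFT : F = T
  · subst hFT
    -- Rejected mass goes to the diagonal: the other entries of the row are at most the proposal
    -- probabilities, so comparing total masses gives P(F,F) ≥ p(F).
    refine (hp F).trans ?_
    have h1 := mcSVT_row F
    rw [← sum_probSVG x, ← Finset.add_sum_erase _ _ (Finset.mem_univ F),
      ← Finset.add_sum_erase _ (probSVG x) (Finset.mem_univ F)] at h1
    have h2 : ∑ G ∈ Finset.univ.erase F, mcSVT x F G ≤ ∑ G ∈ Finset.univ.erase F, probSVG x G :=
      Finset.sum_le_sum fun G hG => by
        rw [mcSVT_of_ne (Finset.ne_of_mem_erase hG)]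
        exact min_le_left _ _
    linarith
  · rw [mcSVT_of_ne hFT]
    exact le_min (hp F) (hp T)

theorem tvDist_chain_le {R : ℝ} (hR : 1 ≤ R)
    (h : ∀ T : SVT x, 1 ≤ R * (Fintype.card (SVT x) * probSVG x T)) {v : SVT x → ℝ}
    (hv : ∑ T, v T = 1) (hv0 : ∀ T, 0 ≤ v T) (t : ℕ) :
    tvDist (Matrix.vecMul v (mcSVT x ^ t)) (unif (SVT x)) ≤ (1 - R⁻¹) ^ t := by
  have hne : Nonempty (SVT x) := by
    by_contra hcon
    rw [not_nonempty_iff] at hcon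
    simp at hv
  have hcard : (Fintype.card (SVT x) : ℝ) ≠ 0 := by
    rw [Nat.cast_ne_zero]; exact Fintype.card_ne_zero
  refine tvDist_pow_le (inv_le_one_of_one_le₀ hR) (mcSVT_ge hR h) mcSVT_row ?_ ?_ ?_ hv hv0 t
  · simp only [unif, Finset.sum_const, Finset.card_univ, nsmul_eq_mul]
    exact mul_one_div_cancel hcard
  · intro T; simp [unif]
  -- By symmetry column sums are row sums, hence the uniform law is stationary.
  · funext F
    have h1 := mcSVT_row F
    simp only [Matrix.vecMul, dotProduct, unif, ← Finset.mul_sum]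
    rw [Finset.sum_congr rfl fun T _ => mcSVT_symm T F, h1, mul_one]

theorem distStat_le {R : ℝ} (hR : 1 ≤ R)
    (h : ∀ T : SVT x, 1 ≤ R * (Fintype.card (SVT x) * probSVG x T)) (t : ℕ) :
    distStat (mcSVT x) (unif (SVT x)) t ≤ (1 - R⁻¹) ^ t := by
  refine Real.iSup_le (fun T => ?_) (pow_nonneg (sub_nonneg.2 (inv_le_one_of_one_le₀ hR)) t)
  have := tvDist_chain_le hR h (v := Pi.single T 1) (by simp) (fun F => by
    by_cases hF : F = T
    · subst hF; simp
    · simp [hF]) t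
  rwa [Matrix.single_one_vecMul] at this

theorem one_sub_inv_pow_le {R : ℕ} (hR : 1 ≤ R) (n : ℕ) :
    (1 - (R : ℝ)⁻¹) ^ (R * n) ≤ Real.exp (-n) := by
  have hR' : (R : ℝ) ≠ 0 := by positivity
  have h0 : 0 ≤ 1 - (R : ℝ)⁻¹ :=
    sub_nonneg.2 (inv_le_one_of_one_le₀ (by exact_mod_cast hR))
  have h1 : 1 - (R : ℝ)⁻¹ ≤ Real.exp (-(R : ℝ)⁻¹) := by
    have := Real.add_one_le_exp (-(R : ℝ)⁻¹)
    linarith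
  refine (pow_le_pow_left₀ h0 h1 _).trans (le_of_eq ?_)
  rw [← Real.exp_nat_mul]
  congr 1
  push_cast
  field_simp

theorem rapidlyMixing_of_subset {C : ℕ} {𝓕 : Set Triple} (h𝓕 : 𝓕 ⊆ fixEmpty C ∪ fixExcess C) :
    RapidlyMixing 𝓕 := by
  refine ⟨(MvPolynomial.X 1 + 1) ^ C * (MvPolynomial.X 2 + 1), fun x hx ε hε => ?_⟩
  have hR : 1 ≤ (x.k + 1) ^ C := Nat.one_le_pow _ _ (by omega)
  -- After R n steps the distance is at most exp(-n). With n ≥ 1/ε this is at most ε since exp n ≥ n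
  -- + 1; a number of steps polynomial in 1/ε avoids logarithms.
  have hd : distStat (mcSVT x) (unif (SVT x)) ((x.k + 1) ^ C * ⌈ε⁻¹⌉₊) ≤ ε := by
    refine (distStat_le (R := ((x.k + 1) ^ C : ℕ)) (by exact_mod_cast hR) (fun T => ?_) _).trans
      ((one_sub_inv_pow_le hR _).trans ?_)
    · have := one_le_card_mul_prob (h𝓕 hx) T
      exact_mod_cast this
    · have h1 := Nat.le_ceil ε⁻¹
      have h2 := Real.add_one_le_exp (⌈ε⁻¹⌉₊ : ℝ)
      rw [Real.exp_neg, inv_le_comm₀ (Real.exp_pos _) hε]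
      linarith
  refine ⟨⟨_, hd⟩, ?_⟩
  have hle : mixingTime (mcSVT x) (unif (SVT x)) ε ≤ (x.k + 1) ^ C * ⌈ε⁻¹⌉₊ := Nat.sInf_le hd
  calc (mixingTime (mcSVT x) (unif (SVT x)) ε : ℝ) ≤ ((x.k + 1) ^ C * ⌈ε⁻¹⌉₊ : ℕ) := by
        exact_mod_cast hle
    _ ≤ ((x.k : ℝ) + 1) ^ C * (ε⁻¹ + 1) := by
        push_cast
        have := (Nat.ceil_lt_add_one (inv_pos.2 hε).le).le
        gcongr
    _ = _ := by simp

end Chain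

/-! ### Couplings of probability laws. -/

section Coupling

variable {α β γ δ : Type}

/-- There is a coupling of `μ` and `ν` that is concentrated on the relation `R`. -/
def Lift (R : α → β → Prop) (μ : PMF α) (ν : PMF β) : Prop :=
  ∃ j : PMF (α × β), j.map Prod.fst = μ ∧ j.map Prod.snd = ν ∧ ∀ z ∈ j.support, R z.1 z.2

theorem Lift.pure {R : α → β → Prop} {a : α} {b : β} (h : R a b) :
    Lift R (PMF.pure a) (PMF.pure b) := by
  refine ⟨PMF.pure (a, b), PMF.pure_map _ _, PMF.pure_map _ _, fun z hz => ?_⟩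
  rw [PMF.mem_support_pure_iff] at hz
  exact hz ▸ h

/-- Draw a pair from the first coupling and continue with a coupling chosen for that pair. -/
theorem Lift.bind {R : α → β → Prop} {R' : γ → δ → Prop} {μ : PMF α} {ν : PMF β}
    {f : α → PMF γ} {g : β → PMF δ} (h : Lift R μ ν)
    (hfg : ∀ a b, a ∈ μ.support → b ∈ ν.support → R a b → Lift R' (f a) (g b)) :
    Lift R' (μ.bind f) (ν.bind g) := by
  obtain ⟨j, rfl, rfl, hj⟩ := h
  have key : ∀ z, ∃ k : PMF (γ × δ), k.map Prod.fst = f z.1 ∧ k.map Prod.snd = g z.2 ∧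
      (z ∈ j.support → ∀ w ∈ k.support, R' w.1 w.2) := by
    intro z
    by_cases hz : z ∈ j.support
    · obtain ⟨k, h1, h2, h3⟩ := hfg z.1 z.2 ((PMF.mem_support_map_iff _ _ _).2 ⟨z, hz, rfl⟩)
        ((PMF.mem_support_map_iff _ _ _).2 ⟨z, hz, rfl⟩) (hj z hz)
      exact ⟨k, h1, h2, fun _ => h3⟩
    -- Pairs of probability 0 still need some coupling; the independent one serves.
    · refine ⟨(f z.1).bind fun c => (g z.2).map fun d => (c, d), ?_, ?_, fun h => absurd h hz⟩
      · rw [PMF.map_bind]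
        simp only [PMF.map_comp]
        exact (congrArg _ (funext fun c => PMF.map_const _ c)).trans (PMF.bind_pure _)
      · rw [PMF.map_bind]
        simp only [PMF.map_comp]
        exact (congrArg _ (funext fun c => PMF.map_id _)).trans (PMF.bind_const _ _)
  choose k hk1 hk2 hk3 using key
  refine ⟨j.bind k, ?_, ?_, ?_⟩
  · rw [PMF.map_bind, PMF.bind_map]
    exact congrArg _ (funext hk1)
  · rw [PMF.map_bind, PMF.bind_map]
    exact congrArg _ (funext hk2)
  · intro w hw
    rw [PMF.mem_support_bind_iff] at hw
    obtain ⟨z, hz, hw⟩ := hw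
    exact hk3 z hz w hw

theorem Lift.mono {R R' : α → β → Prop} {μ : PMF α} {ν : PMF β} (h : Lift R μ ν)
    (hRR : ∀ a b, a ∈ μ.support → b ∈ ν.support → R a b → R' a b) : Lift R' μ ν := by
  obtain ⟨j, rfl, rfl, hj⟩ := h
  exact ⟨j, rfl, rfl, fun z hz => hRR z.1 z.2 ((PMF.mem_support_map_iff _ _ _).2 ⟨z, hz, rfl⟩)
    ((PMF.mem_support_map_iff _ _ _).2 ⟨z, hz, rfl⟩) (hj z hz)⟩

/-- If the right component determines the left one, a coupling is an exact equality of laws. The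
output law of the program is obtained in this way. -/
theorem Lift.map_eq {R : α → β → Prop} {μ : PMF α} {ν : PMF β} {f : β → α} (h : Lift R μ ν)
    (hR : ∀ a b, R a b → f b = a) : ν.map f = μ := by
  obtain ⟨j, rfl, rfl, hj⟩ := h
  rw [PMF.map_comp, PMF.map, PMF.map, ← PMF.bindOnSupport_eq_bind, ← PMF.bindOnSupport_eq_bind]
  congr 1
  funext z hz
  simp only [Function.comp]
  rw [hR _ _ (hj z hz)]

/-- The right process may do bookkeeping while the left one waits, provided that every outcome can
be coupled. -/
theorem Lift.of_right {R : α → β → Prop} {μ : PMF α} {ν : PMF γ} {g : γ → PMF β}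
    (h : ∀ c ∈ ν.support, Lift R μ (g c)) : Lift R μ (ν.bind g) := by
  have h1 : Lift (fun (_ : Unit) (c : γ) => c ∈ ν.support) (PMF.pure ()) ν := by
    refine ⟨ν.map fun c => ((), c), ?_, ?_, ?_⟩
    · rw [PMF.map_comp]
      exact PMF.map_const _ _
    · rw [PMF.map_comp]
      exact PMF.map_id _
    · intro z hz
      rw [PMF.mem_support_map_iff] at hz
      obtain ⟨c, hc, rfl⟩ := hz
      exact hc
  have h2 := h1.bind (f := fun _ => μ) (R' := R) (g := g) fun _ c _ hc _ => h c hc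
  rwa [PMF.pure_bind] at h2

theorem Lift.bind_post {R : α → β → Prop} {R' : α → γ → Prop} {μ : PMF α} {ν : PMF β}
    {g : β → PMF γ} (h : Lift R μ ν)
    (hg : ∀ a b, a ∈ μ.support → b ∈ ν.support → R a b → ∀ c ∈ (g b).support, R' a c) :
    Lift R' μ (ν.bind g) := by
  rw [← PMF.bind_pure μ]
  refine h.bind fun a b ha hb hab => ?_
  rw [← PMF.bind_pure (g b)]
  exact Lift.of_right fun c hc => Lift.pure (hg a b ha hb hab c hc)

theorem map_uniformOfFinset {A : Finset α} {B : Finset β} (hA : A.Nonempty) (hB : B.Nonempty)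
    {φ : α → β} (hφ : Set.BijOn φ A B) :
    (PMF.uniformOfFinset A hA).map φ = PMF.uniformOfFinset B hB := by
  classical
  have hcard : A.card = B.card := Finset.card_nbij φ hφ.mapsTo hφ.injOn hφ.surjOn
  ext b
  rw [PMF.map_apply]
  by_cases hb : b ∈ B
  · obtain ⟨a, ha, rfl⟩ := hφ.surjOn hb
    rw [PMF.uniformOfFinset_apply_of_mem hB hb, tsum_eq_single a]
    · rw [if_pos rfl, PMF.uniformOfFinset_apply_of_mem hA ha, hcard]
    · intro a' ha'
      split_ifs with h
      · refine PMF.uniformOfFinset_apply_of_notMem hA fun hm => ha' ?_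
        exact hφ.injOn hm ha h.symm
      · rfl
  · rw [PMF.uniformOfFinset_apply_of_notMem hB hb]
    refine ENNReal.tsum_eq_zero.2 fun a => ?_
    split_ifs with h
    · refine PMF.uniformOfFinset_apply_of_notMem hA fun hm => hb ?_
      rw [h]
      exact hφ.mapsTo hm
    · rfl

/-- A bijection couples two uniform draws. It translates a random number of the program into a
random box. -/
theorem Lift.pick {R : γ → δ → Prop} {A : Finset α} {B : Finset β} {φ : β → α}
    (hB : B.Nonempty) (hφ : Set.BijOn φ B A) {p : PMF γ} {q : PMF δ} {f : α → PMF γ} {g : β → PMF δ}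
    (h : ∀ b ∈ B, Lift R (f (φ b)) (g b)) : Lift R (pick A p f) (pick B q g) := by
  have hA : A.Nonempty := by
    obtain ⟨b, hb⟩ := hB
    exact ⟨φ b, hφ.mapsTo hb⟩
  rw [pick_of_nonempty hA, pick_of_nonempty hB]
  have h1 : Lift (fun a b => b ∈ B ∧ a = φ b) (PMF.uniformOfFinset A hA)
      (PMF.uniformOfFinset B hB) := by
    refine ⟨(PMF.uniformOfFinset B hB).map fun b => (φ b, b), ?_, ?_, ?_⟩
    · rw [PMF.map_comp]
      exact map_uniformOfFinset hB hA hφ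
    · rw [PMF.map_comp]
      exact PMF.map_id _
    · intro z hz
      rw [PMF.mem_support_map_iff] at hz
      obtain ⟨b, hb, rfl⟩ := hz
      exact ⟨(PMF.mem_support_uniformOfFinset_iff hB b).1 hb, rfl⟩
  refine h1.bind fun a b _ _ hab => ?_
  rw [hab.2]
  exact h b hab.1

theorem Lift.pick_left {R : γ → δ → Prop} {A : Finset α} {B : Finset β} {φ : α → β}
    (hA : A.Nonempty) (hφ : Set.BijOn φ A B) {p : PMF γ} {q : PMF δ} {f : α → PMF γ}
    {g : β → PMF δ} (h : ∀ a ∈ A, Lift R (f a) (g (φ a))) :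
    Lift R (SetValued.pick A p f) (SetValued.pick B q g) := by
  have : Nonempty α := ⟨hA.choose⟩
  refine Lift.pick (φ := Function.invFunOn φ A) ?_ (Set.BijOn.symm hφ.invOn_invFunOn.symm hφ) ?_
  · obtain ⟨a, ha⟩ := hA
    exact ⟨φ a, hφ.mapsTo ha⟩
  · intro b hb
    have h1 := h _ (Function.invFunOn_mem (hφ.surjOn hb))
    rwa [Function.invFunOn_eq (hφ.surjOn hb)] at h1

theorem pick_bind (A : Finset α) (x : PMF β) (f : α → PMF β) (g : β → PMF γ) :
    (pick A x f).bind g = pick A (x.bind g) fun a => (f a).bind g := by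
  unfold SetValued.pick
  split_ifs
  · rw [PMF.bind_bind]
  · rfl

theorem map_pick (A : Finset α) (x : PMF β) (f : α → PMF β) (g : β → γ) :
    (pick A x f).map g = pick A (x.map g) fun a => (f a).map g := by
  unfold SetValued.pick
  split_ifs
  · rw [PMF.map_bind]
  · rfl

theorem pmf_bool_ext {p q : PMF Bool} (h : p true = q true) : p = q := by
  have hp := p.tsum_coe
  have hq := q.tsum_coe
  rw [tsum_bool] at hp hq
  ext b
  cases b with
  | true => exact h
  | false =>
    rw [h, ← hq] at hp
    exact (ENNReal.add_left_inj (PMF.apply_ne_top _ _)).1 hp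

/-- Programs have no coins, only uniform draws; a coin of probability n/M is the event u < n. -/
theorem coin_eq_map {n M : ℕ} (hn : n ≤ M) (hM : (Finset.range M).Nonempty)
    (h : (n : ℝ≥0) / (M : ℝ≥0) ≤ 1) :
    coin ((n : ℝ≥0) / (M : ℝ≥0)) h =
      (PMF.uniformOfFinset (Finset.range M) hM).map fun u => decide (u < n) := by
  have hM' : (M : ℝ≥0) ≠ 0 := by
    rw [Nat.cast_ne_zero]
    rintro rfl
    simp at hM
  refine pmf_bool_ext ?_
  rw [PMF.map_apply, tsum_eq_sum (s := Finset.range n)]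
  · rw [Finset.sum_congr rfl (g := fun _ => (M : ℝ≥0∞)⁻¹)]
    · rw [Finset.sum_const, Finset.card_range, nsmul_eq_mul]
      simp only [coin, PMF.ofFintype_apply, cond_true]
      rw [ENNReal.coe_div hM', div_eq_mul_inv]
      simp
    · intro u hu
      have hu' := Finset.mem_range.1 hu
      rw [if_pos (by simp [hu']), PMF.uniformOfFinset_apply_of_mem hM
        (Finset.mem_range.2 (hu'.trans_le hn)), Finset.card_range]
  · intro u hu
    rw [if_neg (by simpa using hu)]

/-- `n` steps of the chain with transition law `f`. -/
def iterate (f : α → PMF α) : ℕ → α → PMF α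
  | 0, a => PMF.pure a
  | n + 1, a => (f a).bind (iterate f n)

theorem iterate_add (f : α → PMF α) (m n : ℕ) (a : α) :
    iterate f (m + n) a = (iterate f m a).bind (iterate f n) := by
  induction m generalizing a with
  | zero => rw [Nat.zero_add, iterate, PMF.pure_bind]
  | succ m ih =>
    rw [Nat.succ_add, iterate, iterate, PMF.bind_bind]
    congr 1
    funext b
    exact ih b

theorem iterate_one (f : α → PMF α) (a : α) : iterate f 1 a = f a := by
  rw [iterate]
  exact PMF.bind_pure _

theorem mem_support_iterate {f : α → PMF α} {I : ℕ → α → Prop} {n : ℕ} {a : α} (h0 : I 0 a)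
    (hstep : ∀ i < n, ∀ a, I i a → ∀ b ∈ (f a).support, I (i + 1) b) :
    ∀ b ∈ (iterate f n a).support, I n b := by
  induction n with
  | zero =>
    intro b hb
    rw [iterate, PMF.mem_support_pure_iff] at hb
    exact hb ▸ h0
  | succ n ih =>
    intro b hb
    rw [iterate_add, PMF.mem_support_bind_iff] at hb
    obtain ⟨c, hc, hb⟩ := hb
    rw [iterate_one] at hb
    exact hstep n (Nat.lt_succ_self n) c (ih (fun i hi => hstep i (hi.trans (Nat.lt_succ_self n))) c hc)
      b hb

end Coupling

/-! ### Reasoning about programs without their running time. -/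

section Execution

/-- The law of the final memory. -/
def Prog.exec (x : Triple) (p : Prog) (s : Mem) : PMF Mem := (p.run x s).map Prod.fst

variable {x : Triple} {s : Mem}

theorem exec_skip : Prog.skip.exec x s = PMF.pure s := by
  rw [Prog.exec, Prog.run, PMF.pure_map]

theorem exec_set {a : ℕ} {i e : Expr} :
    (Prog.set a i e).exec x s = PMF.pure (s.write a (i.val x s) (e.val x s)) := by
  rw [Prog.exec, Prog.run, PMF.pure_map]

theorem exec_rand {a : ℕ} {i e : Expr} :
    (Prog.rand a i e).exec x s = pick (Finset.range (e.val x s))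
      (PMF.pure (s.write a (i.val x s) 0)) fun u => PMF.pure (s.write a (i.val x s) u) := by
  rw [Prog.exec, Prog.run, map_pick]
  simp only [PMF.pure_map]

theorem exec_seq {p q : Prog} : (Prog.seq p q).exec x s = (p.exec x s).bind (q.exec x) := by
  rw [Prog.exec, Prog.run, PMF.map_bind, Prog.exec, PMF.bind_map]
  congr 1
  funext r
  simp only [Function.comp, PMF.map_bind, PMF.pure_map]
  rfl

theorem exec_ite {e : Expr} {p q : Prog} :
    (Prog.ite e p q).exec x s = if e.val x s ≠ 0 then p.exec x s else q.exec x s := by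
  rw [Prog.exec, Prog.run, PMF.map_bind]
  simp only [PMF.pure_map]
  split_ifs <;> rfl

theorem map_iter (f : Mem → PMF (Mem × ℕ)) (n : ℕ) (s : Mem) :
    (iter f n s).map Prod.fst = iterate (fun s => (f s).map Prod.fst) n s := by
  induction n generalizing s with
  | zero => rw [iter, iterate, PMF.pure_map]
  | succ n ih =>
    rw [iter, iterate, PMF.map_bind, PMF.bind_map]
    congr 1
    funext r
    simp only [Function.comp, PMF.map_bind, PMF.pure_map]
    rw [← ih]
    rfl

theorem exec_loop {e : Expr} {p : Prog} :
    (Prog.loop e p).exec x s = iterate (p.exec x) (e.val x s) s := by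
  rw [Prog.exec, Prog.run, PMF.map_bind]
  simp only [PMF.pure_map]
  exact map_iter _ _ _

theorem write_apply {a i v b j : ℕ} :
    s.write a i v b j = if b = a ∧ j = i then v else s b j := by
  unfold Mem.write
  by_cases h : b = a
  · subst h
    by_cases h' : j = i
    · subst h'; simp
    · simp [h']
  · simp [h]

theorem write_of_ne {a i v b : ℕ} (h : b ≠ a) : s.write a i v b = s b := by
  unfold Mem.write
  simp [h]

theorem write_self {a i v : ℕ} : s.write a i v a = Function.update (s a) i v := by
  unfold Mem.write
  simp

/-- The program does not write to array `a`. -/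
def Prog.keeps (a : ℕ) : Prog → Bool
  | skip => true
  | set b _ _ => b != a
  | rand b _ _ => b != a
  | seq p q => p.keeps a && q.keeps a
  | ite _ p q => p.keeps a && q.keeps a
  | loop _ p => p.keeps a

/-- A syntactic frame rule: it preserves unrelated arrays without a separate invariant for each. -/
theorem Prog.keeps_spec {a : ℕ} {p : Prog} (h : p.keeps a = true) {s : Mem} :
    ∀ s' ∈ (p.exec x s).support, s' a = s a := by
  induction p generalizing s with
  | skip =>
    intro s' hs
    rw [exec_skip, PMF.mem_support_pure_iff] at hs
    rw [hs]
  | set b i e =>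
    intro s' hs
    rw [exec_set, PMF.mem_support_pure_iff] at hs
    rw [hs, write_of_ne]
    simp only [keeps, bne_iff_ne] at h
    exact h.symm
  | rand b i e =>
    intro s' hs
    simp only [keeps, bne_iff_ne] at h
    rw [exec_rand] at hs
    rcases (Finset.range (e.val x s)).eq_empty_or_nonempty with h0 | h0
    · rw [h0, pick_empty, PMF.mem_support_pure_iff] at hs
      rw [hs, write_of_ne h.symm]
    · rw [mem_support_pick h0] at hs
      obtain ⟨u, -, hs⟩ := hs
      rw [PMF.mem_support_pure_iff] at hs
      rw [hs, write_of_ne h.symm]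
  | seq p q ihp ihq =>
    intro s' hs
    simp only [keeps, Bool.and_eq_true] at h
    rw [exec_seq, PMF.mem_support_bind_iff] at hs
    obtain ⟨s1, h1, h2⟩ := hs
    rw [ihq h.2 s' h2, ihp h.1 s1 h1]
  | ite e p q ihp ihq =>
    intro s' hs
    simp only [keeps, Bool.and_eq_true] at h
    rw [exec_ite] at hs
    split_ifs at hs
    · exact ihp h.1 s' hs
    · exact ihq h.2 s' hs
  | loop e p ih =>
    rw [exec_loop]
    exact mem_support_iterate (I := fun _ t => t a = s a) rfl
      fun _ _ _ ht t' ht' => (ih h t' ht').trans ht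

/-- Run programs one after another. -/
def block : List Prog → Prog
  | [] => Prog.skip
  | p :: l => Prog.seq p (block l)

theorem exec_block_nil : (block []).exec x s = PMF.pure s := exec_skip

theorem exec_block_cons {p : Prog} {l : List Prog} :
    (block (p :: l)).exec x s = (p.exec x s).bind ((block l).exec x) := exec_seq

/-- Every final memory satisfies `Q`. -/
def Post (x : Triple) (p : Prog) (s : Mem) (Q : Mem → Prop) : Prop :=
  ∀ s' ∈ (p.exec x s).support, Q s'

theorem Post.mono {p : Prog} {Q Q' : Mem → Prop} (h : Post x p s Q) (hQ : ∀ t, Q t → Q' t) :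
    Post x p s Q' := fun t ht => hQ t (h t ht)

theorem Post.and {p : Prog} {Q Q' : Mem → Prop} (h : Post x p s Q) (h' : Post x p s Q') :
    Post x p s fun t => Q t ∧ Q' t := fun t ht => ⟨h t ht, h' t ht⟩

theorem Post.set {a : ℕ} {i e : Expr} {Q : Mem → Prop} (h : Q (s.write a (i.val x s) (e.val x s))) :
    Post x (Prog.set a i e) s Q := by
  intro t ht
  rw [exec_set, PMF.mem_support_pure_iff] at ht
  exact ht ▸ h

theorem Post.skip {Q : Mem → Prop} (h : Q s) : Post x Prog.skip s Q := by
  intro t ht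
  rw [exec_skip, PMF.mem_support_pure_iff] at ht
  exact ht ▸ h

theorem Post.ite {e : Expr} {p q : Prog} {Q : Mem → Prop} (h1 : e.val x s ≠ 0 → Post x p s Q)
    (h2 : e.val x s = 0 → Post x q s Q) : Post x (Prog.ite e p q) s Q := by
  intro t ht
  rw [exec_ite] at ht
  split_ifs at ht with h
  · exact h1 h t ht
  · exact h2 (not_not.1 h) t ht

theorem Post.nil {Q : Mem → Prop} (h : Q s) : Post x (block []) s Q := Post.skip h

theorem Post.cons {p : Prog} {l : List Prog} {Q Q' : Mem → Prop} (h : Post x p s Q)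
    (h' : ∀ t, Q t → Post x (block l) t Q') : Post x (block (p :: l)) s Q' := by
  intro t ht
  rw [exec_block_cons, PMF.mem_support_bind_iff] at ht
  obtain ⟨s1, h1, h2⟩ := ht
  exact h' s1 (h s1 h1) t h2

theorem Post.cons_set {a : ℕ} {i e : Expr} {l : List Prog} {Q : Mem → Prop}
    (h : Post x (block l) (s.write a (i.val x s) (e.val x s)) Q) :
    Post x (block (Prog.set a i e :: l)) s Q :=
  Post.cons (Q := fun t => t = s.write a (i.val x s) (e.val x s)) (Post.set rfl)
    fun _ ht => ht ▸ h

theorem Post.loop {e : Expr} {p : Prog} {n : ℕ} (hn : e.val x s = n) (I : ℕ → Mem → Prop)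
    (h0 : I 0 s) (hstep : ∀ i < n, ∀ t, I i t → Post x p t (I (i + 1))) :
    Post x (Prog.loop e p) s (I n) := by
  intro t ht
  rw [exec_loop, hn] at ht
  exact mem_support_iterate (I := I) h0 hstep t ht

theorem Lift.cons {α : Type} {R : α → Mem → Prop} {μ : PMF α} {p : Prog} {l : List Prog}
    {Q : Mem → Prop} (h : Post x p s Q) (h' : ∀ t, Q t → Lift R μ ((block l).exec x t)) :
    Lift R μ ((block (p :: l)).exec x s) := by
  rw [exec_block_cons]
  exact Lift.of_right fun t ht => h' t (h t ht)

theorem Lift.cons_set {α : Type} {R : α → Mem → Prop} {μ : PMF α} {a : ℕ} {i e : Expr}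
    {l : List Prog}
    (h : Lift R μ ((block l).exec x (s.write a (i.val x s) (e.val x s)))) :
    Lift R μ ((block (Prog.set a i e :: l)).exec x s) := by
  rw [exec_block_cons, exec_set, PMF.pure_bind]
  exact h

theorem Lift.iterate {α : Type} {R : α → Mem → Prop} {f : α → PMF α} {g : Mem → PMF Mem}
    (h : ∀ a s, R a s → Lift R (f a) (g s)) (n : ℕ) {a : α} {s : Mem} (has : R a s) :
    Lift R (iterate f n a) (SetValued.iterate g n s) := by
  induction n generalizing a s with
  | zero => exact Lift.pure has
  | succ n ih => exact (h a s has).bind fun b t _ _ hbt => ih hbt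

end Execution

/-! ### Running time bounds. -/

section Cost

/-- Loop bounds that can be read off from the input. -/
def Expr.static : Expr → Bool
  | lit _ => true
  | get 0 (lit 0) => true
  | get 0 (lit 2) => true
  | add e f => e.static && f.static
  | _ => false

/-- A polynomial bound for the value of a static expression. -/
def Expr.bound : Expr → MvPolynomial (Fin 3) ℕ
  | lit n => (n : MvPolynomial (Fin 3) ℕ)
  | get 0 (lit 0) => MvPolynomial.X 1
  -- The accuracy parameter is the ceiling of log₂ δ⁻¹, at most 2 log δ⁻¹ + 1 because log 2 > 1/2.
  | get 0 (lit 2) => 2 * MvPolynomial.X 2 + 1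
  | add e f => e.bound + f.bound
  | _ => 0

/-- All loop bounds are static and the input is never overwritten. -/
def Prog.static : Prog → Bool
  | skip => true
  | set a _ _ => a != 0
  | rand a _ _ => a != 0
  | seq p q => p.static && q.static
  | ite _ p q => p.static && q.static
  | loop e p => e.static && p.static

/-- A polynomial bound for the running time of a static program. -/
def Prog.bound : Prog → MvPolynomial (Fin 3) ℕ
  | skip => 1
  | set _ i e => ((i.cost + e.cost + 1 : ℕ) : MvPolynomial (Fin 3) ℕ)
  | rand _ i e => ((i.cost + e.cost + 1 : ℕ) : MvPolynomial (Fin 3) ℕ)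
  | seq p q => p.bound + q.bound
  | ite e p q => ((e.cost + 1 : ℕ) : MvPolynomial (Fin 3) ℕ) + (p.bound + q.bound)
  | loop e p => ((e.cost + 1 : ℕ) : MvPolynomial (Fin 3) ℕ) + e.bound * (p.bound + 1)

variable {x : Triple} {b : ℕ} {y : Fin 3 → ℝ}

theorem aeval_nonneg (hy : ∀ i, 0 ≤ y i) (p : MvPolynomial (Fin 3) ℕ) :
    0 ≤ MvPolynomial.aeval y p := by
  induction p using MvPolynomial.induction_on with
  | C a => simp
  | add p q hp hq => rw [map_add]; exact add_nonneg hp hq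
  | mul_X p i hp => rw [map_mul, MvPolynomial.aeval_X]; exact mul_nonneg hp (hy i)

theorem Expr.val_le_bound (hk : (x.k : ℝ) = y 1) (hb : (b : ℝ) ≤ 2 * y 2 + 1) {s : Mem}
    (hs : s 0 = initMem x b 0) {e : Expr} (he : e.static = true) :
    (e.val x s : ℝ) ≤ MvPolynomial.aeval y e.bound := by
  induction e using Expr.static.induct with
  | case1 n => simp [val, bound]
  | case2 => simp [val, bound, hs, initMem, hk]
  | case3 => simpa [val, bound, hs, initMem] using hb
  | case4 e f ihe ihf =>
    simp only [static, Bool.and_eq_true] at he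
    simp only [val, bound, map_add, Nat.cast_add]
    exact add_le_add (ihe he.1) (ihf he.2)
  | case5 e h1 h2 h3 h4 =>
    exfalso
    unfold static at he
    split at he <;> simp_all

theorem iter_cost {f : Mem → PMF (Mem × ℕ)} {P : Mem → Prop} {c : ℝ}
    (hf : ∀ s, P s → ∀ r ∈ (f s).support, P r.1 ∧ (r.2 : ℝ) ≤ c) (n : ℕ) {s : Mem} (hs : P s) :
    ∀ r ∈ (iter f n s).support, P r.1 ∧ (r.2 : ℝ) ≤ n * (c + 1) := by
  induction n generalizing s with
  | zero =>
    intro r hr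
    rw [iter, PMF.mem_support_pure_iff] at hr
    subst hr
    simpa using hs
  | succ n ih =>
    intro r hr
    rw [iter, PMF.mem_support_bind_iff] at hr
    obtain ⟨r1, h1, hr⟩ := hr
    rw [PMF.mem_support_bind_iff] at hr
    obtain ⟨r2, h2, hr⟩ := hr
    rw [PMF.mem_support_pure_iff] at hr
    subst hr
    obtain ⟨h3, h4⟩ := hf s hs r1 h1
    obtain ⟨h5, h6⟩ := ih h3 r2 h2
    refine ⟨h5, ?_⟩
    push_cast
    linarith

/-- Array 0 is never overwritten, so the loop lengths do not depend on the random draws; its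
invariance is carried along in the induction. -/
theorem Prog.cost_le_bound (hy : ∀ i, 0 ≤ y i) (hk : (x.k : ℝ) = y 1) (hb : (b : ℝ) ≤ 2 * y 2 + 1)
    {p : Prog} (hp : p.static = true) {s : Mem} (hs : s 0 = initMem x b 0) :
    ∀ r ∈ (p.run x s).support, r.1 0 = initMem x b 0 ∧ (r.2 : ℝ) ≤ MvPolynomial.aeval y p.bound := by
  induction p generalizing s with
  | skip =>
    intro r hr
    rw [run, PMF.mem_support_pure_iff] at hr
    subst hr
    exact ⟨hs, by simp [bound]⟩
  | set a i e =>
    intro r hr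
    simp only [static, bne_iff_ne] at hp
    rw [run, PMF.mem_support_pure_iff] at hr
    subst hr
    exact ⟨(write_of_ne hp.symm).trans hs, by simp only [bound, map_natCast]; exact le_rfl⟩
  | rand a i e =>
    intro r hr
    simp only [static, bne_iff_ne] at hp
    rw [run] at hr
    rcases (Finset.range (e.val x s)).eq_empty_or_nonempty with h0 | h0
    · rw [h0, pick_empty, PMF.mem_support_pure_iff] at hr
      subst hr
      exact ⟨(write_of_ne hp.symm).trans hs, by simp only [bound, map_natCast]; exact le_rfl⟩
    · rw [mem_support_pick h0] at hr
      obtain ⟨u, -, hr⟩ := hr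
      rw [PMF.mem_support_pure_iff] at hr
      subst hr
      exact ⟨(write_of_ne hp.symm).trans hs, by simp only [bound, map_natCast]; exact le_rfl⟩
  | seq p q ihp ihq =>
    intro r hr
    simp only [static, Bool.and_eq_true] at hp
    rw [run, PMF.mem_support_bind_iff] at hr
    obtain ⟨r1, h1, hr⟩ := hr
    rw [PMF.mem_support_bind_iff] at hr
    obtain ⟨r2, h2, hr⟩ := hr
    rw [PMF.mem_support_pure_iff] at hr
    subst hr
    obtain ⟨h3, h4⟩ := ihp hp.1 hs r1 h1
    obtain ⟨h5, h6⟩ := ihq hp.2 h3 r2 h2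
    refine ⟨h5, ?_⟩
    simp only [bound, map_add]
    push_cast
    linarith
  | ite e p q ihp ihq =>
    intro r hr
    simp only [static, Bool.and_eq_true] at hp
    rw [run, PMF.mem_support_bind_iff] at hr
    obtain ⟨r1, h1, hr⟩ := hr
    rw [PMF.mem_support_pure_iff] at hr
    subst hr
    have hp0 := aeval_nonneg hy p.bound
    have hq0 := aeval_nonneg hy q.bound
    simp only [bound, map_add, map_natCast]
    push_cast
    split_ifs at h1
    · obtain ⟨h3, h4⟩ := ihp hp.1 hs r1 h1
      exact ⟨h3, by linarith⟩
    · obtain ⟨h3, h4⟩ := ihq hp.2 hs r1 h1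
      exact ⟨h3, by linarith⟩
  | loop e p ih =>
    intro r hr
    simp only [static, Bool.and_eq_true] at hp
    rw [run, PMF.mem_support_bind_iff] at hr
    obtain ⟨r1, h1, hr⟩ := hr
    rw [PMF.mem_support_pure_iff] at hr
    subst hr
    obtain ⟨h3, h4⟩ := iter_cost (P := fun s => s 0 = initMem x b 0)
      (c := MvPolynomial.aeval y p.bound) (fun s hs => ih hp.2 hs) _ hs r1 h1
    refine ⟨h3, ?_⟩
    have h5 := Expr.val_le_bound hk hb hs hp.1
    have h6 := aeval_nonneg hy p.bound
    simp only [bound, map_add, map_mul, map_natCast, map_one]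
    push_cast
    nlinarith

end Cost

/-! ### The chain as a random process. -/

section ChainLaw

variable {x : Triple}

/-- One step of the chain: generate a proposal and accept or reject it by comparing weights. -/
def metStep (x : Triple) (T : Filling x.Y) : PMF (Filling x.Y) :=
  (svGen x).bind fun F => pick (Finset.range (weight x T)) (PMF.pure T) fun u =>
    PMF.pure (if u < weight x F then F else T)

theorem toReal_bind_eq_sum {μ : PMF (Filling x.Y)} (hμ : ∀ T ∈ μ.support, T ∈ SVT x)
    {α : Type} (f : Filling x.Y → PMF α) (a : α) :
    (μ.bind f a).toReal = ∑ T : SVT x, (μ T.1).toReal * (f T.1 a).toReal := by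
  rw [PMF.bind_apply, tsum_eq_sum (s := SVT x), ENNReal.toReal_sum]
  · simp only [ENNReal.toReal_mul]
    exact (Finset.sum_coe_sort (SVT x) fun T => (μ T).toReal * (f T a).toReal).symm
  · exact fun T _ => ENNReal.mul_ne_top (PMF.apply_ne_top _ _) (PMF.apply_ne_top _ _)
  · intro T hT
    rw [(PMF.apply_eq_zero_iff μ T).2 fun h => hT (hμ T h), zero_mul]

theorem sum_toReal_eq_one {μ : PMF (Filling x.Y)} (hμ : ∀ T ∈ μ.support, T ∈ SVT x) :
    ∑ T : SVT x, (μ T.1).toReal = 1 := by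
  have h := toReal_bind_eq_sum hμ (fun _ => PMF.pure ()) ()
  simpa using h.symm

theorem metStep_support {T : Filling x.Y} (hT : T ∈ SVT x) :
    ∀ F ∈ (metStep x T).support, F ∈ SVT x := by
  intro F hF
  rw [metStep, PMF.mem_support_bind_iff] at hF
  obtain ⟨G, hG, hF⟩ := hF
  rw [mem_support_pick ⟨0, Finset.mem_range.2 (weight_pos hT)⟩] at hF
  obtain ⟨u, -, hF⟩ := hF
  rw [PMF.mem_support_pure_iff] at hF
  rw [hF]
  split_ifs
  · exact svGen_support hG
  · exact hT

/-- Proposing F and accepting with probability min(w(F), w(T))/w(T) gives min(p(F), p(T)), since p w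
is constant. -/
theorem metStep_apply (T F : SVT x) : (metStep x T.1 F.1).toReal = mcSVT x T F := by
  have hne : ∀ F : SVT x, F ≠ T → (metStep x T.1 F.1).toReal = mcSVT x T F := by
    intro F hFT
    have hFT' : F.1 ≠ T.1 := fun h => hFT (Subtype.ext h)
    have hw : (0 : ℝ) < weight x T.1 := by exact_mod_cast weight_pos T.2
    rw [metStep, toReal_bind_eq_sum (fun _ => svGen_support), Finset.sum_eq_single F,
      pick_apply_toReal ⟨0, Finset.mem_range.2 (weight_pos T.2)⟩, Finset.card_range, mcSVT_of_ne hFT]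
    · have h1 : ∀ u ∈ Finset.range (weight x T.1),
          ((PMF.pure (if u < weight x F.1 then F.1 else T.1) : PMF (Filling x.Y)) F.1).toReal =
            if u < weight x F.1 then 1 else 0 := by
        intro u _
        split_ifs <;> simp [hFT']
      rw [Finset.sum_congr rfl h1, Finset.sum_boole]
      have h2 : (Finset.range (weight x T.1)).filter (fun u => u < weight x F.1) =
          Finset.range (min (weight x F.1) (weight x T.1)) := by
        ext u; simp; tauto
      rw [h2, Finset.card_range]
      have e1 := probSVG_mul_weight T
      have e2 := probSVG_mul_weight F
      have hF := probSVG_pos F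
      change probSVG x F * _ = _
      rw [← e1] at e2
      -- The smaller weight belongs to the larger probability.
      rcases le_total (weight x F.1) (weight x T.1) with h | h
      · have h' : (weight x F.1 : ℝ) ≤ weight x T.1 := by exact_mod_cast h
        rw [min_eq_left h, min_eq_right, mul_left_comm, e2, mul_comm, mul_assoc,
          mul_inv_cancel₀ hw.ne', mul_one]
        nlinarith
      · have h' : (weight x T.1 : ℝ) ≤ weight x F.1 := by exact_mod_cast h
        rw [min_eq_right h, min_eq_left, inv_mul_cancel₀ hw.ne', mul_one]
        nlinarith
    · intro G _ hGF
      rw [pick_apply_toReal ⟨0, Finset.mem_range.2 (weight_pos T.2)⟩, Finset.sum_eq_zero, mul_zero,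
        mul_zero]
      intro u _
      have hGF' : F.1 ≠ G.1 := fun h => hGF (Subtype.ext h.symm)
      split_ifs <;> simp [hFT', hGF']
    · exact fun h => absurd (Finset.mem_univ _) h
  by_cases h : F = T
  · subst h
    -- The diagonal entry follows because both rows sum to 1.
    have h1 := sum_toReal_eq_one (metStep_support F.2)
    have h2 := mcSVT_row F
    rw [← Finset.add_sum_erase _ _ (Finset.mem_univ F)] at h1 h2
    rw [Finset.sum_congr rfl fun G hG => hne G (Finset.ne_of_mem_erase hG)] at h1
    linarith
  · exact hne F h

/-- The law of the chain after `t` steps from an output of `SVGen`. -/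
def chainLaw (x : Triple) (t : ℕ) : PMF (Filling x.Y) := (svGen x).bind (iterate (metStep x) t)

theorem chainLaw_succ (x : Triple) (t : ℕ) :
    chainLaw x (t + 1) = (chainLaw x t).bind (metStep x) := by
  rw [chainLaw, chainLaw, PMF.bind_bind]
  congr 1
  funext T
  rw [iterate_add]
  congr 1
  funext F
  exact iterate_one _ _

theorem chainLaw_support (x : Triple) (t : ℕ) : ∀ T ∈ (chainLaw x t).support, T ∈ SVT x := by
  induction t with
  | zero =>
    intro T hT
    have : chainLaw x 0 = svGen x := PMF.bind_pure _
    rw [this] at hT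
    exact svGen_support hT
  | succ t ih =>
    intro T hT
    rw [chainLaw_succ, PMF.mem_support_bind_iff] at hT
    obtain ⟨F, hF, hT⟩ := hT
    exact metStep_support (ih F hF) T hT

theorem chainLaw_apply (x : Triple) (t : ℕ) (T : SVT x) :
    (chainLaw x t T.1).toReal = Matrix.vecMul (probSVG x) (mcSVT x ^ t) T := by
  induction t generalizing T with
  | zero =>
    have : chainLaw x 0 = svGen x := PMF.bind_pure _
    rw [this, pow_zero, Matrix.vecMul_one]
    rfl
  | succ t ih =>
    rw [chainLaw_succ, toReal_bind_eq_sum (chainLaw_support x t), pow_succ, ← Matrix.vecMul_vecMul]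
    simp only [ih, metStep_apply]
    rfl

end ChainLaw

/-! ### Shapes stored as lists of row lengths. -/

section Rows

variable {Y : YoungDiagram} {A : Finset Y.cells} {L : ℕ → ℕ} {c : Y.cells}

/-- `L` lists the row lengths of the set `A` of boxes. -/
def IsRows (A : Finset Y.cells) (L : ℕ → ℕ) : Prop :=
  ∀ i j, j < L i ↔ ∃ h : (i, j) ∈ Y.cells, (⟨(i, j), h⟩ : Y.cells) ∈ A

theorem isRows_rowLen (hA : IsLowerSet (A : Set Y.cells)) : IsRows A (rowLen A hA) :=
  fun _ _ => lt_rowLen_iff hA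

theorem IsRows.mem_iff (h : IsRows A L) : c ∈ A ↔ c.1.2 < L c.1.1 := by
  rw [h]
  exact ⟨fun hc => ⟨c.2, hc⟩, fun ⟨_, hc⟩ => hc⟩

theorem IsRows.antitone (h : IsRows A L) (hA : IsLowerSet (A : Set Y.cells)) : Antitone L := by
  refine antitone_nat_of_succ_le fun i => ?_
  by_contra hlt
  push Not at hlt
  obtain ⟨hm, hmA⟩ := (h _ _).1 hlt
  have hle : ((i, L i) : ℕ × ℕ) ≤ (i + 1, L i) := ⟨by simp, le_rfl⟩
  have : L i < L i := (h i (L i)).2 ⟨Y.isLowerSet hle hm,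
    hA (show (⟨(i, L i), _⟩ : Y.cells) ≤ ⟨(i + 1, L i), hm⟩ from hle) hmA⟩
  exact lt_irrefl _ this

theorem IsRows.card_filter (h : IsRows A L) (i : ℕ) : (A.filter fun c => c.1.1 = i).card = L i := by
  rw [← Finset.card_range (L i), ← Finset.card_image_of_injOn (f := fun d : Y.cells => d.1.2)]
  · congr 1
    ext j
    simp only [Finset.mem_image, Finset.mem_filter, Finset.mem_range, h i j]
    constructor
    · rintro ⟨⟨⟨i', j'⟩, hm⟩, ⟨hd, e⟩, rfl⟩
      simp only at e
      subst e
      exact ⟨hm, hd⟩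
    · rintro ⟨hm, hd⟩
      exact ⟨⟨_, hm⟩, ⟨hd, rfl⟩, rfl⟩
  · intro d hd d' hd' e
    simp only [Finset.coe_filter, Set.mem_ofPred_eq] at hd hd'
    exact Subtype.ext (Prod.ext (hd.2.trans hd'.2.symm) e)

theorem IsRows.le_card (h : IsRows A L) (i : ℕ) : L i ≤ A.card := by
  rw [← h.card_filter i]
  exact Finset.card_le_card (Finset.filter_subset _ _)

theorem IsRows.sum_le_card (h : IsRows A L) (n : ℕ) : ∑ i ∈ Finset.range n, L i ≤ A.card := by
  rw [Finset.sum_congr rfl fun i _ => (h.card_filter i).symm, ← Finset.card_biUnion]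
  · exact Finset.card_le_card (Finset.biUnion_subset.2 fun i _ => Finset.filter_subset _ _)
  · intro i _ j _ hij
    rw [Function.onFun, Finset.disjoint_filter]
    intro c _ h1 h2
    exact hij (h1.symm.trans h2)

/-- If row i is nonempty, so are rows 0, …, i, which makes at least i + 1 boxes. Hence k + 1 rounds
suffice to treat all rows. -/
theorem IsRows.eq_zero (h : IsRows A L) (hA : IsLowerSet (A : Set Y.cells)) {i : ℕ}
    (hi : A.card ≤ i) : L i = 0 := by
  by_contra h0
  have h1 : ∀ l ∈ Finset.range (i + 1), 1 ≤ L l := fun l hl => by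
    have := h.antitone hA (Nat.lt_succ_iff.1 (Finset.mem_range.1 hl))
    omega
  have h2 := Finset.card_nsmul_le_sum _ _ _ h1
  rw [Finset.card_range, smul_eq_mul, mul_one] at h2
  exact absurd (h2.trans (h.sum_le_card (i + 1))) (by omega)

theorem IsRows.sum_eq_card (h : IsRows A L) (hA : IsLowerSet (A : Set Y.cells)) {n : ℕ}
    (hn : A.card ≤ n) : ∑ i ∈ Finset.range n, L i = A.card := by
  rw [Finset.card_eq_sum_card_fiberwise (f := fun c : Y.cells => c.1.1) (t := Finset.range n)]
  · exact Finset.sum_congr rfl fun i _ => (h.card_filter i).symm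
  · intro c hc
    rw [Finset.mem_coe, Finset.mem_range]
    by_contra hge
    have h1 : L c.1.1 = 0 := h.eq_zero hA (hn.trans (not_lt.1 hge))
    have h2 := h.mem_iff.1 hc
    omega

theorem IsRows.mem_hook_iff (h : IsRows A L) {d : Y.cells} : d ∈ hook A c ↔
    d.1.2 < L d.1.1 ∧ ((d.1.1 = c.1.1 ∧ c.1.2 < d.1.2) ∨ (d.1.2 = c.1.2 ∧ c.1.1 < d.1.1)) := by
  rw [hook, Finset.mem_filter, h.mem_iff]

theorem IsRows.corner (h : IsRows A L) (hc : c ∈ A) (hcor : hook A c = ∅) :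
    L c.1.1 = c.1.2 + 1 := by
  have h1 := h.mem_iff.1 hc
  by_contra hne
  obtain ⟨hm, hmA⟩ := (h c.1.1 (c.1.2 + 1)).1 (by omega)
  have : (⟨(c.1.1, c.1.2 + 1), hm⟩ : Y.cells) ∈ hook A c :=
    Finset.mem_filter.2 ⟨hmA, Or.inl ⟨rfl, Nat.lt_succ_self _⟩⟩
  simp [hcor] at this

theorem IsRows.erase (h : IsRows A L) (hc : c ∈ A) (hcor : hook A c = ∅) :
    IsRows (A.erase c) (Function.update L c.1.1 (L c.1.1 - 1)) := by
  intro i j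
  have h1 := h.corner hc hcor
  simp only [Finset.mem_erase]
  by_cases hi : i = c.1.1
  · subst hi
    rw [Function.update_self]
    constructor
    · intro hj
      obtain ⟨hm, hmA⟩ := (h c.1.1 j).1 (by omega)
      refine ⟨hm, fun he => ?_, hmA⟩
      have := congrArg (fun d : Y.cells => d.1.2) he
      simp only at this
      omega
    · rintro ⟨hm, hne, hmA⟩
      have h2 := (h c.1.1 j).2 ⟨hm, hmA⟩
      have : j ≠ c.1.2 := fun hj => hne (Subtype.ext (Prod.ext rfl hj))
      omega
  · rw [Function.update_of_ne hi, h]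
    refine exists_congr fun hm => (and_iff_right fun he => hi ?_).symm
    exact congrArg (fun d : Y.cells => d.1.1) he

/-- The box at the end of row `i` can be added to the shape with row lengths `L`. -/
def IsOuter (Y : YoungDiagram) (L : ℕ → ℕ) (i : ℕ) : Prop :=
  (i, L i) ∈ Y.cells ∧ (i = 0 ∨ L i < L (i - 1))

/-- The north-west boxes of the complement are the places in the diagram where one box can be added
to `A`; they can be read off from consecutive row lengths. -/
theorem IsRows.mem_NW_iff (h : IsRows A L) (hA : IsLowerSet (A : Set Y.cells)) :
    c ∈ NW Aᶜ ↔ c.1.2 = L c.1.1 ∧ IsOuter Y L c.1.1 := by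
  simp only [SetValued.mem_NW_iff, Finset.mem_compl, h.mem_iff, not_lt]
  constructor
  · rintro ⟨h1, h2⟩
    have he : c.1.2 = L c.1.1 := by
      have hle : (c.1.1, L c.1.1) ≤ c.1 := ⟨le_rfl, h1⟩
      have := h2 ⟨(c.1.1, L c.1.1), Y.isLowerSet hle c.2⟩ le_rfl hle
      exact (congrArg (fun d : Y.cells => d.1.2) this).symm
    refine ⟨he, ?_, ?_⟩
    · rw [← he]; exact c.2
    · by_contra hcon
      push Not at hcon
      have hle : (c.1.1 - 1, c.1.2) ≤ c.1 := ⟨Nat.sub_le _ _, le_rfl⟩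
      have := h2 ⟨(c.1.1 - 1, c.1.2), Y.isLowerSet hle c.2⟩ (hcon.2.trans he.ge) hle
      have := congrArg (fun d : Y.cells => d.1.1) this
      simp only at this
      omega
  · rintro ⟨h1, -, h3⟩
    refine ⟨h1.ge, fun d hd hdc => ?_⟩
    have hle : d.1.1 ≤ c.1.1 ∧ d.1.2 ≤ c.1.2 := hdc
    have he : d.1.1 = c.1.1 := by
      by_contra hne
      have := h.antitone hA (show d.1.1 ≤ c.1.1 - 1 by omega)
      omega
    rw [he] at hd
    exact Subtype.ext (Prod.ext he (by omega))

/-- The boxes of a hook are numbered consecutively, first along the arm, then along the leg. -/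
theorem IsRows.bijOn_hook (h : IsRows A L) (hc : c ∈ A) {leg : ℕ}
    (hleg : ∀ n, n < leg ↔ c.1.2 < L (c.1.1 + n + 1)) :
    Set.BijOn (fun u => cellAt c (if u < L c.1.1 - (c.1.2 + 1) then (c.1.1, c.1.2 + u + 1)
      else (c.1.1 + (u - (L c.1.1 - (c.1.2 + 1))) + 1, c.1.2)))
      (Finset.range (L c.1.1 - (c.1.2 + 1) + leg) : Set ℕ) (hook A c : Set Y.cells) := by
  have hc' := h.mem_iff.1 hc
  have hval : ∀ u ∈ Finset.range (L c.1.1 - (c.1.2 + 1) + leg),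
      (cellAt c (if u < L c.1.1 - (c.1.2 + 1) then (c.1.1, c.1.2 + u + 1)
      else (c.1.1 + (u - (L c.1.1 - (c.1.2 + 1))) + 1, c.1.2))).1 =
        if u < L c.1.1 - (c.1.2 + 1) then (c.1.1, c.1.2 + u + 1)
      else (c.1.1 + (u - (L c.1.1 - (c.1.2 + 1))) + 1, c.1.2) := by
    intro u hu
    rw [Finset.mem_range] at hu
    split_ifs with hlt
    · obtain ⟨hm, -⟩ := (h c.1.1 (c.1.2 + u + 1)).1 (by omega)
      rw [cellAt, dif_pos hm]
    · obtain ⟨hm, -⟩ := (h (c.1.1 + (u - (L c.1.1 - (c.1.2 + 1))) + 1) c.1.2).1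
        ((hleg _).1 (by omega))
      rw [cellAt, dif_pos hm]
  refine ⟨?_, ?_, ?_⟩
  · intro u hu
    rw [Finset.mem_coe, h.mem_hook_iff, hval u hu]
    rw [Finset.mem_coe, Finset.mem_range] at hu
    split_ifs with hlt
    · exact ⟨by simp only; omega, Or.inl ⟨rfl, by simp only; omega⟩⟩
    · exact ⟨(hleg _).1 (by omega), Or.inr ⟨rfl, by simp only; omega⟩⟩
  · intro u hu v hv huv
    have := congrArg Subtype.val huv
    simp only [hval u hu, hval v hv] at this
    rw [Finset.mem_coe, Finset.mem_range] at hu hv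
    split_ifs at this with h1 h2 h2 <;> simp only [Prod.mk.injEq] at this <;> omega
  · intro d hd
    rw [Finset.mem_coe, h.mem_hook_iff] at hd
    obtain ⟨h1, ⟨h2, h3⟩ | ⟨h2, h3⟩⟩ := hd
    · rw [h2] at h1
      have hu : d.1.2 - c.1.2 - 1 ∈ Finset.range (L c.1.1 - (c.1.2 + 1) + leg) := by
        rw [Finset.mem_range]; omega
      refine ⟨_, hu, Subtype.ext ?_⟩
      simp only [hval _ hu]
      rw [if_pos (by omega)]
      exact Prod.ext h2.symm (by simp only; omega)
    · obtain ⟨n, hn⟩ : ∃ n, d.1.1 = c.1.1 + n + 1 := ⟨d.1.1 - c.1.1 - 1, by omega⟩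
      rw [hn, h2] at h1
      have hlt := (hleg n).2 h1
      have hu : L c.1.1 - (c.1.2 + 1) + n ∈ Finset.range (L c.1.1 - (c.1.2 + 1) + leg) := by
        rw [Finset.mem_range]; omega
      refine ⟨_, hu, Subtype.ext ?_⟩
      simp only [hval _ hu]
      rw [if_neg (by omega)]
      exact Prod.ext (by simp only; omega) h2.symm

end Rows

/-! ### The sampler as a program. -/

section Program

/-- The scalar variable number `a`. -/
abbrev var (a : ℕ) : Expr := Expr.get a (.lit 0)

/-- Assignment to the scalar variable number `a`. -/
abbrev setv (a : ℕ) (e : Expr) : Prog := Prog.set a (.lit 0) e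

/-- The input `k + 1`. -/
abbrev kSucc : Expr := .add (var 0) (.lit 1)

/-- Extend row number `var 14` by one box if the next box is empty. -/
def growRow : Prog :=
  .ite (.box (var 14) (.get 5 (var 14)))
    -- Inside the shape the status minus 1 is nonzero exactly for nonempty boxes.
    (.ite (.sub (.box (var 14) (.get 5 (var 14))) (.lit 1)) .skip
      (.set 5 (var 14) (.add (.get 5 (var 14)) (.lit 1)))) .skip

/-- Compute the length of row number `var 14` and add it to `var 11`. -/
def initRow : Prog := block [
  .set 5 (var 14) (.lit 0),
  .loop kSucc growRow,
  setv 11 (.add (var 11) (.get 5 (var 14))),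
  setv 14 (.add (var 14) (.lit 1))]

/-- Store the row lengths of the empty boxes in array 5 and their number in `var 11`. -/
def initRows : Prog := block [setv 14 (.lit 0), setv 11 (.lit 0), .loop kSucc initRow]

/-- Append the row `var 14` to the list of candidates in array 6, of length `var 17`. -/
def addRow : Prog := block [
  .set 6 (var 17) (var 14),
  setv 17 (.add (var 17) (.lit 1)),
  -- One addition of the old weight per candidate replaces the multiplication of the weight by their
  -- number.
  setv 18 (.add (var 18) (var 12))]

/-- Append the row `var 14` if it ends next to a box of `NW`. -/
def scanRow : Prog := block [
  .ite (.box (var 14) (.get 5 (var 14)))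
    (.ite (var 14)
      (.ite (.sub (.get 5 (.sub (var 14) (.lit 1))) (.get 5 (var 14))) addRow .skip) addRow) .skip,
  setv 14 (.add (var 14) (.lit 1))]

/-- Put `var 10` into a random box of `NW`, and multiply `var 12` by the number of these boxes. -/
def join : Prog := block [
  setv 17 (.lit 0), setv 18 (.lit 0), setv 14 (.lit 0),
  .loop kSucc scanRow,
  setv 12 (var 18),
  .rand 16 (.lit 0) (var 17),
  .set 3 (var 10) (.get 6 (var 16)),
  .set 4 (var 10) (.get 5 (.get 6 (var 16)))]

/-- Pass to the next row if the box number `var 15` is not in row `var 14`. -/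
def findRow : Prog :=
  .ite (.sub (.get 5 (var 14)) (var 15)) .skip
    (block [setv 15 (.sub (var 15) (.get 5 (var 14))), setv 14 (.add (var 14) (.lit 1))])

/-- Increase the leg length `var 19` if there is a further box. -/
def legStep : Prog :=
  .ite (.sub (.get 5 (.add (.add (var 14) (var 19)) (.lit 1))) (var 15))
    (setv 19 (.add (var 19) (.lit 1))) .skip

/-- One move of the hook walk from the box `(var 14, var 15)`. -/
def walkStep : Prog := block [
  setv 17 (.sub (.get 5 (var 14)) (.add (var 15) (.lit 1))),
  setv 19 (.lit 0),
  .loop (var 0) legStep,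
  .ite (.add (var 17) (var 19))
    (block [
      .rand 16 (.lit 0) (.add (var 17) (var 19)),
      .ite (.sub (var 17) (var 16)) (setv 15 (.add (.add (var 15) (var 16)) (.lit 1)))
        (setv 14 (.add (.add (var 14) (.sub (var 16) (var 17))) (.lit 1)))]) .skip]

/-- Put `var 10` into the corner `(var 14, var 15)`. -/
def fillCorner : Prog := block [
  .set 3 (var 10) (var 14),
  .set 4 (var 10) (var 15),
  .set 5 (var 14) (.sub (.get 5 (var 14)) (.lit 1)),
  setv 11 (.sub (var 11) (.lit 1))]

/-- Put `var 10` into an empty box found by a hook walk. -/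
def walk : Prog := block [
  .rand 15 (.lit 0) (var 11),
  setv 14 (.lit 0),
  .loop kSucc findRow,
  -- There are at most k empty boxes, so k moves reach a corner; further moves stay there.
  .loop (var 0) walkStep,
  fillCorner]

/-- Insert the value `var 10` and decrease it. -/
def insertStep : Prog := block [
  .ite (.sub (.get 0 (.lit 1)) (var 10))
    (block [
      .rand 16 (.lit 0) (var 10),
      -- Truncated subtraction tests u < M - |λ'|, an event of probability (M - |λ'|)/M for uniform
      -- u < M.
      .ite (.sub (.sub (var 10) (var 11)) (var 16)) join walk]) walk,
  setv 10 (.sub (var 10) (.lit 1))]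

/-- The random generation algorithm; the result is stored in arrays 3 and 4, its weight in
`var 12`. -/
def generate : Prog := block [initRows, setv 12 (.lit 1), setv 10 (var 0), .loop (var 0) insertStep]

/-- Copy the position of the value `var 20`. -/
def copyOne : Prog := block [
  .set 1 (var 20) (.get 3 (var 20)),
  .set 2 (var 20) (.get 4 (var 20)),
  setv 20 (.add (var 20) (.lit 1))]

/-- Make the proposal the current state. -/
def accept : Prog := block [setv 20 (.lit 0), .loop kSucc copyOne, setv 13 (var 12)]

/-- One step of the chain. -/
def metropolis : Prog := block [
  generate,
  .rand 16 (.lit 0) (var 13),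
  .ite (.sub (var 12) (var 16)) accept .skip]

/-- Run a program `(k + 1) ^ n` times. -/
def powLoop (p : Prog) : ℕ → Prog
  | 0 => p
  | n + 1 => .loop kSucc (powLoop p n)

/-- The sampler: `(k + 1) ^ C * b` steps of the chain, where `b` is the accuracy parameter. -/
def sampler (C : ℕ) : Prog := block [
  generate, accept, .loop (.get 0 (.lit 2)) (powLoop metropolis C)]

theorem static_powLoop {p : Prog} (hp : p.static = true) (n : ℕ) : (powLoop p n).static = true := by
  induction n with
  | zero => exact hp
  | succ n ih =>
    simp only [powLoop, Prog.static, ih, Bool.and_true]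
    rfl

theorem static_sampler (C : ℕ) : (sampler C).static = true := by
  have h1 : (powLoop metropolis C).static = true := static_powLoop rfl C
  have h2 : generate.static = true := rfl
  have h3 : accept.static = true := rfl
  simp only [sampler, block, Prog.static, h1, h2, h3, Bool.and_true, Expr.static]

end Program

/-! ### Specifications of the deterministic parts. -/

section Deterministic

variable {x : Triple} {s : Mem}

theorem write_write {a i v w : ℕ} : (s.write a i v).write a i w = s.write a i w := by
  funext b j
  simp only [write_apply]
  split_ifs <;> rfl

theorem write_eq_self {a i v : ℕ} (h : s a i = v) : s.write a i v = s := by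
  funext b j
  rw [write_apply]
  split_ifs with hb
  · rw [hb.1, hb.2, h]
  · rfl

theorem Post.keeps (p : Prog) (s : Mem) : Post x p s fun t => ∀ a, p.keeps a = true → t a = s a :=
  fun _ ht _ ha => Prog.keeps_spec ha _ ht

theorem val_box {r c : Expr} :
    (Expr.box r c).val x s = if h : (r.val x s, c.val x s) ∈ x.Y.cells then
        if x.S ⟨(r.val x s, c.val x s), h⟩ = ∅ then 1 else 2
      else 0 := by rw [Expr.val]

theorem val_box_ne_zero {r c : Expr} :
    (Expr.box r c).val x s ≠ 0 ↔ (r.val x s, c.val x s) ∈ x.Y.cells := by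
  rw [val_box]
  split_ifs with h1 h2 <;> simp [h1]

theorem val_box_eq_one {L : ℕ → ℕ} (hL : IsRows (emptyBoxes x.S) L) {r c : Expr} :
    (Expr.box r c).val x s = 1 ↔ c.val x s < L (r.val x s) := by
  rw [val_box, hL]
  simp only [mem_emptyBoxes]
  split_ifs with h1 h2
  · simp [h2, h1]
  · simp [h2, h1]
  · simp [h1]

theorem growRow_spec {L : ℕ → ℕ} (hL : IsRows (emptyBoxes x.S) L) {i : ℕ}
    (h : s 5 (s 14 0) = min i (L (s 14 0))) :
    Post x growRow s fun t => t = s.write 5 (s 14 0) (min (i + 1) (L (s 14 0))) := by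
  have hb := val_box_eq_one (s := s) hL (r := var 14) (c := .get 5 (var 14))
  simp only [Expr.val] at hb
  have hsame : ¬ (min i (L (s 14 0)) < L (s 14 0)) →
      s = s.write 5 (s 14 0) (min (i + 1) (L (s 14 0))) := by
    intro hlt
    exact (write_eq_self (by omega)).symm
  refine Post.ite (fun h0 => Post.ite (fun h1 => Post.skip (hsame ?_)) fun h1 => Post.set ?_)
    fun h0 => Post.skip (hsame ?_)
  · rw [← h, ← hb]
    simp only [Expr.val] at h1
    omega
  · have h2 : s 5 (s 14 0) < L (s 14 0) := by
      rw [← hb]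
      simp only [Expr.val] at h0 h1
      omega
    simp only [Expr.val]
    congr 1
    omega
  · rw [← h, ← hb]
    simp only [Expr.val] at h0
    omega

theorem initRow_spec {L : ℕ → ℕ} (hL : IsRows (emptyBoxes x.S) L) (hk : s 0 0 = x.k)
    (hle : L (s 14 0) ≤ x.k) :
    Post x initRow s fun t => t 0 = s 0 ∧ t 5 = Function.update (s 5) (s 14 0) (L (s 14 0)) ∧
      t 11 0 = s 11 0 + L (s 14 0) ∧ t 14 0 = s 14 0 + 1 := by
  refine Post.cons_set (Post.cons (Post.loop (n := x.k + 1) (by simp [Expr.val, write_apply, hk])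
    (fun i t => t = s.write 5 (s 14 0) (min i (L (s 14 0)))) ?_ ?_) ?_)
  · simp [Expr.val]
  · rintro i - t rfl
    have h14 : (s.write 5 (s 14 0) (min i (L (s 14 0)))) 14 0 = s 14 0 := by simp [write_apply]
    have := growRow_spec (s := s.write 5 (s 14 0) (min i (L (s 14 0)))) hL (i := i) (by
      rw [h14]; simp [write_apply])
    rw [h14, write_write] at this
    exact this
  · rintro t rfl
    refine Post.cons_set (Post.cons_set (Post.nil ⟨?_, ?_, ?_, ?_⟩))
    · simp [write_of_ne]
    · rw [write_of_ne (by decide), write_of_ne (by decide), write_self, min_eq_right (by omega)]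
    · simp [write_apply, Expr.val]
      omega
    · simp [write_apply, Expr.val]

/-- Only rows 0, …, k are rewritten and the table is reused for every proposal, so entries beyond k
must be 0 beforehand. -/
theorem initRows_spec {L : ℕ → ℕ} (hL : IsRows (emptyBoxes x.S) L) (hk : s 0 0 = x.k)
    (hz : ∀ i, x.k < i → s 5 i = 0) :
    Post x initRows s fun t => t 5 = L ∧ t 11 0 = (emptyBoxes x.S).card := by
  have hcard := x.pre.2.2.2.2
  have hlow := x.pre.isLowerSet
  refine Post.cons_set (Post.cons_set (Post.cons (Post.loop (n := x.k + 1)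
    (by simp [Expr.val, write_apply, hk])
    (fun i t => t 0 0 = x.k ∧ t 14 0 = i ∧ t 11 0 = ∑ l ∈ Finset.range i, L l ∧
      (∀ l < i, t 5 l = L l) ∧ ∀ l, x.k < l → t 5 l = 0) ?_ ?_) ?_))
  · simpa [write_apply, Expr.val, hk] using hz
  · rintro i hi t ⟨h0, h1, h2, h3, h4⟩
    refine (initRow_spec hL h0 ((hL.le_card _).trans hcard)).mono ?_
    rintro t' ⟨e0, e1, e2, e3⟩
    rw [h1] at e1 e2 e3
    refine ⟨by rw [e0, h0], e3, by rw [e2, h2, Finset.sum_range_succ], fun l hl => ?_, fun l hl => ?_⟩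
    · rw [e1]
      by_cases hli : l = i
      · subst hli; simp
      · rw [Function.update_of_ne hli]
        exact h3 l (by omega)
    · rw [e1, Function.update_of_ne (by omega)]
      exact h4 l hl
  · rintro t ⟨-, -, h2, h3, h4⟩
    refine Post.nil ⟨funext fun l => ?_, ?_⟩
    · by_cases hl : l < x.k + 1
      · exact h3 l hl
      · rw [h4 l (by omega), hL.eq_zero hlow (by omega)]
    · rw [h2, hL.sum_eq_card hlow (by omega)]

theorem addRow_spec : Post x addRow s fun t => t 6 = Function.update (s 6) (s 17 0) (s 14 0) ∧
    t 17 0 = s 17 0 + 1 ∧ t 18 0 = s 18 0 + s 12 0 ∧ t 14 0 = s 14 0 := by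
  refine Post.cons_set (Post.cons_set (Post.cons_set (Post.nil ⟨?_, ?_, ?_, ?_⟩)))
  · rw [write_of_ne (by decide), write_of_ne (by decide), write_self]; rfl
  · simp [write_apply, Expr.val]
  · simp [write_apply, Expr.val]
  · simp [write_apply, Expr.val]

/-- The first `a` entries of `l` list the outer rows below `i`. -/
def ListsOuter (Y : YoungDiagram) (L l : ℕ → ℕ) (a i : ℕ) : Prop :=
  (∀ j < a, l j < i ∧ IsOuter Y L (l j)) ∧ (∀ j < a, ∀ j' < a, l j = l j' → j = j') ∧
    ∀ r < i, IsOuter Y L r → ∃ j < a, l j = r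

theorem ListsOuter.succ_of_not {Y : YoungDiagram} {L l : ℕ → ℕ} {a i : ℕ}
    (h : ListsOuter Y L l a i) (hi : ¬ IsOuter Y L i) : ListsOuter Y L l a (i + 1) := by
  refine ⟨fun j hj => ⟨(h.1 j hj).1.trans (Nat.lt_succ_self i), (h.1 j hj).2⟩, h.2.1,
    fun r hr hr' => ?_⟩
  have : r ≠ i := by rintro rfl; exact hi hr'
  exact h.2.2 r (by omega) hr'

theorem ListsOuter.succ {Y : YoungDiagram} {L l : ℕ → ℕ} {a i : ℕ}
    (h : ListsOuter Y L l a i) (hi : IsOuter Y L i) :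
    ListsOuter Y L (Function.update l a i) (a + 1) (i + 1) := by
  have hne : ∀ j < a, Function.update l a i j = l j := fun j hj =>
    Function.update_of_ne (by omega) _ _
  refine ⟨fun j hj => ?_, fun j hj j' hj' hjj => ?_, fun r hr hr' => ?_⟩
  · by_cases hja : j = a
    · subst hja; simp [hi]
    · rw [hne j (by omega)]
      have := h.1 j (by omega)
      exact ⟨by omega, this.2⟩
  · by_cases hja : j = a <;> by_cases hja' : j' = a
    · rw [hja, hja']
    · subst hja
      rw [Function.update_self, hne j' (by omega)] at hjj
      have := (h.1 j' (by omega)).1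
      omega
    · subst hja'
      rw [Function.update_self, hne j (by omega)] at hjj
      have := (h.1 j (by omega)).1
      omega
    · rw [hne j (by omega), hne j' (by omega)] at hjj
      exact h.2.1 j (by omega) j' (by omega) hjj
  · by_cases hri : r = i
    · exact ⟨a, by omega, by rw [Function.update_self, hri]⟩
    · obtain ⟨j, hj, rfl⟩ := h.2.2 r (by omega) hr'
      exact ⟨j, by omega, hne j hj⟩

theorem scanRow_spec (h : ListsOuter x.Y (s 5) (s 6) (s 17 0) (s 14 0))
    (hw : s 18 0 = s 17 0 * s 12 0) :
    Post x scanRow s fun t => ListsOuter x.Y (t 5) (t 6) (t 17 0) (t 14 0) ∧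
      t 18 0 = t 17 0 * t 12 0 ∧ t 14 0 = s 14 0 + 1 := by
  refine Post.cons (Q := fun t => t 5 = s 5 ∧ t 12 = s 12 ∧ t 14 0 = s 14 0 ∧
    ListsOuter x.Y (s 5) (t 6) (t 17 0) (s 14 0 + 1) ∧ t 18 0 = t 17 0 * s 12 0) ?_ ?_
  · have hadd : IsOuter x.Y (s 5) (s 14 0) → Post x addRow s fun t => t 5 = s 5 ∧ t 12 = s 12 ∧
        t 14 0 = s 14 0 ∧
        ListsOuter x.Y (s 5) (t 6) (t 17 0) (s 14 0 + 1) ∧ t 18 0 = t 17 0 * s 12 0 := by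
      intro ho
      refine ((Post.keeps addRow s).and addRow_spec).mono ?_
      rintro t ⟨hk, h1, h2, h3, h4⟩
      refine ⟨hk 5 rfl, hk 12 rfl, h4, ?_, ?_⟩
      · rw [h1, h2]
        exact h.succ ho
      · rw [h3, h2, hw]; ring
    have hskip : ¬ IsOuter x.Y (s 5) (s 14 0) → s 5 = s 5 ∧ s 12 = s 12 ∧
        s 14 0 = s 14 0 ∧
        ListsOuter x.Y (s 5) (s 6) (s 17 0) (s 14 0 + 1) ∧ s 18 0 = s 17 0 * s 12 0 :=
      fun ho => ⟨rfl, rfl, rfl, h.succ_of_not ho, hw⟩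
    have hb := val_box_ne_zero (x := x) (s := s) (r := var 14) (c := .get 5 (var 14))
    refine Post.ite (fun h0 => Post.ite (fun h1 => Post.ite (fun h2 => hadd ?_) fun h2 =>
      Post.skip (hskip ?_)) fun h1 => hadd ?_) fun h0 => Post.skip (hskip ?_)
    · refine ⟨hb.1 h0, Or.inr ?_⟩
      simp only [Expr.val] at h2
      omega
    · rintro ⟨-, h3⟩
      simp only [Expr.val] at h1 h2
      omega
    · exact ⟨hb.1 h0, Or.inl h1⟩
    · rintro ⟨h3, -⟩
      exact hb.2 h3 h0
  · rintro t ⟨h5, h12, h14, hl, hw'⟩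
    refine Post.cons_set (Post.nil ⟨?_, ?_, ?_⟩)
    · rw [write_of_ne (by decide), write_of_ne (by decide), write_of_ne (by decide), h5]
      simpa [write_apply, Expr.val, h14] using hl
    · simp [write_apply, hw', h12]
    · simp [write_apply, Expr.val, h14]

/-- The offset plus the lengths of the skipped rows is conserved; either the row has been found or
every round so far has skipped one. -/
theorem findRow_spec {L : ℕ → ℕ} {u i : ℕ} (h5 : s 5 = L)
    (h1 : s 15 0 + ∑ l ∈ Finset.range (s 14 0), L l = u)
    (h2 : s 15 0 < L (s 14 0) ∨ s 14 0 = i) :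
    Post x findRow s fun t => t 15 0 + ∑ l ∈ Finset.range (t 14 0), L l = u ∧
      (t 15 0 < L (t 14 0) ∨ t 14 0 = i + 1) := by
  subst h5
  refine Post.ite (fun h0 => Post.skip ⟨h1, Or.inl ?_⟩) fun h0 =>
    Post.cons_set (Post.cons_set (Post.nil ?_))
  · simp only [Expr.val] at h0
    omega
  · simp only [Expr.val] at h0
    have h3 : s 14 0 = i := by omega
    simp only [write_apply, Expr.val]
    simp [Finset.sum_range_succ]
    omega

theorem legStep_spec {leg i : ℕ} (hleg : ∀ n, n < leg ↔ s 15 0 < s 5 (s 14 0 + n + 1))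
    (h : s 19 0 = min i leg) :
    Post x legStep s fun t => t = s.write 19 0 (min (i + 1) leg) := by
  have hl := hleg (s 19 0)
  refine Post.ite (fun h0 => Post.set ?_) fun h0 => Post.skip (write_eq_self ?_).symm
  · simp only [Expr.val] at h0 ⊢
    congr 1
    omega
  · simp only [Expr.val] at h0
    omega

theorem accept_spec (hk : s 0 0 = x.k) : Post x accept s fun t =>
    (∀ v ≤ x.k, t 1 v = s 3 v ∧ t 2 v = s 4 v) ∧ t 13 0 = s 12 0 := by
  refine Post.cons_set (Post.cons (Post.loop (n := x.k + 1) (by simp [Expr.val, write_apply, hk])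
    (fun i t => t 20 0 = i ∧ t 3 = s 3 ∧ t 4 = s 4 ∧ t 12 = s 12 ∧
      ∀ v < i, t 1 v = s 3 v ∧ t 2 v = s 4 v) ?_ ?_) ?_)
  · simp [write_apply, write_of_ne, Expr.val]
  · rintro i hi t ⟨h1, h2, h3, h4, h5⟩
    refine Post.cons_set (Post.cons_set (Post.cons_set (Post.nil ⟨?_, ?_, ?_, ?_, ?_⟩)))
    · simp [write_apply, Expr.val, h1]
    · simp [write_of_ne, h2]
    · simp [write_of_ne, h3]
    · simp [write_of_ne, h4]
    · intro v hv
      simp only [write_apply, Expr.val]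
      by_cases hvi : v = i
      · subst hvi; simp [h1, h2, h3]
      · simp [h1, hvi, h5 v (by omega)]
  · rintro t ⟨h1, h2, h3, h4, h5⟩
    refine Post.cons_set (Post.nil ⟨fun v hv => ?_, ?_⟩)
    · simpa [write_apply, Expr.val] using h5 v (by omega)
    · simp [write_apply, Expr.val, h4]

end Deterministic

/-! ### The hook walk as an iteration, and the enumeration of boxes. -/

section Walk

variable {Y : YoungDiagram} {A : Finset Y.cells}

/-- One move of the hook walk. -/
def hookMove (A : Finset Y.cells) (c : Y.cells) : PMF Y.cells :=
  pick (hook A c) (PMF.pure c) PMF.pure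

/-- Stopping at a corner is the same as making idle moves there, which is what a counted loop does.
-/
theorem hookWalk_eq_iterate (n : ℕ) (c : Y.cells) : hookWalk A n c = iterate (hookMove A) n c := by
  induction n generalizing c with
  | zero => rfl
  | succ n ih =>
    rw [hookWalk, iterate, hookMove, pick_bind]
    rcases (hook A c).eq_empty_or_nonempty with h | h
    · rw [h, pick_empty, pick_empty, PMF.pure_bind, ← ih, hookWalk_of_hook_empty h]
    · rw [pick_of_nonempty h, pick_of_nonempty h]
      congr 1
      funext d
      rw [ih, PMF.pure_bind]

theorem exists_legLength (hA : IsLowerSet (A : Set Y.cells)) {L : ℕ → ℕ} (hL : IsRows A L)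
    (c : Y.cells) : ∃ leg ≤ A.card, ∀ n, n < leg ↔ c.1.2 < L (c.1.1 + n + 1) := by
  have h1 : ∀ n, n < colLen A hA c.1.2 - (c.1.1 + 1) ↔ c.1.2 < L (c.1.1 + n + 1) := by
    intro n
    rw [hL, ← lt_colLen_iff hA]
    omega
  refine ⟨_, ?_, h1⟩
  by_contra hlt
  have h2 := (h1 A.card).1 (not_le.1 hlt)
  rw [hL.eq_zero hA (by omega)] at h2
  omega

/-- The position of a box in the row by row enumeration of `A`. -/
def boxIndex (L : ℕ → ℕ) (c : Y.cells) : ℕ := c.1.2 + ∑ l ∈ Finset.range c.1.1, L l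

theorem prefix_unique {L : ℕ → ℕ} {r c r' c' : ℕ} (h : c < L r) (h' : c' < L r')
    (he : c + ∑ l ∈ Finset.range r, L l = c' + ∑ l ∈ Finset.range r', L l) : r = r' ∧ c = c' := by
  have key : ∀ {r c r' c' : ℕ}, c < L r → r < r' →
      c + ∑ l ∈ Finset.range r, L l ≠ c' + ∑ l ∈ Finset.range r', L l := by
    intro r c r' c' h hlt he
    have := Finset.sum_le_sum_of_subset (f := L) (Finset.range_subset_range.2 hlt)
    rw [Finset.sum_range_succ] at this
    omega
  rcases lt_trichotomy r r' with hlt | rfl | hlt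
  · exact absurd he (key h hlt)
  · exact ⟨rfl, by omega⟩
  · exact absurd he.symm (key h' hlt)

/-- The numbering turns a uniform number below `A.card` into a uniform starting box. -/
theorem bijOn_boxIndex {L : ℕ → ℕ} (hL : IsRows A L) :
    Set.BijOn (boxIndex L) (A : Set Y.cells) (Finset.range A.card : Set ℕ) := by
  have hmaps : ∀ c ∈ A, boxIndex L c ∈ Finset.range A.card := by
    intro c hc
    rw [Finset.mem_range, boxIndex]
    have h1 := hL.mem_iff.1 hc
    have h2 := hL.sum_le_card (c.1.1 + 1)
    rw [Finset.sum_range_succ] at h2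
    omega
  have hinj : ∀ c ∈ A, ∀ d ∈ A, boxIndex L c = boxIndex L d → c = d := by
    intro c hc d hd he
    obtain ⟨h1, h2⟩ := prefix_unique (hL.mem_iff.1 hc) (hL.mem_iff.1 hd) he
    exact Subtype.ext (Prod.ext h1 h2)
  refine ⟨hmaps, fun c hc d hd => hinj c hc d hd, ?_⟩
  exact Finset.surjOn_of_injOn_of_card_le _ hmaps (fun c hc d hd => hinj c hc d hd) (by simp)

end Walk

/-! ### Coupling single insertions with the program. -/

section Sampling

variable {x : Triple} {s : Mem} {M : ℕ}

/-- The outcome of the insertion of the value `M + 1`. -/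
def Inserted (x : Triple) (M : ℕ) (T : Filling x.Y) (s : Mem) (T' : Filling x.Y) (t : Mem) : Prop :=
  ∃ c, T' = place c (M + 1) T ∧ t 3 = Function.update (s 3) (M + 1) c.1.1 ∧
    t 4 = Function.update (s 4) (M + 1) c.1.2 ∧ t 11 0 = (emptyBoxes T').card ∧
    t 12 0 = (if c ∈ emptyBoxes T then 1 else (NW (filledBoxes T)).card) * s 12 0 ∧
    IsRows (emptyBoxes T') (t 5) ∧ t 0 = s 0 ∧ t 10 = s 10

/-- The memory describes the current position of the hook walk. -/
def AtBox (A : Finset x.Y.cells) (s : Mem) (c : x.Y.cells) (t : Mem) : Prop :=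
  c ∈ A ∧ t 14 0 = c.1.1 ∧ t 15 0 = c.1.2 ∧ t 5 = s 5 ∧ t 0 = s 0

/-- The program draws a number below arm plus leg; `IsRows.bijOn_hook` identifies it with a box of
the hook. -/
theorem walkStep_lift {A : Finset x.Y.cells} (hA : IsLowerSet (A : Set x.Y.cells))
    (hL : IsRows A (s 5)) (hcard : A.card ≤ x.k) (hk : s 0 0 = x.k) {c : x.Y.cells} {t : Mem}
    (hc : AtBox A s c t) : Lift (AtBox A s) (hookMove A c) (walkStep.exec x t) := by
  obtain ⟨hcA, h14, h15, h5, h0⟩ := hc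
  obtain ⟨leg, hlegle, hleg⟩ := exists_legLength hA hL c
  refine Lift.cons_set (Lift.cons_set (Lift.cons (Q := fun t' => t' 14 0 = c.1.1 ∧ t' 15 0 = c.1.2 ∧
    t' 5 = s 5 ∧ t' 0 = s 0 ∧ t' 17 0 = s 5 c.1.1 - (c.1.2 + 1) ∧ t' 19 0 = leg) ?_ ?_))
  · set t1 := (t.write 17 ((Expr.lit 0).val x t)
      ((Expr.sub (.get 5 (var 14)) (.add (var 15) (.lit 1))).val x t)) with ht1
    have hv : (Expr.lit 0).val x t1 = 0 := rfl
    rw [hv]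
    refine Post.mono (Post.loop (n := x.k) (by
      simp only [Expr.val, write_apply, ht1]; simp [h0, hk])
      (fun i t' => t' = t1.write 19 0 (min i leg)) (by simp) ?_) ?_
    · rintro i - t' rfl
      refine (legStep_spec (leg := leg) (i := i) ?_ ?_).mono ?_
      · intro n
        simp only [write_apply, ht1]
        simpa [h14, h15, h5] using hleg n
      · simp [write_apply]
      · rintro t'' rfl
        rw [write_write]
    · rintro t' rfl
      rw [min_eq_right (hlegle.trans hcard)]
      refine ⟨?_, ?_, ?_, ?_, ?_, ?_⟩
      · simp [write_apply, ht1, h14]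
      · simp [write_apply, ht1, h15]
      · simp [write_of_ne, ht1, h5]
      · simp [write_of_ne, ht1, h0]
      · simp [write_apply, ht1, Expr.val, h14, h15, h5]
      · simp [write_apply]
  · rintro t1 ⟨e14, e15, e5, e0, e17, e19⟩
    rw [exec_block_cons]
    have hnil : ∀ t, (block []).exec x t = PMF.pure t := fun t => exec_block_nil
    rw [show (block []).exec x = PMF.pure from funext hnil, PMF.bind_pure]
    have hbij := hL.bijOn_hook hcA hleg
    rw [hookMove, exec_ite]
    have hval : (Expr.add (var 17) (var 19)).val x t1 = s 5 c.1.1 - (c.1.2 + 1) + leg := by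
      simp only [Expr.val, e17, e19]
    rw [hval]
    split_ifs with hne
    · rw [exec_block_cons, exec_rand, hval, pick_bind]
      refine Lift.pick ⟨0, Finset.mem_range.2 (Nat.pos_of_ne_zero hne)⟩ hbij ?_
      intro u hu
      rw [Finset.mem_range] at hu
      have hmem := hbij.mapsTo (Finset.mem_coe.2 (Finset.mem_range.2 hu))
      rw [PMF.pure_bind]
      rw [← PMF.bind_pure ((block _).exec x _)]
      refine Lift.of_right fun t2 ht2 => Lift.pure ?_
      have hA' : cellAt c (if u < s 5 c.1.1 - (c.1.2 + 1) then
          (c.1.1, c.1.2 + u + 1) else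
            (c.1.1 + (u - (s 5 c.1.1 - (c.1.2 + 1))) + 1, c.1.2)) ∈ A :=
        (Finset.mem_filter.1 hmem).1
      refine Post.cons (Q := fun t => AtBox A s _ t) (Post.ite (fun hlt => Post.set ?_)
        fun hlt => Post.set ?_) (fun t h => Post.nil h) t2 ht2
      · have hlt' : u < s 5 c.1.1 - (c.1.2 + 1) := by
          simp only [Expr.val, write_apply] at hlt
          simp [e17] at hlt
          omega
        rw [if_pos hlt'] at hA' ⊢
        obtain ⟨hm, -⟩ := (hL c.1.1 (c.1.2 + u + 1)).1 (by omega)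
        refine ⟨hA', ?_, ?_, ?_, ?_⟩
        · simp [write_apply, cellAt_of_mem c hm, e14]
        · simp [write_apply, cellAt_of_mem c hm, Expr.val, e15]
        · simp [write_of_ne, e5]
        · simp [write_of_ne, e0]
      · have hlt' : ¬ u < s 5 c.1.1 - (c.1.2 + 1) := by
          simp only [Expr.val, write_apply] at hlt
          simp [e17] at hlt
          omega
        rw [if_neg hlt'] at hA' ⊢
        obtain ⟨hm, -⟩ := (hL (c.1.1 + (u - (s 5 c.1.1 - (c.1.2 + 1))) + 1) c.1.2).1
          ((hleg _).1 (by omega))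
        refine ⟨hA', ?_, ?_, ?_, ?_⟩
        · simp [write_apply, cellAt_of_mem c hm, Expr.val, e14, e17]
        · simp [write_apply, cellAt_of_mem c hm, e15]
        · simp [write_of_ne, e5]
        · simp [write_of_ne, e0]
    · have hempty : hook A c = ∅ := by
        rw [Finset.eq_empty_iff_forall_notMem]
        intro d hd
        obtain ⟨u, hu, -⟩ := hbij.surjOn hd
        rw [Finset.mem_coe, Finset.mem_range] at hu
        omega
      rw [hempty, pick_empty, exec_skip]
      exact Lift.pure ⟨hcA, e14, e15, e5, e0⟩

theorem walk_lift {T : Filling x.Y} (hT : IsPreTableau x.Y x.N (M + 1) T)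
    (hL : IsRows (emptyBoxes T) (s 5)) (hMk : M + 1 ≤ x.k) (hk : s 0 0 = x.k)
    (hM : s 10 0 = M + 1) (he : s 11 0 = (emptyBoxes T).card) (hne : (emptyBoxes T).Nonempty) :
    Lift (Inserted x M T s) (hookInsert (emptyBoxes T) (M + 1) T) (walk.exec x s) := by
  have hA := hT.isLowerSet
  set A := emptyBoxes T with hAdef
  have hcard : A.card ≤ x.k := hT.2.2.2.2.trans hMk
  rw [walk, exec_block_cons, exec_rand, pick_bind, hookInsert]
  have hv : (var 11).val x s = A.card := he
  rw [hv]
  refine Lift.pick_left hne (bijOn_boxIndex hL) fun c hc => ?_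
  rw [PMF.pure_bind]
  refine Lift.cons_set (Lift.cons (Q := fun t => AtBox A s c t ∧ ∀ a, a ≠ 14 → a ≠ 15 → t a = s a)
    ?_ ?_)
  · set s1 := (s.write 15 ((Expr.lit 0).val x s) (boxIndex (s 5) c)) with hs1
    set s2 := s1.write 14 ((Expr.lit 0).val x s1) ((Expr.lit 0).val x s1) with hs2
    have hs : ∀ a, a ≠ 14 → a ≠ 15 → s2 a = s a := fun a h1 h2 => by
      rw [hs2, write_of_ne h1, hs1, write_of_ne h2]
    refine Post.mono (Post.loop (n := x.k + 1) (by
      simp only [Expr.val, hs 0 (by decide) (by decide), hk])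
      (fun i t => (∀ a, a ≠ 14 → a ≠ 15 → t a = s a) ∧
        t 15 0 + ∑ l ∈ Finset.range (t 14 0), s 5 l = boxIndex (s 5) c ∧
        (t 15 0 < s 5 (t 14 0) ∨ t 14 0 = i)) ⟨hs, ?_, ?_⟩ ?_) ?_
    · simp [hs2, hs1, write_apply, Expr.val]
    · exact Or.inr (by simp [hs2, write_apply, Expr.val])
    · rintro i - t ⟨h1, h2, h3⟩
      refine ((Post.keeps findRow t).and
        (findRow_spec (h1 5 (by decide) (by decide)) h2 h3)).mono ?_
      rintro t' ⟨hkeep, h4⟩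
      refine ⟨fun a ha ha' => (hkeep a ?_).trans (h1 a ha ha'), h4⟩
      simp [findRow, Prog.keeps, block, ha.symm, ha'.symm]
    · rintro t ⟨h1, h2, h3⟩
      have hlt : t 15 0 < s 5 (t 14 0) := by
        -- If all k + 1 rounds had skipped a row, the skipped rows would contain all boxes of `A`,
        -- but the index is below their number.
        refine h3.resolve_right fun h4 => ?_
        rw [h4, hL.sum_eq_card hA (by omega)] at h2
        have := Finset.mem_range.1 ((bijOn_boxIndex hL).mapsTo hc)
        omega
      obtain ⟨h5, h6⟩ := prefix_unique hlt (hL.mem_iff.1 hc) h2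
      exact ⟨⟨hc, h5, h6, h1 5 (by decide) (by decide), h1 0 (by decide) (by decide)⟩, h1⟩
  · rintro t ⟨hat, hkeep⟩
    rw [exec_block_cons, exec_loop]
    have hkt : (var 0).val x t = x.k := by
      simp only [Expr.val, hkeep 0 (by decide) (by decide), hk]
    have hd := (depth_lt_card hc).le
    -- Enlarge the budget of the abstract walk to the k moves of the program.
    rw [hkt, ← hookWalk_eq_of_le hd hcard, hookWalk_eq_iterate]
    have hlift := Lift.iterate (fun c t h => walkStep_lift hA hL hcard hk h) x.k hat
    refine hlift.bind fun d t1 hd' ht1 hat1 => ?_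
    rw [← hookWalk_eq_iterate] at hd'
    obtain ⟨hdA, hcor⟩ := hookWalk_support (hd.trans hcard) hc hd'
    have hdT : T d = ∅ := mem_emptyBoxes.1 hdA
    have hkeep1 : ∀ a, walkStep.keeps a = true → t1 a = t a := fun a ha => by
      have := Prog.keeps_spec (x := x) (a := a) (p := .loop (var 0) walkStep) ha (s := t) t1
        (by rw [exec_loop, hkt]; exact ht1)
      exact this
    obtain ⟨-, h14, h15, h5, h0⟩ := hat1
    have k3 : t1 3 = s 3 := (hkeep1 3 rfl).trans (hkeep 3 (by decide) (by decide))
    have k4 : t1 4 = s 4 := (hkeep1 4 rfl).trans (hkeep 4 (by decide) (by decide))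
    have k10 : t1 10 = s 10 := (hkeep1 10 rfl).trans (hkeep 10 (by decide) (by decide))
    have k11 : t1 11 = s 11 := (hkeep1 11 rfl).trans (hkeep 11 (by decide) (by decide))
    have k12 : t1 12 = s 12 := (hkeep1 12 rfl).trans (hkeep 12 (by decide) (by decide))
    rw [show PMF.pure (Function.update T d {M + 1}) =
      (PMF.pure (place d (M + 1) T) : PMF (Filling x.Y)) by rw [place, hdT]; rfl]
    rw [← PMF.bind_pure ((block [fillCorner]).exec x t1)]
    have hdM : d ∈ emptyBoxes T := hdA
    refine Lift.of_right fun t2 ht2 => Lift.pure ?_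
    refine (Post.cons (Q := Inserted x M T s (place d (M + 1) T)) ?_ fun t h => Post.nil h) t2 ht2
    refine Post.cons_set (Post.cons_set (Post.cons_set (Post.cons_set (Post.nil
      ⟨d, rfl, ?_, ?_, ?_, ?_, ?_, ?_, ?_⟩))))
    · rw [write_of_ne (by decide), write_of_ne (by decide), write_of_ne (by decide), write_self]
      simp only [Expr.val, k3, k10, hM, h14]
    · rw [write_of_ne (by decide), write_of_ne (by decide), write_self]
      simp [Expr.val, write_apply, write_of_ne, k4, k10, hM, h15]
    · rw [emptyBoxes_place, Finset.card_erase_of_mem hdM]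
      simp [Expr.val, write_apply, k11, he, hAdef]
    · rw [if_pos hdM]
      simp [write_apply, k12]
    · rw [emptyBoxes_place, write_of_ne (by decide), write_self]
      have := hL.erase hdA hcor
      simpa [Expr.val, write_apply, write_of_ne, h14, h5] using this
    · simp [write_of_ne, h0]
    · simp [write_of_ne, k10]

theorem join_lift {T : Filling x.Y} (hT : IsPreTableau x.Y x.N (M + 1) T)
    (hL : IsRows (emptyBoxes T) (s 5)) (hMk : M + 1 ≤ x.k) (hMN : M + 1 < x.N) (hk : s 0 0 = x.k)
    (hM : s 10 0 = M + 1) (he : s 11 0 = (emptyBoxes T).card) :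
    Lift (Inserted x M T s)
      (pick (NW (filledBoxes T)) (PMF.pure T) fun c =>
        PMF.pure (Function.update T c (T c ∪ {M + 1})))
      (join.exec x s) := by
  have hA := hT.isLowerSet
  have hcard : (emptyBoxes T).card ≤ x.k := hT.2.2.2.2.trans hMk
  have hNW := NW_nonempty (hT.filled_nonempty hMN)
  refine Lift.cons_set (Lift.cons_set (Lift.cons_set (Lift.cons (Q := fun t =>
    (∀ a, scanRow.keeps a = true → a ≠ 18 → t a = s a) ∧
    ListsOuter x.Y (s 5) (t 6) (t 17 0) (x.k + 1) ∧ t 18 0 = t 17 0 * s 12 0) ?_ ?_)))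
  · refine Post.mono (Post.loop (n := x.k + 1) (by simp [Expr.val, write_apply, hk])
      (fun i t => (∀ a, scanRow.keeps a = true → a ≠ 18 → t a = s a) ∧
        ListsOuter x.Y (t 5) (t 6) (t 17 0) (t 14 0) ∧ t 18 0 = t 17 0 * t 12 0 ∧ t 14 0 = i)
        ⟨?_, ?_, ?_, ?_⟩ ?_) ?_
    · intro a ha h18
      have h14 : a ≠ 14 := by rintro rfl; exact absurd ha (by decide)
      have h17 : a ≠ 17 := by rintro rfl; exact absurd ha (by decide)
      rw [write_of_ne h14, write_of_ne h18, write_of_ne h17]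
    · simp only [write_apply, Expr.val]
      exact ⟨fun j hj => absurd hj (by simp), fun j hj => absurd hj (by simp),
        fun r hr => absurd hr (by simp)⟩
    · simp [write_apply, Expr.val]
    · simp [write_apply, Expr.val]
    · rintro i - t ⟨h1, h2, h3, h4⟩
      refine ((Post.keeps scanRow t).and (scanRow_spec h2 h3)).mono ?_
      rintro t' ⟨hkeep, h5, h6, h7⟩
      exact ⟨fun a ha ha' => (hkeep a ha).trans (h1 a ha ha'), h5, h6, by rw [h7, h4]⟩
    · rintro t ⟨h1, h2, h3, h4⟩
      have h5 := h1 5 rfl (by decide)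
      rw [h5, h4] at h2
      rw [h1 12 rfl (by decide)] at h3
      exact ⟨h1, h2, h3⟩
  · rintro t ⟨hkeep, hlist, hprod⟩
    have t0 := hkeep 0 rfl (by decide)
    have t3 := hkeep 3 rfl (by decide)
    have t4 := hkeep 4 rfl (by decide)
    have t5 := hkeep 5 rfl (by decide)
    have t10 := hkeep 10 rfl (by decide)
    have t11 := hkeep 11 rfl (by decide)
    obtain ⟨c₀, hc₀⟩ := hNW
    have hval : ∀ u < t 17 0, (cellAt c₀ (t 6 u, s 5 (t 6 u))).1 = (t 6 u, s 5 (t 6 u)) := by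
      intro u hu
      have := (hlist.1 u hu).2.1
      rw [cellAt, dif_pos this]
    have hbij : Set.BijOn (fun u => cellAt c₀ (t 6 u, s 5 (t 6 u)))
        (Finset.range (t 17 0) : Set ℕ) (NW (filledBoxes T) : Set x.Y.cells) := by
      rw [filledBoxes_eq]
      refine ⟨?_, ?_, ?_⟩
      · intro u hu
        rw [Finset.mem_coe, Finset.mem_range] at hu
        rw [Finset.mem_coe, hL.mem_NW_iff hA, hval u hu]
        exact ⟨rfl, (hlist.1 u hu).2⟩
      · intro u hu v hv huv
        rw [Finset.mem_coe, Finset.mem_range] at hu hv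
        have := congrArg Subtype.val huv
        simp only [hval u hu, hval v hv, Prod.mk.injEq] at this
        exact hlist.2.1 u hu v hv this.1
      · intro c hc
        rw [Finset.mem_coe, hL.mem_NW_iff hA] at hc
        -- The row above such a box meets the empty shape, which has at most k rows; so the scan of
        -- rows 0, …, k finds it.
        have hr : c.1.1 < x.k + 1 := by
          rcases hc.2.2 with h | h
          · omega
          · by_contra hge
            rw [hL.eq_zero hA (show (emptyBoxes T).card ≤ c.1.1 - 1 by omega)] at h
            omega
        obtain ⟨j, hj, hj'⟩ := hlist.2.2 c.1.1 hr hc.2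
        refine ⟨j, Finset.mem_coe.2 (Finset.mem_range.2 hj), ?_⟩
        have : (t 6 j, s 5 (t 6 j)) = c.1 := by
          rw [hj']
          exact Prod.ext rfl hc.1.symm
        simp only [this, cellAt_coe]
    have hcardNW : t 17 0 = (NW (filledBoxes T)).card := by
      rw [← Finset.card_range (t 17 0)]
      exact Finset.card_nbij _ hbij.mapsTo hbij.injOn hbij.surjOn
    have hpos : 0 < t 17 0 := by rw [hcardNW]; exact Finset.card_pos.2 ⟨c₀, hc₀⟩
    refine Lift.cons_set ?_
    set t1 := t.write 12 ((Expr.lit 0).val x t) ((var 18).val x t) with ht1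
    have h17 : (var 17).val x t1 = t 17 0 := by simp [Expr.val, ht1, write_apply]
    rw [exec_block_cons, exec_rand, pick_bind, h17]
    refine Lift.pick ⟨0, Finset.mem_range.2 hpos⟩ hbij fun u hu => ?_
    rw [Finset.mem_range] at hu
    rw [PMF.pure_bind]
    set c := cellAt c₀ (t 6 u, s 5 (t 6 u)) with hcdef
    have hcv : c.1 = (t 6 u, s 5 (t 6 u)) := hval u hu
    have hcNW : c ∈ NW (filledBoxes T) := hbij.mapsTo (Finset.mem_coe.2 (Finset.mem_range.2 hu))
    have hce : c ∉ emptyBoxes T := fun h => (hT.mem_NW_iff.1 hcNW).1 (mem_emptyBoxes.1 h)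
    have hpl : emptyBoxes (place c (M + 1) T) = emptyBoxes T := by
      rw [emptyBoxes_place, Finset.erase_eq_of_notMem hce]
    rw [show Function.update T c (T c ∪ {M + 1}) = place c (M + 1) T by
      rw [place, Finset.union_comm]; rfl]
    rw [← PMF.bind_pure ((block _).exec x _)]
    refine Lift.of_right fun t2 ht2 => Lift.pure ?_
    refine (Post.cons_set (Post.cons_set (Post.nil
      ⟨c, rfl, ?_, ?_, ?_, ?_, ?_, ?_, ?_⟩)) : Post x _ _ (Inserted x M T s (place c (M + 1) T))) t2 ht2
    · rw [write_of_ne (by decide), write_self]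
      simp [Expr.val, write_apply, write_of_ne, ht1, t3, t10, hM, hcv]
    · rw [write_self]
      simp [Expr.val, write_apply, write_of_ne, ht1, t4, t5, t10, hM, hcv]
    · rw [hpl]
      simp [write_apply, ht1, t11, he]
    · rw [if_neg hce, ← hcardNW]
      simp [write_apply, ht1, Expr.val, hprod]
    · rw [hpl]
      simpa [write_of_ne, ht1, t5] using hL
    · simp [write_of_ne, ht1, t0]
    · simp [write_of_ne, ht1, t10]

end Sampling

/-! ### Coupling the algorithm and the chain with the program. -/

section Generation

variable {x : Triple} {s : Mem} {b M : ℕ} {T : Filling x.Y}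

/-- The memory describes the filling `T`, which contains all values larger than `M`. -/
structure Describes (x : Triple) (b M : ℕ) (T : Filling x.Y) (s : Mem) : Prop where
  input : s 0 = initMem x b 0
  pre : IsPreTableau x.Y x.N M T
  fill : ∀ c, T c = x.S c ∪ (Finset.Ioc M x.k).filter fun v => (s 3 v, s 4 v) = c.1
  next : s 10 0 = M
  card : s 11 0 = (emptyBoxes T).card
  wt : s 12 0 = ∏ j ∈ Finset.Ioc M x.k, stepWeight T j
  rows : IsRows (emptyBoxes T) (s 5)

theorem stepWeight_place {c : x.Y.cells} (hT : IsPreTableau x.Y x.N (M + 1) T) {j : ℕ}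
    (hj : M + 1 < j) : stepWeight (place c (M + 1) T) j = stepWeight T j := by
  have h : ∀ i, M + 1 ≤ i → trunc i (place c (M + 1) T) = trunc i T := fun i hi => by
    rw [← trunc_trunc hi, hT.trunc_place]
  rw [stepWeight, stepWeight, h j (by omega), h (j - 1) (by omega)]

theorem stepWeight_place_self {c : x.Y.cells} (hT : IsPreTableau x.Y x.N (M + 1) T)
    (hT' : IsPreTableau x.Y x.N M (place c (M + 1) T)) :
    stepWeight (place c (M + 1) T) (M + 1) =
      if c ∈ emptyBoxes T then 1 else (NW (filledBoxes T)).card := by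
  rw [stepWeight, hT.trunc_place, Nat.add_sub_cancel, hT'.trunc_self, emptyBoxes_place]
  by_cases hc : c ∈ emptyBoxes T
  · rw [if_pos hc, if_neg]
    intro h
    rw [h] at hc
    exact Finset.notMem_erase _ _ hc
  · rw [if_neg hc, if_pos (Finset.erase_eq_of_notMem hc).symm]

theorem Ioc_eq_insert {k : ℕ} (hMk : M + 1 ≤ k) :
    Finset.Ioc M k = insert (M + 1) (Finset.Ioc (M + 1) k) := by
  ext v
  simp only [Finset.mem_insert, Finset.mem_Ioc]
  omega

/-- The entries at index `M + 1` are new, and later insertions do not change the step weights of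
larger values, so the earlier data remain valid. -/
theorem Describes.inserted (h : Describes x b (M + 1) T s) (hMk : M + 1 ≤ x.k)
    {T' : Filling x.Y} {t : Mem} (hT' : IsPreTableau x.Y x.N M T') (hi : Inserted x M T s T' t) :
    Describes x b M T' (t.write 10 0 M) := by
  obtain ⟨c, rfl, h3, h4, h11, h12, h5, h0, h10⟩ := hi
  refine ⟨?_, hT', fun e => ?_, ?_, ?_, ?_, ?_⟩
  · rw [write_of_ne (by decide), h0, h.input]
  · rw [write_of_ne (by decide), write_of_ne (by decide), h3, h4, Ioc_eq_insert hMk,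
      Finset.filter_insert, Function.update_self, Function.update_self]
    have hf : (Finset.Ioc (M + 1) x.k).filter (fun v =>
        (Function.update (s 3) (M + 1) c.1.1 v, Function.update (s 4) (M + 1) c.1.2 v) = e.1) =
        (Finset.Ioc (M + 1) x.k).filter fun v => (s 3 v, s 4 v) = e.1 := by
      refine Finset.filter_congr fun v hv => ?_
      have : v ≠ M + 1 := by
        have := (Finset.mem_Ioc.1 hv).1
        omega
      rw [Function.update_of_ne this, Function.update_of_ne this]
    rw [hf]
    by_cases hec : e = c
    · subst hec
      rw [place_self, if_pos rfl, Finset.union_insert, ← h.fill]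
    · rw [place_of_ne hec, if_neg, ← h.fill]
      exact fun he => hec (Subtype.ext he.symm)
  · simp [write_apply]
  · simpa [write_apply] using h11
  · rw [Ioc_eq_insert hMk, Finset.prod_insert (by simp), stepWeight_place_self h.pre hT']
    rw [Finset.prod_congr rfl fun j hj => stepWeight_place h.pre (Finset.mem_Ioc.1 hj).1, ← h.wt]
    simpa [write_apply] using h12
  · rw [write_of_ne (by decide)]
    exact h5

theorem svStep_eq_pick (hM : 0 < M) : svStep M T = pick (Finset.range M) (PMF.pure T) fun u =>
    if u < M - (emptyBoxes T).card then
      pick (NW (filledBoxes T)) (PMF.pure T) fun c => PMF.pure (Function.update T c (T c ∪ {M}))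
    else hookInsert (emptyBoxes T) M T := by
  have hne : (Finset.range M).Nonempty := ⟨0, Finset.mem_range.2 hM⟩
  rw [svStep, coin_eq_map (Nat.sub_le _ _) hne, PMF.bind_map, pick_of_nonempty hne]
  congr 1
  funext u
  by_cases h : u < M - (emptyBoxes T).card <;> simp [h]

theorem Inserted.of_eq {s' : Mem} (h : ∀ a, a ≠ 16 → s' a = s a) {T' : Filling x.Y} {t : Mem}
    (hi : Inserted x M T s' T' t) : Inserted x M T s T' t := by
  rw [Inserted, h 3 (by decide), h 4 (by decide), h 12 (by decide), h 0 (by decide),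
    h 10 (by decide)] at hi
  exact hi

theorem insertStep_lift (h : Describes x b (M + 1) T s) (hMk : M + 1 ≤ x.k) :
    Lift (Describes x b M) (genStep x.N (M + 1) T) (insertStep.exec x s) := by
  have hk : s 0 0 = x.k := by rw [h.input]; simp [initMem]
  have hN : s 0 1 = x.N := by rw [h.input]; simp [initMem]
  have hMN := hMk.trans x.k_le
  rw [insertStep, exec_block_cons]
  refine Lift.bind_post (R := Inserted x M T s) ?_ ?_
  · rw [exec_ite]
    have hv : (Expr.sub (.get 0 (.lit 1)) (var 10)).val x s = x.N - (M + 1) := by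
      simp [Expr.val, hN, h.next]
    rw [hv, genStep]
    split_ifs with h1 h2 h2
    · omega
    · refine walk_lift h.pre h.rows hMk hk h.next h.card ?_
      have hpre := h.pre
      rw [h1] at hpre
      rw [hpre.empty_top]
      have : Nonempty x.Y.cells := x.nonempty.to_subtype
      exact Finset.univ_nonempty
    · have hlt : M + 1 < x.N := by omega
      have hv10 : (var 10).val x s = M + 1 := h.next
      rw [svStep_eq_pick (Nat.succ_pos M), exec_block_cons, exec_rand, pick_bind, hv10]
      refine Lift.pick (φ := id) ⟨0, Finset.mem_range.2 (Nat.succ_pos M)⟩ (Set.bijOn_id _)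
        fun u hu => ?_
      rw [Finset.mem_range] at hu
      rw [PMF.pure_bind, exec_block_cons,
        show (block []).exec x = PMF.pure from funext fun t => exec_block_nil, PMF.bind_pure,
        exec_ite]
      set s1 := s.write 16 ((Expr.lit 0).val x s) u with hs1
      have hs : ∀ a, a ≠ 16 → s1 a = s a := fun a ha => write_of_ne ha
      have hv' : (Expr.sub (.sub (var 10) (var 11)) (var 16)).val x s1 =
          M + 1 - (emptyBoxes T).card - u := by
        simp [Expr.val, hs1, write_apply, h.next, h.card]
      rw [hv']
      by_cases hu' : u < M + 1 - (emptyBoxes T).card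
      · rw [id, if_pos hu', if_pos (by omega)]
        refine (join_lift h.pre (by rw [hs 5 (by decide)]; exact h.rows) hMk hlt
          (by rw [hs 0 (by decide)]; exact hk) (by rw [hs 10 (by decide)]; exact h.next)
          (by rw [hs 11 (by decide)]; exact h.card)).mono fun _ _ _ _ hi => hi.of_eq hs
      · rw [id, if_neg hu', if_neg (by omega)]
        refine (walk_lift h.pre (by rw [hs 5 (by decide)]; exact h.rows) hMk
          (by rw [hs 0 (by decide)]; exact hk) (by rw [hs 10 (by decide)]; exact h.next)
          (by rw [hs 11 (by decide)]; exact h.card) ?_).mono fun _ _ _ _ hi => hi.of_eq hs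
        rw [← Finset.card_pos]
        omega
    · omega
  · intro T' t hT' _ hi
    obtain ⟨c, -, -, hpre⟩ := genStep_support x.nonempty h.pre hMN hT'
    have h10 : t 10 = s 10 := by
      obtain ⟨_, -, -, -, -, -, -, -, h10⟩ := hi
      exact h10
    have h1 := h.inserted hMk hpre hi
    have hv : (Expr.sub (var 10) (.lit 1)).val x t = M := by
      simp [Expr.val, h10, h.next]
    refine Post.cons_set (Post.nil ?_)
    rw [hv]
    exact h1

theorem insertLoop_lift (hMk : M ≤ x.k) (h : Describes x b M T s) :
    Lift (Describes x b 0) (genLoop x.N M T) (iterate (insertStep.exec x) M s) := by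
  induction M generalizing T s with
  | zero => exact Lift.pure h
  | succ M ih =>
    exact (insertStep_lift h hMk).bind fun T' t _ _ h' => ih (by omega) h'

theorem generate_lift (h0 : s 0 = initMem x b 0) (hz : ∀ i, x.k < i → s 5 i = 0) :
    Lift (Describes x b 0) (svGen x) (generate.exec x s) := by
  have hk : s 0 0 = x.k := by rw [h0]; simp [initMem]
  refine Lift.cons ((Post.keeps initRows s).and
    (initRows_spec (isRows_rowLen x.pre.isLowerSet) hk hz)) ?_
  rintro t ⟨hkeep, h5, h11⟩
  have t0 := hkeep 0 rfl
  refine Lift.cons_set (Lift.cons_set ?_)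
  set t2 := (t.write 12 ((Expr.lit 0).val x t) ((Expr.lit 1).val x t)).write 10
    ((Expr.lit 0).val x (t.write 12 ((Expr.lit 0).val x t) ((Expr.lit 1).val x t)))
    ((var 0).val x (t.write 12 ((Expr.lit 0).val x t) ((Expr.lit 1).val x t))) with ht2
  have hkt : (var 0).val x t2 = x.k := by simp [Expr.val, ht2, write_apply, t0, hk]
  rw [exec_block_cons, show (block []).exec x = PMF.pure from funext fun t => exec_block_nil,
    PMF.bind_pure, exec_loop, hkt, svGen_eq_genLoop]
  refine insertLoop_lift le_rfl ⟨?_, x.pre, ?_, ?_, ?_, ?_, ?_⟩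
  · simp [ht2, write_of_ne, t0, h0]
  · simp
  · simp [ht2, write_apply, Expr.val, t0, hk]
  · simp [ht2, write_apply, h11]
  · simp [ht2, write_apply, Expr.val]
  · simp only [ht2, write_of_ne (show (5 : ℕ) ≠ 10 by decide), write_of_ne (show (5 : ℕ) ≠ 12 by decide), h5]
    exact isRows_rowLen _

/-- The memory describes the current state of the chain. -/
structure Current (x : Triple) (b : ℕ) (T : Filling x.Y) (s : Mem) : Prop where
  input : s 0 = initMem x b 0
  clean : ∀ i, x.k < i → s 5 i = 0
  mem : T ∈ SVT x
  out : output x s = T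
  wt : s 13 0 = weight x T

/-- A finished tableau has no empty box, so all rows are 0: each run leaves the table fit for the
next one. -/
theorem Describes.clean (h : Describes x b 0 T s) : ∀ i, x.k < i → s 5 i = 0 := fun _ _ =>
  h.rows.eq_zero h.pre.isLowerSet (h.pre.2.2.2.2.trans (Nat.zero_le _))

theorem Describes.weight_eq (h : Describes x b 0 T s) : s 12 0 = weight x T := by
  rw [h.wt, weight]
  rfl

theorem accept_current (h : Describes x b 0 T s) (hT : T ∈ SVT x) :
    Post x accept s (Current x b T) := by
  have hk : s 0 0 = x.k := by rw [h.input]; simp [initMem]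
  refine ((Post.keeps accept s).and (accept_spec hk)).mono ?_
  rintro t ⟨hkeep, hpos, hw⟩
  refine ⟨(hkeep 0 rfl).trans h.input, ?_, hT, funext fun c => ?_, hw.trans h.weight_eq⟩
  · rw [hkeep 5 rfl]
    exact h.clean
  · rw [output, h.fill c]
    congr 1
    refine Finset.filter_congr fun v hv => ?_
    obtain ⟨h1, h2⟩ := hpos v (Finset.mem_Icc.1 hv).2
    rw [h1, h2]

theorem metropolis_lift (h : Current x b T s) :
    Lift (Current x b) (metStep x T) (metropolis.exec x s) := by
  rw [metropolis, exec_block_cons, metStep]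
  refine (generate_lift h.input h.clean).bind fun F t hF ht hFt => ?_
  -- The current state lives in arrays 1, 2 and 13, which generating a proposal does not touch.
  have hkeep : ∀ a, generate.keeps a = true → t a = s a := fun a ha => Prog.keeps_spec ha t ht
  have hw : (var 13).val x t = weight x T := by
    simp only [Expr.val, hkeep 13 rfl, h.wt]
  rw [exec_block_cons, exec_rand, pick_bind, hw]
  refine Lift.pick (φ := id) ⟨0, Finset.mem_range.2 (weight_pos h.mem)⟩ (Set.bijOn_id _)
    fun u hu => ?_
  rw [PMF.pure_bind, exec_block_cons,
    show (block []).exec x = PMF.pure from funext fun t => exec_block_nil, PMF.bind_pure]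
  set t1 := t.write 16 ((Expr.lit 0).val x t) u with ht1
  have ht : ∀ a, a ≠ 16 → t1 a = t a := fun a ha => write_of_ne ha
  have hv : (Expr.sub (var 12) (var 16)).val x t1 = weight x F - u := by
    simp [Expr.val, ht1, write_apply, hFt.weight_eq]
  rw [← PMF.bind_pure (Prog.exec x (Prog.ite _ _ _) t1)]
  refine Lift.of_right fun t2 ht2 => Lift.pure ?_
  refine (Post.ite (fun hne => ?_) (fun he => Post.skip ?_) : Post x _ t1 _) t2 ht2
  · rw [hv] at hne
    rw [id, if_pos (by omega)]
    refine accept_current ⟨?_, hFt.pre, ?_, ?_, ?_, ?_, ?_⟩ (svGen_support hF)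
    · rw [ht 0 (by decide), hFt.input]
    · rw [ht 3 (by decide), ht 4 (by decide)]; exact hFt.fill
    · rw [ht 10 (by decide)]; exact hFt.next
    · rw [ht 11 (by decide)]; exact hFt.card
    · rw [ht 12 (by decide)]; exact hFt.wt
    · rw [ht 5 (by decide)]; exact hFt.rows
  · rw [hv] at he
    rw [id, if_neg (by omega)]
    refine ⟨?_, ?_, h.mem, ?_, ?_⟩
    · rw [ht 0 (by decide), hFt.input]
    · rw [ht 5 (by decide)]; exact hFt.clean
    · rw [← h.out]
      funext c
      rw [output, output, ht 1 (by decide), ht 2 (by decide), hkeep 1 rfl, hkeep 2 rfl]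
    · rw [ht 13 (by decide), hkeep 13 rfl, h.wt]

/-- The program `p` makes `n` steps of the chain. -/
def Advances (x : Triple) (b n : ℕ) (p : Prog) : Prop :=
  ∀ T s, Current x b T s → Lift (Current x b) (iterate (metStep x) n T) (p.exec x s)

theorem Advances.loop {n m : ℕ} {p : Prog} {e : Expr} (hp : Advances x b n p)
    (he : ∀ s, s 0 = initMem x b 0 → e.val x s = m) : Advances x b (m * n) (.loop e p) := by
  intro T s h
  rw [exec_loop, he s h.input]
  clear he
  induction m generalizing T s with
  | zero =>
    rw [Nat.zero_mul]
    exact Lift.pure h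
  | succ m ih =>
    rw [Nat.succ_mul, Nat.add_comm, iterate_add, iterate]
    exact (hp T s h).bind fun T' s' _ _ h' => ih T' s' h'

theorem advances_powLoop (x : Triple) (b n : ℕ) :
    Advances x b ((x.k + 1) ^ n) (powLoop metropolis n) := by
  induction n with
  | zero =>
    intro T s h
    rw [pow_zero, iterate_one]
    exact metropolis_lift h
  | succ n ih =>
    rw [pow_succ']
    exact ih.loop fun s hs => by simp [Expr.val, hs, initMem]

theorem sampler_lift (x : Triple) (b C : ℕ) :
    Lift (Current x b) (chainLaw x (b * (x.k + 1) ^ C)) ((sampler C).exec x (initMem x b)) := by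
  rw [sampler, exec_block_cons, chainLaw]
  refine (generate_lift rfl fun i _ => by simp [initMem]).bind fun F t hF _ hFt => ?_
  refine Lift.cons (accept_current hFt (svGen_support hF)) fun t1 h1 => ?_
  rw [exec_block_cons, show (block []).exec x = PMF.pure from funext fun t => exec_block_nil,
    PMF.bind_pure]
  exact (advances_powLoop x b C).loop (fun s hs => by simp [Expr.val, hs, initMem]) F t1 h1

/-- The final memory determines the tableau, so the coupling becomes an equality of laws. -/
theorem sample_sampler (x : Triple) (C : ℕ) (δ : ℝ) :
    (sampler C).sample x δ = chainLaw x (biasInput δ * (x.k + 1) ^ C) := by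
  rw [← (sampler_lift x (biasInput δ) C).map_eq fun T s h => h.out, Prog.exec, PMF.map_comp]
  rfl

end Generation

/-! ### The accuracy parameter and the conclusion. -/

section Main

theorem exp_neg_biasInput_le {δ : ℝ} (h0 : 0 < δ) (h1 : δ ≤ 1) :
    Real.exp (-(biasInput δ : ℝ)) ≤ δ := by
  have hL : 0 ≤ Real.log δ⁻¹ := Real.log_nonneg ((one_le_inv₀ h0).2 h1)
  have h2 : Real.log δ⁻¹ ≤ biasInput δ := by
    refine le_trans ?_ (Nat.le_ceil _)
    rw [Real.logb, le_div_iff₀ (Real.log_pos one_lt_two)]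
    -- As log 2 < 1, the natural logarithm of δ⁻¹ is at most its binary logarithm.
    have := Real.log_two_lt_d9
    nlinarith
  rw [Real.log_inv] at h2
  rw [← Real.le_log_iff_exp_le h0]
  linarith

theorem biasInput_le {δ : ℝ} (h0 : 0 < δ) (h1 : δ ≤ 1) :
    (biasInput δ : ℝ) ≤ 2 * Real.log δ⁻¹ + 1 := by
  have hL : 0 ≤ Real.log δ⁻¹ := Real.log_nonneg ((one_le_inv₀ h0).2 h1)
  have hlog := Real.log_two_gt_d9
  have h2 : Real.logb 2 δ⁻¹ ≤ 2 * Real.log δ⁻¹ := by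
    rw [Real.logb, div_le_iff₀ (Real.log_pos one_lt_two)]
    nlinarith
  have h3 : 0 ≤ Real.logb 2 δ⁻¹ := div_nonneg hL (Real.log_pos one_lt_two).le
  have := (Nat.ceil_lt_add_one h3).le
  rw [biasInput]
  linarith

theorem isFPAUS_of_subset {C : ℕ} {𝓕 : Set Triple} (h𝓕 : 𝓕 ⊆ fixEmpty C ∪ fixExcess C) :
    IsFPAUS 𝓕 := by
  refine ⟨sampler C, (sampler C).bound, fun x hx δ h0 h1 => ⟨?_, ?_, ?_, ?_⟩⟩
  · rw [sample_sampler]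
    exact chainLaw_support x _
  · refine ⟨biasInput δ * (x.k + 1) ^ C, fun T => ?_⟩
    rw [sample_sampler, chainLaw_apply]
  · have hR : 1 ≤ (x.k + 1) ^ C := Nat.one_le_pow _ _ (by omega)
    have h2 : (fun T : SVT x => ((sampler C).sample x δ T.1).toReal) =
        Matrix.vecMul (probSVG x) (mcSVT x ^ ((x.k + 1) ^ C * biasInput δ)) := by
      funext T
      rw [sample_sampler, chainLaw_apply, mul_comm]
    rw [h2]
    -- R b steps with R = (k+1)^C bring the distance below exp(-b), where b is the accuracy
    -- parameter.
    refine (tvDist_chain_le (R := ((x.k + 1) ^ C : ℕ)) (by exact_mod_cast hR) (fun T => ?_)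
      (sum_probSVG x) (fun T => (probSVG_pos T).le) _).trans
        ((one_sub_inv_pow_le hR _).trans (exp_neg_biasInput_le h0 h1))
    have := one_le_card_mul_prob (h𝓕 hx) T
    exact_mod_cast this
  · intro r hr
    have hL : 0 ≤ Real.log δ⁻¹ := Real.log_nonneg ((one_le_inv₀ h0).2 h1)
    refine (Prog.cost_le_bound (b := biasInput δ) ?_ rfl (biasInput_le h0 h1) (static_sampler C)
      (s := initMem x (biasInput δ)) rfl r hr).2
    intro i
    fin_cases i
    · exact Nat.cast_nonneg _
    · exact Nat.cast_nonneg _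
    · exact hL

end Main

end SetValued

end

theorem theorem5p7 (C : ℕ) :
    (SetValued.RapidlyMixing (SetValued.fixEmpty C) ∧
      SetValued.IsFPAUS (SetValued.fixEmpty C)) ∧
    (SetValued.RapidlyMixing (SetValued.fixExcess C) ∧
      SetValued.IsFPAUS (SetValued.fixExcess C)) := by
  exact ⟨⟨SetValued.rapidlyMixing_of_subset Set.subset_union_left,
      SetValued.isFPAUS_of_subset Set.subset_union_left⟩,
    SetValued.rapidlyMixing_of_subset Set.subset_union_right,
    SetValued.isFPAUS_of_subset Set.subset_union_right⟩
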